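/- **Setting.** Let $d\in\{1,2,3\}$ and let $\Omega\subset\mathbb R^d$ be open, bounded, connected and polytopal, with $\partial\Omega=\overline{\Gamma^D}\cup\overline{\Gamma^N}$, $\Gamma^D,\Gamma^N\subset\partial\Omega$ disjoint, $|\Gamma^D|>0$. The physical data are the following. * *Statistics.* $a\in\,]0,+\infty]$, $I_h=\,]0,a[$, and $h\in C^1(I_h)$ with $h'>0$, $\lim_0h=-\infty$, $\lim_ah=+\infty$. The inverse $g=h^{-1}:\mathbb R\to I_h$ satisfies $g'\le g_0\,g$ for some $g_0>0$. $H$ is a primitive of $h$ on $I_h$. * *Recombination.* $R(N,P)=r(N,P)\,(e^{h(N)+h(P)}-1)$ with $r\ge0$, possibly depending on $x\in\Omega$, continuous in $(N,P)\in I_h^2$ and integrable in $x$. * *Tensors and doping.* Bounded measurable tensor fields $\Lambda_N,\Lambda_P$ (not necessarily symmetric) and $\Lambda_\phi$ (symmetric) on $\Omega$, all uniformly elliptic; $C\in L^\infty(\Omega)$. * *Initial and boundary data.* $N^{in},P^{in}\in L^\infty(\Omega)$, $N^D,P^D\in H^1(\Omega)$, $\phi^D\in H^1(\Omega)\cap L^\infty(\Omega)$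 such that, for some $0<m_0<M_0<a$, $m_0\le N^{in},P^{in},N^D,P^D\le M_0$ a.e. in $\Omega$. There are constants $\alpha_N,\alpha_P$ with $h(N^D)-\phi^D=\alpha_N$ and $h(P^D)+\phi^D=\alpha_P$ on $\Gamma^D$, and $\alpha_N+\alpha_P=0$ if $r\neq0$. **Mesh.** $\mathcal D$ consists of three finite families. * *Cells* $\mathcal M$: nonempty, disjoint, open polytopal sets $K\subset\Omega$ with $\overline\Omega=\bigcup_K\overline K$. * *Faces* $\mathcal E$: nonempty, disjoint, connected sets $\sigma$, each relatively open in a hyperplane $\mathcal H_\sigma$, with relative boundary of zero surface measure. Each $K$ has a set of faces $\mathcal E_K\subset\mathcal E$ with $\partial K=\bigcup_{\sigma\in\mathcal E_K}\overline\sigma$. Each face either belongs to exactly one cell and lies in $\partial\Omega$, or belongs to exactly two cells and lies in $\Omega$. Each boundary face lies in $\Gamma^D$ or in $\Gamma^N$. * *Centres* $x_K\in K$: $K$ is star-shaped with respect to $x_K$ and $d_{K,\sigma}=\mathrm{dist}(x_K,\mathcal H_\sigma)>0$ for $\sigma\in\mathcal E_K$. Write $\overline x_\sigma$ for the barycentre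 of $\sigma$, $n_{K,\sigma}$ for the outward unit normal, and $P_{K,\sigma}$ for the open pyramid of base $\sigma$ and apex $x_K$. Let $V=\mathbb R^{\mathcal M}\times\mathbb R^{\mathcal E}$ and let $V_0$ be the set of $v\in V$ with $v_\sigma=0$ on all boundary faces $\sigma\subset\Gamma^D$. For $v\in V$, $v_{\mathcal M}$ is the function equal to $v_K$ on each cell $K$. Functions act on $V$ coordinatewise. $\phi^D_{\mathcal D}\in V$ collects the averages of $\phi^D$ on cells and (of its trace) on faces. **Discrete forms.** Fix $\eta>0$ and a continuous $m:I_h^2\to I_h$ with $m_h(x,y)\le m(x,y)\le\max(x,y)$, where $m_h(x,x)=x$ and $m_h(x,y)=\frac{[xh(x)-H(x)]-[yh(y)-H(y)]}{h(x)-h(y)}$ for $x\ne y$. Set $$G_Kv=\tfrac1{|K|}\sum_{\sigma\in\mathcal E_K}|\sigma|(v_\sigma-v_K)n_{K,\sigma},\qquad \nabla_{K,\sigma}v=G_Kv+\tfrac{\eta}{d_{K,\sigma}}\big(v_\sigma-v_K-G_Kv\cdot(\overline x_\sigma-x_K)\big)n_{K,\sigma},$$ $$a_K^\Lambda(u,v)=\sum_{\sigma\in\mathcal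 E_K}\int_{P_{K,\sigma}}\nabla_{K,\sigma}v\cdot\Lambda\nabla_{K,\sigma}u,\qquad a^\Lambda=\sum_Ka_K^\Lambda,$$ $$T^\Lambda(u,w,v)=\sum_K r_K(u)\,a_K^\Lambda(w,v),\qquad r_K(u)=\tfrac1{|\mathcal E_K|}\sum_{\sigma\in\mathcal E_K}m(u_K,u_\sigma),$$ and $L(v)=\int_\Omega Cv_{\mathcal M}-a^{\Lambda_\phi}(\phi^D_{\mathcal D},v)$. **Scheme.** Let $\Delta t>0$. A solution is a sequence $(N^n,P^n,\phi^n)_{n\ge0}$ in $V^3$ such that: * $N^0_K=\frac1{|K|}\int_KN^{in}$ and $P^0_K=\frac1{|K|}\int_KP^{in}$ for all $K$; * for all $n\ge0$, $\phi^n-\phi^D_{\mathcal D}\in V_0$ and $a^{\Lambda_\phi}(\phi^n-\phi^D_{\mathcal D},v)-L(v)=\int_\Omega(P^n_{\mathcal M}-N^n_{\mathcal M})v_{\mathcal M}$ for all $v\in V_0$ (for $n=0$ this determines $\phi^0$); * for all $n\ge0$, $N^{n+1},P^{n+1}$ are $I_h$-valued, $w^{N,n+1}=h(N^{n+1})-\phi^{n+1}-\alpha_N\in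 V_0$, $w^{P,n+1}=h(P^{n+1})+\phi^{n+1}-\alpha_P\in V_0$, and for all $v\in V_0$ $$\int_\Omega\tfrac{N^{n+1}_{\mathcal M}-N^n_{\mathcal M}}{\Delta t}v_{\mathcal M}+T^{\Lambda_N}(N^{n+1},w^{N,n+1},v)=-\int_\Omega R(N^{n+1}_{\mathcal M},P^{n+1}_{\mathcal M})v_{\mathcal M},$$ $$\int_\Omega\tfrac{P^{n+1}_{\mathcal M}-P^n_{\mathcal M}}{\Delta t}v_{\mathcal M}+T^{\Lambda_P}(P^{n+1},w^{P,n+1},v)=-\int_\Omega R(N^{n+1}_{\mathcal M},P^{n+1}_{\mathcal M})v_{\mathcal M}.$$ **Equilibrium and entropy.** The discrete thermal equilibrium is the triple $(N^e,P^e,\phi^e)\in V^3$ with $\phi^e-\phi^D_{\mathcal D}\in V_0$, $N^e=g(\alpha_N+\phi^e)$, $P^e=g(\alpha_P-\phi^e)$ and $$a^{\Lambda_\phi}(\phi^e-\phi^D_{\mathcal D},v)=L(v)+\int_\Omega\big[g(\alpha_P-\phi^e_{\mathcal M})-g(\alpha_N+\phi^e_{\mathcal M})\big]v_{\mathcal M}\qquad\forall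 v\in V_0.$$ The discrete relative entropy is $$\mathbb E^n=\int_\Omega\big[H(N^n_{\mathcal M})-H(N^e_{\mathcal M})-h(N^e_{\mathcal M})(N^n_{\mathcal M}-N^e_{\mathcal M})\big]+\int_\Omega\big[H(P^n_{\mathcal M})-H(P^e_{\mathcal M})-h(P^e_{\mathcal M})(P^n_{\mathcal M}-P^e_{\mathcal M})\big]+\tfrac12a^{\Lambda_\phi}(\phi^n-\phi^e,\phi^n-\phi^e).$$ **Theorem (discrete long-time behaviour).** The discrete thermal equilibrium exists and is unique. There exist $\nu>0$ and $c>0$, depending only on the data, on $\mathcal D$ and scheme parameters ($\eta$, $m$), and on $\Delta t$, such that every solution of the scheme satisfies, for all $n\in\mathbb N$, $$\mathbb E^{n+1}\le(1+\nu\Delta t)^{-1}\,\mathbb E^n,$$ $$\|N^n_{\mathcal M}-N^e_{\mathcal M}\|_{L^2(\Omega)}^2+\|P^n_{\mathcal M}-P^e_{\mathcal M}\|_{L^2(\Omega)}^2+\|\phi^n_{\mathcal M}-\phi^e_{\mathcal M}\|_{L^2(\Omega)}^2\le c\,\mathbb E^0\,(1+\nu\Delta t)^{-n}.$$ -/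

import Mathlib

open MeasureTheory Set Filter Topology
open scoped ContDiff RealInnerProductSpace

noncomputable section

namespace HFV

/-- The space `ℝ^d` with its Euclidean structure. -/
abbrev Pt (d : ℕ) := EuclideanSpace ℝ (Fin d)

/-! ### Sobolev functions and traces -/

/-- `u ∈ H¹(Ω)`: `u` is square integrable on `Ω` and has a square integrable weak gradient. -/
def MemH1 {d : ℕ} (Ω : Set (Pt d)) (u : Pt d → ℝ) : Prop :=
  MemLp u 2 (volume.restrict Ω) ∧
    ∃ w : Pt d → Pt d, MemLp w 2 (volume.restrict Ω) ∧
      ∀ θ : Pt d → ℝ, ContDiff ℝ ∞ θ → HasCompactSupport θ → tsupport θ ⊆ Ω →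
        ∀ e : Pt d, ∫ x in Ω, u x * fderiv ℝ θ x e = - ∫ x in Ω, ⟪w x, e⟫ * θ x

/-- The trace of `u : Ω → ℝ` at a point `x` of the closure of `Ω`: the limit of the averages of `u`
over `Ω ∩ B(x, r)` as `r → 0⁺`.  For `u ∈ H¹(Ω)` and a polytopal `Ω` the limit exists for almost
every point (for the surface measure) of any hyperplane piece contained in `Ω` or in `∂Ω`, and it is
the Sobolev trace. -/
def trace {d : ℕ} (Ω : Set (Pt d)) (u : Pt d → ℝ) (x : Pt d) : ℝ :=
  limUnder (𝓝[>] (0 : ℝ)) fun r => ⨍ y in Ω ∩ Metric.ball x r, u y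

/-- The `(d-1)`-dimensional surface measure on `ℝ^d` (normalised Hausdorff measure; it is the
counting measure when `d = 1`). -/
def surf (d : ℕ) : Measure (Pt d) := μHE[d - 1]

/-- The square of the `L²(Ω)` norm. -/
def l2NormSq {d : ℕ} (Ω : Set (Pt d)) (f : Pt d → ℝ) : ℝ := ∫ x in Ω, f x ^ 2

/-! ### Statistics -/

/-- The interval `]0, a[` of admissible densities, for `a ∈ ]0, +∞]`. -/
def admissible (a : EReal) : Set ℝ := {x | 0 < x ∧ (x : EReal) < a}

/-- A statistics function `h : ]0, a[ → ℝ` (only its values on `]0, a[` matter), which is an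
increasing bijection onto `ℝ`, with inverse `g`. -/
structure Statistics where
  a : EReal
  a_pos : 0 < a
  h : ℝ → ℝ
  h_contDiff : ContDiffOn ℝ 1 h (admissible a)
  h_deriv_pos : ∀ x ∈ admissible a, 0 < deriv h x
  h_tendsto_zero : Tendsto h (𝓝[>] 0) atBot
  h_tendsto_a : Tendsto h (comap (fun x : ℝ => (x : EReal)) (𝓝[<] a)) atTop
  /-- `g' ≤ g₀ g` on `ℝ` for some constant `g₀ > 0`, where `g = h⁻¹`. -/
  inverse_deriv_le : ∃ g₀ : ℝ, 0 < g₀ ∧ ∀ s : ℝ,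
    deriv (Function.invFunOn h (admissible a)) s ≤ g₀ * Function.invFunOn h (admissible a) s

namespace Statistics

/-- The set `I_h = ]0, a[`. -/
def I (S : Statistics) : Set ℝ := admissible S.a

/-- The inverse function `g = h⁻¹ : ℝ → I_h`. -/
def g (S : Statistics) : ℝ → ℝ := Function.invFunOn S.h S.I

open Classical in
/-- Base point of the primitive `H`: it is `1` if `1 ∈ I_h`, and `a / 2` otherwise. -/
def base (S : Statistics) : ℝ := if 1 < S.a then 1 else S.a.toReal / 2

/-- The primitive `H` of `h`. -/
def H (S : Statistics) (x : ℝ) : ℝ := ∫ s in S.base..x, S.h s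

/-- The density `H(x) - H(y) - h(y)(x - y)` of the relative entropy. -/
def relH (S : Statistics) (x y : ℝ) : ℝ := S.H x - S.H y - S.h y * (x - y)

open Classical in
/-- The mean `m_h` associated with `h`. -/
def mh (S : Statistics) (x y : ℝ) : ℝ :=
  if x = y then x
  else ((x * S.h x - S.H x) - (y * S.h y - S.H y)) / (S.h x - S.h y)

/-- The admissible mean functions `m : I_h × I_h → I_h` used to reconstruct densities in cells. -/
structure IsMean (S : Statistics) (m : ℝ → ℝ → ℝ) : Prop where
  continuousOn : ContinuousOn (fun p : ℝ × ℝ => m p.1 p.2) (S.I ×ˢ S.I)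
  mem : ∀ x ∈ S.I, ∀ y ∈ S.I, m x y ∈ S.I
  mh_le : ∀ x ∈ S.I, ∀ y ∈ S.I, S.mh x y ≤ m x y
  le_max : ∀ x ∈ S.I, ∀ y ∈ S.I, m x y ≤ max x y

end Statistics

/-! ### Domain and physical data -/

/-- The domain `Ω`: open, bounded, connected and polytopal (its boundary lies in finitely many
hyperplanes), with a boundary divided into a Dirichlet part of positive measure and a Neumann
part. -/
structure Domain (d : ℕ) where
  Ω : Set (Pt d)
  isOpen : IsOpen Ω
  isBounded : Bornology.IsBounded Ω
  isConnected : IsConnected Ω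
  polytopal : ∃ s : Finset (Pt d × ℝ), (∀ p ∈ s, p.1 ≠ 0) ∧
    frontier Ω ⊆ ⋃ p ∈ s, {x : Pt d | ⟪p.1, x⟫ = p.2}
  ΓD : Set (Pt d)
  ΓN : Set (Pt d)
  disjoint : Disjoint ΓD ΓN
  ΓD_subset : ΓD ⊆ frontier Ω
  ΓN_subset : ΓN ⊆ frontier Ω
  frontier_eq : frontier Ω = closure ΓD ∪ closure ΓN
  ΓD_pos : 0 < surf d ΓD

/-- A (possibly nonsymmetric) tensor field `Λ ∈ L^∞(Ω, ℝ^{d×d})` which satisfies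
`lo |ξ|² ≤ ξ · Λ ξ` and `|Λ ξ| ≤ hi |ξ|` almost everywhere in `Ω`. -/
structure IsDiffusionTensor {d : ℕ} (Ω : Set (Pt d)) (Λ : Pt d → Pt d →L[ℝ] Pt d)
    (lo hi : ℝ) : Prop where
  meas : AEStronglyMeasurable Λ (volume.restrict Ω)
  lower : ∀ᵐ x ∂volume.restrict Ω, ∀ ξ : Pt d, lo * ‖ξ‖ ^ 2 ≤ ⟪ξ, Λ x ξ⟫
  upper : ∀ᵐ x ∂volume.restrict Ω, ∀ ξ : Pt d, ‖Λ x ξ‖ ≤ hi * ‖ξ‖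

/-- A symmetric tensor field `Λ ∈ L^∞(Ω, ℝ^{d×d})` which satisfies
`lo |ξ|² ≤ ξ · Λ ξ ≤ hi |ξ|²` almost everywhere in `Ω`. -/
structure IsSymmDiffusionTensor {d : ℕ} (Ω : Set (Pt d)) (Λ : Pt d → Pt d →L[ℝ] Pt d)
    (lo hi : ℝ) : Prop where
  meas : AEStronglyMeasurable Λ (volume.restrict Ω)
  symm : ∀ᵐ x ∂volume.restrict Ω, ∀ ξ ζ : Pt d, ⟪Λ x ξ, ζ⟫ = ⟪ξ, Λ x ζ⟫
  lower : ∀ᵐ x ∂volume.restrict Ω, ∀ ξ : Pt d, lo * ‖ξ‖ ^ 2 ≤ ⟪ξ, Λ x ξ⟫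
  upper : ∀ᵐ x ∂volume.restrict Ω, ∀ ξ : Pt d, ⟪ξ, Λ x ξ⟫ ≤ hi * ‖ξ‖ ^ 2

/-- The physical data of the drift-diffusion system on a domain. -/
structure PhysicalData {d : ℕ} (dom : Domain d) where
  /-- the statistics `h` -/
  stat : Statistics
  /-- the recombination coefficient `r(x, N, P)` -/
  r : Pt d → ℝ → ℝ → ℝ
  r_nonneg : ∀ x ∈ dom.Ω, ∀ n ∈ stat.I, ∀ p ∈ stat.I, 0 ≤ r x n p
  r_continuous : ∀ x ∈ dom.Ω,
    ContinuousOn (fun q : ℝ × ℝ => r x q.1 q.2) (stat.I ×ˢ stat.I)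
  r_integrable : ∀ n ∈ stat.I, ∀ p ∈ stat.I, IntegrableOn (fun x => r x n p) dom.Ω
  /-- the permittivity `Λ_φ` -/
  Λφ : Pt d → Pt d →L[ℝ] Pt d
  Λφ_tensor : ∃ lo hi : ℝ, 0 < lo ∧ lo ≤ hi ∧ IsSymmDiffusionTensor dom.Ω Λφ lo hi
  /-- the diffusion tensors `Λ_N`, `Λ_P` -/
  ΛN : Pt d → Pt d →L[ℝ] Pt d
  ΛP : Pt d → Pt d →L[ℝ] Pt d
  ΛNP_tensor : ∃ lo hi : ℝ, 0 < lo ∧ lo ≤ hi ∧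
    IsDiffusionTensor dom.Ω ΛN lo hi ∧ IsDiffusionTensor dom.Ω ΛP lo hi
  /-- the doping profile `C ∈ L^∞(Ω)` -/
  C : Pt d → ℝ
  C_memLp : MemLp C ⊤ (volume.restrict dom.Ω)
  /-- the boundary data, given through liftings on `Ω` -/
  ND : Pt d → ℝ
  PD : Pt d → ℝ
  φD : Pt d → ℝ
  ND_memH1 : MemH1 dom.Ω ND
  PD_memH1 : MemH1 dom.Ω PD
  φD_memH1 : MemH1 dom.Ω φD
  φD_memLp : MemLp φD ⊤ (volume.restrict dom.Ω)
  /-- the initial densities -/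
  Nin : Pt d → ℝ
  Pin : Pt d → ℝ
  Nin_memLp : MemLp Nin ⊤ (volume.restrict dom.Ω)
  Pin_memLp : MemLp Pin ⊤ (volume.restrict dom.Ω)
  bounds : ∃ lo hi : ℝ, 0 < lo ∧ lo < hi ∧ (hi : EReal) < stat.a ∧
    ∀ᵐ x ∂volume.restrict dom.Ω, Nin x ∈ Icc lo hi ∧ Pin x ∈ Icc lo hi ∧
      ND x ∈ Icc lo hi ∧ PD x ∈ Icc lo hi
  /-- the constants of the compatibility conditions `h(N^D) - φ^D = α_N` and `h(P^D) + φ^D = α_P`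
  on `Γ^D`, and `α_N + α_P = 0` unless `r = 0` -/
  αN : ℝ
  αP : ℝ
  compat_N : ∀ᵐ x ∂surf d, x ∈ dom.ΓD →
    stat.h (trace dom.Ω ND x) - trace dom.Ω φD x = αN
  compat_P : ∀ᵐ x ∂surf d, x ∈ dom.ΓD →
    stat.h (trace dom.Ω PD x) + trace dom.Ω φD x = αP
  compat_r : (¬ ∀ n ∈ stat.I, ∀ p ∈ stat.I, ∀ᵐ x ∂volume.restrict dom.Ω, r x n p = 0) →
    αN + αP = 0

/-- The recombination-generation rate `R(N, P) = r(N, P) (exp(h(N) + h(P)) - 1)`. -/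
def PhysicalData.R {d : ℕ} {dom : Domain d} (data : PhysicalData dom) (x : Pt d) (n p : ℝ) : ℝ :=
  data.r x n p * (Real.exp (data.stat.h n + data.stat.h p) - 1)

/-! ### Meshes -/

/-- A discretisation of `Ω`: cells indexed by `𝓜`, faces indexed by `𝓔`, and cell centres. The face
`σ` lies in the hyperplane `{x | ⟪normal σ, x⟫ = offset σ}`, with a unit `normal σ` of arbitrary
orientation. -/
structure Discretisation {d : ℕ} (dom : Domain d) (𝓜 𝓔 : Type*) [Fintype 𝓜] [Fintype 𝓔] where
  cell : 𝓜 → Set (Pt d)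
  cell_isOpen : ∀ K, IsOpen (cell K)
  cell_nonempty : ∀ K, (cell K).Nonempty
  cell_subset : ∀ K, cell K ⊆ dom.Ω
  cell_disjoint : Pairwise fun K L => Disjoint (cell K) (cell L)
  closure_eq : closure dom.Ω = ⋃ K, closure (cell K)
  face : 𝓔 → Set (Pt d)
  normal : 𝓔 → Pt d
  offset : 𝓔 → ℝ
  norm_normal : ∀ σ, ‖normal σ‖ = 1
  /-- a face is a relatively open subset of its hyperplane -/
  face_open : ∀ σ, ∃ U : Set (Pt d), IsOpen U ∧ face σ = U ∩ {x | ⟪normal σ, x⟫ = offset σ}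
  face_connected : ∀ σ, IsConnected (face σ)
  face_disjoint : Pairwise fun σ τ => Disjoint (face σ) (face τ)
  /-- the faces partition the skeleton up to a set of zero surface measure -/
  face_boundary : ∀ σ, surf d (closure (face σ) \ face σ) = 0
  /-- the set `𝓔_K` of the faces of a cell `K` -/
  facesOf : 𝓜 → Finset 𝓔
  frontier_cell : ∀ K, frontier (cell K) = ⋃ σ ∈ facesOf K, closure (face σ)
  /-- a face is either a boundary face of one cell, or an interface between two cells -/
  face_cells : ∀ σ,
    ({K | σ ∈ facesOf K}.ncard = 1 ∧ face σ ⊆ frontier dom.Ω) ∨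
    ({K | σ ∈ facesOf K}.ncard = 2 ∧ face σ ⊆ dom.Ω)
  center : 𝓜 → Pt d
  center_mem : ∀ K, center K ∈ cell K
  starConvex : ∀ K, StarConvex ℝ (center K) (cell K)
  /-- the distance from `x_K` to the hyperplane of each face of `K` is positive -/
  center_notMem : ∀ K, ∀ σ ∈ facesOf K, ⟪normal σ, center K⟫ ≠ offset σ
  /-- compliance with the partition of the boundary -/
  compliant : ∀ σ, face σ ⊆ frontier dom.Ω → face σ ⊆ dom.ΓD ∨ face σ ⊆ dom.ΓN

/-- The hybrid discrete unknowns: one real number for each cell `K` (the value at `Sum.inl K`) and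
one for each face `σ` (the value at `Sum.inr σ`). -/
abbrev Vec (𝓜 𝓔 : Type*) := 𝓜 ⊕ 𝓔 → ℝ

namespace Discretisation

variable {d : ℕ} {dom : Domain d} {𝓜 𝓔 : Type*} [Fintype 𝓜] [Fintype 𝓔]

/-- The set `𝓔_ext^D` of Dirichlet boundary faces. -/
def dirichletFaces (D : Discretisation dom 𝓜 𝓔) : Set 𝓔 :=
  {σ | {K | σ ∈ D.facesOf K}.ncard = 1 ∧ D.face σ ⊆ dom.ΓD}

/-- The space `V_{D,0}` of the unknowns that vanish on the Dirichlet faces. -/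
def V0 (D : Discretisation dom 𝓜 𝓔) : Set (Vec 𝓜 𝓔) :=
  {v | ∀ σ ∈ D.dirichletFaces, v (Sum.inr σ) = 0}

/-- The piecewise constant function `v_𝓜`, equal to `v_K` on each cell `K`. -/
def recon (D : Discretisation dom 𝓜 𝓔) (v : Vec 𝓜 𝓔) (x : Pt d) : ℝ :=
  ∑ K, (D.cell K).indicator (fun _ => v (Sum.inl K)) x

/-- The hybrid interpolate of a function on `Ω`: averages over cells, and averages of the trace over
faces. -/
def interpolate (D : Discretisation dom 𝓜 𝓔) (u : Pt d → ℝ) : Vec 𝓜 𝓔 :=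
  Sum.elim (fun K => ⨍ x in D.cell K, u x)
    (fun σ => ⨍ x in D.face σ, trace dom.Ω u x ∂surf d)

/-- The measure `|K|`. -/
def cellMeas (D : Discretisation dom 𝓜 𝓔) (K : 𝓜) : ℝ := volume.real (D.cell K)

/-- The surface measure `|σ|`. -/
def faceMeas (D : Discretisation dom 𝓜 𝓔) (σ : 𝓔) : ℝ := (surf d).real (D.face σ)

/-- The barycentre of `σ`. -/
def faceCenter (D : Discretisation dom 𝓜 𝓔) (σ : 𝓔) : Pt d := ⨍ x in D.face σ, x ∂surf d

/-- The distance `d_{K,σ}` from `x_K` to the hyperplane of `σ`. -/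
def dist (D : Discretisation dom 𝓜 𝓔) (K : 𝓜) (σ : 𝓔) : ℝ :=
  |D.offset σ - ⟪D.normal σ, D.center K⟫|

/-- The unit normal `n_{K,σ}` to `σ` pointing outward `K`. As `K` is star-shaped with respect to
`x_K`, it is the unit normal that points from `x_K` towards the hyperplane of `σ`. -/
def outward (D : Discretisation dom 𝓜 𝓔) (K : 𝓜) (σ : 𝓔) : Pt d :=
  Real.sign (D.offset σ - ⟪D.normal σ, D.center K⟫) • D.normal σ

/-- The open pyramid `P_{K,σ}` with base `σ` and apex `x_K`. -/
def pyramid (D : Discretisation dom 𝓜 𝓔) (K : 𝓜) (σ : 𝓔) : Set (Pt d) :=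
  {x | ∃ y ∈ D.face σ, ∃ t ∈ Ioo (0 : ℝ) 1, x = D.center K + t • (y - D.center K)}

/-- The consistent part `G_K` of the discrete gradient. -/
def gradCons (D : Discretisation dom 𝓜 𝓔) (K : 𝓜) (v : Vec 𝓜 𝓔) : Pt d :=
  (D.cellMeas K)⁻¹ • ∑ σ ∈ D.facesOf K,
    (D.faceMeas σ * (v (Sum.inr σ) - v (Sum.inl K))) • D.outward K σ

/-- The discrete gradient `∇_{K,σ} = G_K + S_{K,σ}` on `P_{K,σ}`, with the stabilisation `S_{K,σ}` of
parameter `η`. -/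
def grad (D : Discretisation dom 𝓜 𝓔) (η : ℝ) (K : 𝓜) (σ : 𝓔) (v : Vec 𝓜 𝓔) : Pt d :=
  D.gradCons K v +
    (η / D.dist K σ * (v (Sum.inr σ) - v (Sum.inl K)
      - ⟪D.gradCons K v, D.faceCenter σ - D.center K⟫)) • D.outward K σ

/-- The local bilinear form `a_K^Λ(u, v) = ∫_K ∇_K v · Λ ∇_K u`. -/
def aLoc (D : Discretisation dom 𝓜 𝓔) (η : ℝ) (Λ : Pt d → Pt d →L[ℝ] Pt d) (K : 𝓜)
    (u v : Vec 𝓜 𝓔) : ℝ :=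
  ∑ σ ∈ D.facesOf K, ∫ x in D.pyramid K σ, ⟪D.grad η K σ v, Λ x (D.grad η K σ u)⟫

/-- The global bilinear form `a_D^Λ`. -/
def aForm (D : Discretisation dom 𝓜 𝓔) (η : ℝ) (Λ : Pt d → Pt d →L[ℝ] Pt d)
    (u v : Vec 𝓜 𝓔) : ℝ :=
  ∑ K, D.aLoc η Λ K u v

/-- The local reconstruction operator `r_K` built on the mean function `m`. -/
def rLoc (D : Discretisation dom 𝓜 𝓔) (m : ℝ → ℝ → ℝ) (K : 𝓜) (u : Vec 𝓜 𝓔) : ℝ :=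
  (∑ σ ∈ D.facesOf K, m (u (Sum.inl K)) (u (Sum.inr σ))) / (D.facesOf K).card

/-- The form `T_D^Λ(u, w, v) = ∑_K r_K(u_K) a_K^Λ(w_K, v_K)`. -/
def T (D : Discretisation dom 𝓜 𝓔) (η : ℝ) (m : ℝ → ℝ → ℝ) (Λ : Pt d → Pt d →L[ℝ] Pt d)
    (u w v : Vec 𝓜 𝓔) : ℝ :=
  ∑ K, D.rLoc m K u * D.aLoc η Λ K w v

end Discretisation

/-! ### The schemes -/

section Scheme

variable {d : ℕ} {dom : Domain d} {𝓜 𝓔 : Type*} [Fintype 𝓜] [Fintype 𝓔]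
  (data : PhysicalData dom) (D : Discretisation dom 𝓜 𝓔)

/-- The linear form `L_D^φ(v) = ∫_Ω C v_𝓜 - a_D^φ(φ_D^D, v)`. -/
def Lφ (η : ℝ) (v : Vec 𝓜 𝓔) : ℝ :=
  (∫ x in dom.Ω, data.C x * D.recon v x) - D.aForm η data.Λφ (D.interpolate data.φD) v

/-- The discrete thermal equilibrium `(N^e, P^e, φ^e)`: `φ^e = φ_D^D + ψ^e`, where `ψ^e ∈ V_{D,0}`
solves the scheme for the nonlinear Poisson equation, and `N^e = g(α_N + φ^e)`,
`P^e = g(α_P - φ^e)`. -/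
structure IsThermalEquilibrium (η : ℝ) (Ne Pe φe : Vec 𝓜 𝓔) : Prop where
  psi_mem : φe - D.interpolate data.φD ∈ D.V0
  poisson : ∀ v ∈ D.V0,
    D.aForm η data.Λφ (φe - D.interpolate data.φD) v = Lφ data D η v
      + ∫ x in dom.Ω, (data.stat.g (data.αP - D.recon φe x)
          - data.stat.g (data.αN + D.recon φe x)) * D.recon v x
  eq_N : ∀ i, Ne i = data.stat.g (data.αN + φe i)
  eq_P : ∀ i, Pe i = data.stat.g (data.αP - φe i)

/-- The discrete quasi-Fermi potential `w^N = h(N) - φ - α_N`. -/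
def wN (N φ : Vec 𝓜 𝓔) : Vec 𝓜 𝓔 := fun i => data.stat.h (N i) - φ i - data.αN

/-- The discrete quasi-Fermi potential `w^P = h(P) + φ - α_P`. -/
def wP (P φ : Vec 𝓜 𝓔) : Vec 𝓜 𝓔 := fun i => data.stat.h (P i) + φ i - data.αP

/-- Solutions of the hybrid finite volume scheme. The potential `φ^0` is the one associated with the
initial densities through the discrete Poisson equation; the face values of the densities at the
initial time play no role and are not prescribed. -/
structure IsSolution (η : ℝ) (m : ℝ → ℝ → ℝ) (Δt : ℝ) (N P φ : ℕ → Vec 𝓜 𝓔) : Prop where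
  init_N : ∀ K, N 0 (Sum.inl K) = ⨍ x in D.cell K, data.Nin x
  init_P : ∀ K, P 0 (Sum.inl K) = ⨍ x in D.cell K, data.Pin x
  mem_N : ∀ n i, N (n + 1) i ∈ data.stat.I
  mem_P : ∀ n i, P (n + 1) i ∈ data.stat.I
  wN_mem : ∀ n, wN data (N (n + 1)) (φ (n + 1)) ∈ D.V0
  wP_mem : ∀ n, wP data (P (n + 1)) (φ (n + 1)) ∈ D.V0
  psi_mem : ∀ n, φ n - D.interpolate data.φD ∈ D.V0
  eq_N : ∀ n, ∀ v ∈ D.V0,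
    (∫ x in dom.Ω, (D.recon (N (n + 1)) x - D.recon (N n) x) / Δt * D.recon v x)
      + D.T η m data.ΛN (N (n + 1)) (wN data (N (n + 1)) (φ (n + 1))) v
      = - ∫ x in dom.Ω,
          data.R x (D.recon (N (n + 1)) x) (D.recon (P (n + 1)) x) * D.recon v x
  eq_P : ∀ n, ∀ v ∈ D.V0,
    (∫ x in dom.Ω, (D.recon (P (n + 1)) x - D.recon (P n) x) / Δt * D.recon v x)
      + D.T η m data.ΛP (P (n + 1)) (wP data (P (n + 1)) (φ (n + 1))) v
      = - ∫ x in dom.Ω,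
          data.R x (D.recon (N (n + 1)) x) (D.recon (P (n + 1)) x) * D.recon v x
  poisson : ∀ n, ∀ v ∈ D.V0,
    D.aForm η data.Λφ (φ n - D.interpolate data.φD) v - Lφ data D η v
      = ∫ x in dom.Ω, (D.recon (P n) x - D.recon (N n) x) * D.recon v x

/-- The discrete entropy of `(N, P, φ)` relative to `(N^e, P^e, φ^e)`. -/
def entropy (η : ℝ) (Ne Pe φe N P φ : Vec 𝓜 𝓔) : ℝ :=
  (∫ x in dom.Ω, data.stat.relH (D.recon N x) (D.recon Ne x))
    + (∫ x in dom.Ω, data.stat.relH (D.recon P x) (D.recon Pe x))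
    + 1 / 2 * D.aForm η data.Λφ (φ - φe) (φ - φe)

end Scheme

end HFV

end

/-! The proof is the entropy method, with constants drawn from finite dimension and compactness.
Test the two balance equations with w^N and w^P. By convexity of H, symmetry of Λ_φ and the discrete
Poisson equation, the couplings with φ cancel, and E^{n+1} + Δt·D^{n+1} ≤ E^n remains, where D =
T(N, w^N, w^N) + T(P, w^P, w^P). Recombination has the good sign because α_N + α_P = 0 unless r = 0
(`IsSolution.entropy_add_le`). Decay is then reduced to ν·E ≤ D, with ν uniform over all solutions.

This needs densities confined to a fixed compact part of I_h (`exists_uniform_bound`). The initial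
entropy is common to all solutions, so D ≤ E^0/Δt bounds every m_h(u_K, u_σ)(w_σ − w_K)². The mean
m_h(x, y) decays no faster than 1/|h(x) − h(y)| when h(y) is bounded, and h(u) − w is a bounded
potential. Hence a bound on |h(u)| passes from a cell to its faces and back, starting from the
Dirichlet faces, where w = 0. On the compact set so obtained the means are bounded below and h is
strongly increasing, so D controls w (`exists_sq_le_T`), w controls E
(`IsSolution.entropy_le_quasiFermi`), and E controls the L² distance (`exists_l2NormSq_le_entropy`).

Geometry enters through coercivity on V_0. A vanishing discrete gradient in a cell forces equal
values in the cell and on its faces: for d ≥ 2 by following a line orthogonal to G_K, for d = 1 by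
comparing lengths. The open faces then link every cell to Γ^D, since the rest of the skeleton is
null for the surface measure and cannot disconnect Ω (`mesh_induction`). The equilibrium potential
is a minimiser of a coercive energy, and is unique because g is increasing. -/

namespace HFV

/-! ### Statistics functions -/

namespace Statistics

variable (S : Statistics)

theorem isOpen_I : IsOpen S.I :=
  isOpen_Ioi.inter (isOpen_Iio.preimage continuous_coe_real_ereal)

theorem ordConnected_I : S.I.OrdConnected :=
  ⟨fun _ hx _ hy _ hz => ⟨hx.1.trans_le hz.1,
    (EReal.coe_le_coe_iff.2 hz.2).trans_lt hy.2⟩⟩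

theorem convex_I : Convex ℝ S.I :=
  S.ordConnected_I.convex

theorem continuousOn_h : ContinuousOn S.h S.I :=
  S.h_contDiff.continuousOn

theorem strictMonoOn_h : StrictMonoOn S.h S.I :=
  strictMonoOn_of_deriv_pos S.convex_I S.continuousOn_h fun x hx =>
    S.h_deriv_pos x (interior_subset hx)

theorem exists_h_lt (s : ℝ) : ∃ x ∈ S.I, S.h x < s := by
  have h1 : ∀ᶠ x in 𝓝[>] (0 : ℝ), S.h x < s := S.h_tendsto_zero.eventually (eventually_lt_atBot s)
  have h2 : ∀ᶠ x : ℝ in 𝓝 (0 : ℝ), (x : EReal) < S.a :=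
    (continuous_coe_real_ereal.tendsto (0 : ℝ)).eventually
      (isOpen_Iio.mem_nhds (by simpa using S.a_pos))
  obtain ⟨x, hx, hx2, hx3⟩ :=
    (h1.and ((h2.filter_mono nhdsWithin_le_nhds).and self_mem_nhdsWithin)).exists
  exact ⟨x, ⟨hx3, hx2⟩, hx⟩

theorem exists_lt_h (s : ℝ) : ∃ x ∈ S.I, s < S.h x := by
  have h1 : ∀ᶠ x in comap (fun x : ℝ => (x : EReal)) (𝓝[<] S.a), s < S.h x :=
    S.h_tendsto_a.eventually (eventually_gt_atTop s)
  rw [eventually_comap] at h1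
  have h3 : Ioo (0 : EReal) S.a ∈ 𝓝[<] S.a := Ioo_mem_nhdsLT S.a_pos
  -- The left neighbourhoods of a are taken in the extended reals, which covers a = +∞; a real point
  -- is then chosen between b and a.
  obtain ⟨b, hb, hb0⟩ := (nhdsLT_basis_of_exists_lt ⟨0, S.a_pos⟩).eventually_iff.1
    (h1.and h3)
  obtain ⟨y, hy, hya⟩ := EReal.lt_iff_exists_real_btwn.1 hb
  have := hb0 (show (y : EReal) ∈ Ioo b S.a from ⟨hy, hya⟩)
  exact ⟨y, ⟨by exact_mod_cast this.2.1, hya⟩, this.1 y rfl⟩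

theorem surjOn_h : SurjOn S.h S.I univ := by
  intro s _
  obtain ⟨x, hx, hxs⟩ := S.exists_h_lt s
  obtain ⟨y, hy, hys⟩ := S.exists_lt_h s
  exact S.convex_I.isPreconnected.intermediate_value hx hy S.continuousOn_h ⟨hxs.le, hys.le⟩

theorem g_mem (s : ℝ) : S.g s ∈ S.I :=
  Function.invFunOn_mem (S.surjOn_h (mem_univ s))

@[simp] theorem h_g (s : ℝ) : S.h (S.g s) = s :=
  Function.invFunOn_eq (S.surjOn_h (mem_univ s))

theorem g_h {x : ℝ} (hx : x ∈ S.I) : S.g (S.h x) = x :=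
  S.strictMonoOn_h.injOn (S.g_mem _) hx (S.h_g _)

theorem strictMono_g : StrictMono S.g := fun s t hst =>
  (S.strictMonoOn_h.lt_iff_lt (S.g_mem s) (S.g_mem t)).1 (by simpa using hst)

theorem g_pos (s : ℝ) : 0 < S.g s := (S.g_mem s).1

theorem range_g : range S.g = S.I :=
  Subset.antisymm (range_subset_iff.2 S.g_mem) fun x hx => ⟨S.h x, S.g_h hx⟩

theorem continuous_g : Continuous S.g := by
  refine continuous_iff_continuousAt.2 fun s => ?_
  refine (S.strictMono_g.strictMonoOn univ).continuousAt_of_image_mem_nhds univ_mem ?_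
  rw [image_univ, S.range_g]
  exact S.isOpen_I.mem_nhds (S.g_mem s)

theorem le_h_iff {x s : ℝ} (hx : x ∈ S.I) : s ≤ S.h x ↔ S.g s ≤ x := by
  rw [← S.strictMono_g.le_iff_le, S.g_h hx]

theorem h_le_iff {x s : ℝ} (hx : x ∈ S.I) : S.h x ≤ s ↔ x ≤ S.g s := by
  rw [← S.strictMono_g.le_iff_le, S.g_h hx]

theorem base_mem : S.base ∈ S.I := by
  unfold base
  split_ifs with h
  · exact ⟨one_pos, by exact_mod_cast h⟩
  · have h0 := S.a_pos
    rw [not_lt] at h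
    obtain ⟨b, hb⟩ : ∃ b : ℝ, S.a = b :=
      ⟨S.a.toReal, (EReal.coe_toReal (ne_top_of_le_ne_top (EReal.coe_ne_top 1) (by simpa using h))
        (ne_bot_of_gt h0)).symm⟩
    rw [hb] at h0
    have hb0 : 0 < b := by exact_mod_cast h0
    refine ⟨by rw [hb, EReal.toReal_coe]; positivity, ?_⟩
    rw [hb, EReal.toReal_coe, EReal.coe_lt_coe_iff]
    linarith

theorem intervalIntegrable_h {x y : ℝ} (hx : x ∈ S.I) (hy : y ∈ S.I) :
    IntervalIntegrable S.h volume x y :=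
  (S.continuousOn_h.mono (S.ordConnected_I.uIcc_subset hx hy)).intervalIntegrable

theorem H_sub_H {x y : ℝ} (hx : x ∈ S.I) (hy : y ∈ S.I) :
    S.H x - S.H y = ∫ s in y..x, S.h s :=
  intervalIntegral.integral_interval_sub_left (S.intervalIntegrable_h S.base_mem hx)
    (S.intervalIntegrable_h S.base_mem hy)

/-- Convexity of `H`. -/
theorem H_sub_H_le {x y : ℝ} (hx : x ∈ S.I) (hy : y ∈ S.I) :
    S.H x - S.H y ≤ S.h x * (x - y) := by
  rcases le_total y x with hxy | hxy
  · rw [S.H_sub_H hx hy]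
    have := intervalIntegral.integral_mono_on hxy (S.intervalIntegrable_h hy hx)
      (intervalIntegrable_const (c := S.h x)) fun s hs =>
        S.strictMonoOn_h.monotoneOn (S.ordConnected_I.out hy hx hs) hx hs.2
    rwa [intervalIntegral.integral_const, smul_eq_mul, mul_comm] at this
  · rw [← neg_le_neg_iff, neg_sub, S.H_sub_H hy hx]
    have := intervalIntegral.integral_mono_on hxy (intervalIntegrable_const (c := S.h x))
      (S.intervalIntegrable_h hx hy) fun s hs =>
        S.strictMonoOn_h.monotoneOn hx (S.ordConnected_I.out hx hy hs) hs.1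
    rw [intervalIntegral.integral_const, smul_eq_mul] at this
    linarith

theorem le_H_sub_H {x y : ℝ} (hx : x ∈ S.I) (hy : y ∈ S.I) :
    S.h y * (x - y) ≤ S.H x - S.H y := by
  linarith [S.H_sub_H_le hy hx]

theorem relH_nonneg {x y : ℝ} (hx : x ∈ S.I) (hy : y ∈ S.I) : 0 ≤ S.relH x y :=
  sub_nonneg.2 (S.le_H_sub_H hx hy)

/-- The right-hand side is `relH x y + relH y x`. -/
theorem relH_le {x y : ℝ} (hx : x ∈ S.I) (hy : y ∈ S.I) :
    S.relH x y ≤ (S.h x - S.h y) * (x - y) := by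
  unfold relH
  linarith [S.H_sub_H_le hx hy]

/-- The tangent to H is taken at the new state x', as suits an implicit time step. -/
theorem relH_sub_relH_le {x x' y : ℝ} (hx : x ∈ S.I) (hx' : x' ∈ S.I) :
    S.relH x' y - S.relH x y ≤ (S.h x' - S.h y) * (x' - x) := by
  unfold relH
  linarith [S.H_sub_H_le hx' hx]

/-- On a compact subinterval of `I_h`, `h` is strongly increasing. -/
theorem exists_mul_sq_le (l u : ℝ) (hl : l ∈ S.I) (hu : u ∈ S.I) :
    ∃ c > 0, ∀ x ∈ Icc l u, ∀ y ∈ Icc l u, c * (x - y) ^ 2 ≤ (S.h x - S.h y) * (x - y) := by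
  have hsub : Icc l u ⊆ S.I := S.ordConnected_I.out hl hu
  rcases (Icc l u).eq_empty_or_nonempty with he | hne
  · exact ⟨1, one_pos, fun x hx => by simp [he] at hx⟩
  have hcont : ContinuousOn (deriv S.h) S.I :=
    S.h_contDiff.continuousOn_deriv_of_isOpen S.isOpen_I le_rfl
  obtain ⟨z, hz, hzmin⟩ := isCompact_Icc.exists_isMinOn hne (hcont.mono hsub)
  refine ⟨deriv S.h z, S.h_deriv_pos z (hsub hz), ?_⟩
  have key : ∀ x ∈ Icc l u, ∀ y ∈ Icc l u, y ≤ x → deriv S.h z * (x - y) ≤ S.h x - S.h y := by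
    intro x hx y hy hxy
    refine (convex_Icc l u).mul_sub_le_image_sub_of_le_deriv (S.continuousOn_h.mono hsub) ?_ ?_
      y hy x hx hxy
    · exact ((S.h_contDiff.differentiableOn one_ne_zero).mono hsub).mono interior_subset
    · exact fun w hw => hzmin (interior_subset hw)
  intro x hx y hy
  rcases le_total y x with hxy | hxy
  · nlinarith [key x hx y hy hxy, sub_nonneg.2 hxy]
  · nlinarith [key y hy x hx hxy, sub_nonneg.2 hxy]

/-- With z the midpoint, the tangents to H at z and at y give relH(x, y) ≥ (h(z) − h(y))(z − y), and
strong monotonicity bounds this below by c((x − y)/2)². -/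
theorem exists_mul_sq_le_relH (l u : ℝ) (hl : l ∈ S.I) (hu : u ∈ S.I) :
    ∃ c > 0, ∀ x ∈ Icc l u, ∀ y ∈ Icc l u, c * (x - y) ^ 2 ≤ S.relH x y := by
  obtain ⟨c, hc, h⟩ := S.exists_mul_sq_le l u hl hu
  refine ⟨c / 4, by positivity, fun x hx y hy => ?_⟩
  have hsub : Icc l u ⊆ S.I := S.ordConnected_I.out hl hu
  have hz : (x + y) / 2 ∈ Icc l u :=
    ⟨by linarith [hx.1, hy.1], by linarith [hx.2, hy.2]⟩
  have h1 := S.le_H_sub_H (hsub hx) (hsub hz)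
  have h2 := S.le_H_sub_H (hsub hz) (hsub hy)
  have h3 := h _ hz y hy
  unfold relH
  nlinarith

/-- The numerator of `m_h` dominates `y (h(x) - h(y))`. -/
theorem mul_h_sub_h_le {x y : ℝ} (hx : x ∈ S.I) (hy : y ∈ S.I) :
    y * (S.h x - S.h y) ≤ (x * S.h x - S.H x) - (y * S.h y - S.H y) := by
  linarith [S.H_sub_H_le hx hy]

theorem mh_comm (x y : ℝ) : S.mh x y = S.mh y x := by
  unfold mh
  by_cases h : x = y
  · simp [h]
  · rw [if_neg h, if_neg (Ne.symm h), ← neg_div_neg_eq, neg_sub, neg_sub]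

theorem le_mh_of_le {x y : ℝ} (hx : x ∈ S.I) (hy : y ∈ S.I) (hyx : y ≤ x) : y ≤ S.mh x y := by
  unfold mh
  split_ifs with h
  · exact hyx
  · have := S.strictMonoOn_h hy hx (lt_of_le_of_ne hyx (Ne.symm h))
    rw [le_div_iff₀ (by linarith)]
    exact S.mul_h_sub_h_le hx hy

theorem min_le_mh {x y : ℝ} (hx : x ∈ S.I) (hy : y ∈ S.I) : min x y ≤ S.mh x y := by
  rcases le_total x y with h | h
  · rw [S.mh_comm]
    exact (min_le_left _ _).trans (S.le_mh_of_le hy hx h)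
  · exact (min_le_right _ _).trans (S.le_mh_of_le hx hy h)

/-- The mean `m_h(x, y)` can not degenerate faster than `1 / |h(x) - h(y)|` when `y` stays away
from `0`. -/
theorem le_mh_mul_abs {x y : ℝ} (hx : x ∈ S.I) (hy : y ∈ S.I) (h1 : 1 ≤ |S.h x - S.h y|) :
    S.g (S.h y - 1) ≤ S.mh x y * |S.h x - S.h y| := by
  -- The point z lies one unit of h below y. If x ≥ y, then m_h ≥ y > z. Otherwise x ≤ z, and the
  -- numerator of m_h splits at z: the part from z to y is at least z(h(y) − h(z)) = z, and the part
  -- from x to z is nonnegative.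
  set z := S.g (S.h y - 1) with hz
  have hzI : z ∈ S.I := S.g_mem _
  have hhz : S.h z = S.h y - 1 := S.h_g _
  have hzy : z < y := (S.strictMonoOn_h.lt_iff_lt hzI hy).1 (by linarith)
  rcases le_total y x with hxy | hxy
  · have := S.le_mh_of_le hx hy hxy
    nlinarith [hy.1]
  · have hle : S.h x ≤ S.h y := S.strictMonoOn_h.monotoneOn hx hy hxy
    rw [abs_of_nonpos (by linarith)] at h1 ⊢
    have hxz : x ≤ z := (S.strictMonoOn_h.le_iff_le hx hzI).1 (by linarith)
    have hne : x ≠ y := (hxz.trans_lt hzy).ne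
    have e1 := S.mul_h_sub_h_le hy hzI
    have e2 := S.mul_h_sub_h_le hzI hx
    have e3 : 0 ≤ x * (S.h z - S.h x) := mul_nonneg hx.1.le (by linarith)
    unfold mh
    rw [if_neg hne, neg_sub, ← neg_sub (S.h y) (S.h x), div_neg, neg_mul,
      div_mul_cancel₀ _ (by linarith)]
    have : z * (S.h y - S.h z) = z := by rw [hhz]; ring
    linarith

/-- If `h(y)` and `m_h(x, y) (w_x - w_y)²` are bounded, where `w` is at bounded distance of `h`, so
is `h(x)`. -/
theorem abs_h_le_of_mh_mul_sq_le {x y W b B C : ℝ} (hx : x ∈ S.I) (hy : y ∈ S.I)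
    (hyB : |S.h y| ≤ B) (hW : |S.h x - S.h y| ≤ W + b) (hW0 : 0 ≤ W)
    (hC : S.mh x y * W ^ 2 ≤ C) :
    |S.h x| ≤ B + max (max 1 (2 * b)) (4 * C / S.g (-B - 1)) := by
  set Δ := |S.h x - S.h y| with hΔ
  suffices h : Δ ≤ max (max 1 (2 * b)) (4 * C / S.g (-B - 1)) by
    have := abs_add_le (S.h y) (S.h x - S.h y)
    rw [add_sub_cancel] at this
    linarith
  -- For Δ > 2b one has W ≥ Δ/2, so that g(−B−1)·Δ ≤ m_h Δ² ≤ 4 m_h W² ≤ 4C, against the last lower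
  -- bound on Δ.
  by_contra! hcon
  obtain ⟨⟨h1, h2⟩, h3⟩ : (1 < Δ ∧ 2 * b < Δ) ∧ 4 * C / S.g (-B - 1) < Δ := by
    simpa only [max_lt_iff] using hcon
  have hg := S.g_pos (-B - 1)
  rw [div_lt_iff₀ hg] at h3
  have hgle : S.g (-B - 1) ≤ S.g (S.h y - 1) :=
    S.strictMono_g.monotone (by linarith [neg_abs_le (S.h y)])
  have h4 := S.le_mh_mul_abs hx hy h1.le
  have hm : 0 < S.mh x y := (lt_min hx.1 hy.1).trans_le (S.min_le_mh hx hy)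
  have h5 : Δ ^ 2 / 4 ≤ W ^ 2 := by nlinarith
  have h6 : S.mh x y * (Δ ^ 2 / 4) ≤ S.mh x y * W ^ 2 := mul_le_mul_of_nonneg_left h5 hm.le
  have h7 : S.g (-B - 1) * Δ ≤ S.mh x y * Δ * Δ :=
    mul_le_mul_of_nonneg_right (hgle.trans h4) (by linarith)
  nlinarith

end Statistics

/-! ### Null sets -/

theorem volume_hyperplane {d : ℕ} {p : Pt d} (hp : p ≠ 0) (c : ℝ) :
    volume {x : Pt d | ⟪p, x⟫ = c} = 0 := by
  let s : AffineSubspace ℝ (Pt d) :=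
    (affineSpan ℝ {c}).comap (innerSL ℝ p).toLinearMap.toAffineMap
  have hs : (s : Set (Pt d)) = {x : Pt d | ⟪p, x⟫ = c} := by
    ext x; simp [s]
  rw [← hs]
  refine Measure.addHaar_affineSubspace volume s fun htop => hp ?_
  have h0 : (0 : Pt d) ∈ (s : Set (Pt d)) := by simp [htop]
  have h1 : p ∈ (s : Set (Pt d)) := by simp [htop]
  rw [hs, mem_ofPred_eq] at h0 h1
  rw [inner_zero_right] at h0
  rwa [← h0, inner_self_eq_zero] at h1

/-- An orthogonal projection is 1-Lipschitz, hence does not increase Hausdorff measure; the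
normalising factor is nonzero, so null sets are unaffected by it. -/
theorem surf_image_orthogonalProjection {d : ℕ} (W : Submodule ℝ (Pt d)) {s : Set (Pt d)}
    (hs : surf d s = 0) :
    (Measure.euclideanHausdorffMeasure (d - 1) : Measure W)
      (W.orthogonalProjectionOnto '' s) = 0 := by
  have hne := Measure.addHaarScalarFactor_volume_hausdorffMeasure_ne_zero (d - 1)
  have h0 : (Measure.hausdorffMeasure ((d - 1 : ℕ) : ℝ) : Measure (Pt d)) s = 0 := by
    rw [surf, Measure.euclideanHausdorffMeasure_def, Measure.smul_apply, ENNReal.smul_def,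
      smul_eq_mul, mul_eq_zero] at hs
    exact hs.resolve_left (by simpa using hne)
  have hlip : LipschitzWith 1 (W.orthogonalProjectionOnto : Pt d → W) := by
    refine LipschitzWith.of_dist_le_mul fun x y => ?_
    rw [dist_eq_norm, dist_eq_norm, ← map_sub]
    simpa using W.norm_orthogonalProjectionOnto_apply_le (x - y)
  have h1 := hlip.hausdorffMeasure_image_le (d := ((d - 1 : ℕ) : ℝ)) (Nat.cast_nonneg _) s
  rw [h0, mul_zero, nonpos_iff_eq_zero] at h1
  rw [Measure.euclideanHausdorffMeasure_def, Measure.smul_apply, h1, smul_zero]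

/-- A set of zero surface measure is avoided by some translate of a segment. -/
theorem exists_segment_disjoint {d : ℕ} (hd : 1 ≤ d) {s : Set (Pt d)} (hs : surf d s = 0)
    {a b : Pt d} (hab : a ≠ b) {ε : ℝ} (hε : 0 < ε) :
    ∃ e : Pt d, ‖e‖ < ε ∧ Disjoint (segment ℝ (a + e) (b + e)) s := by
  set v := b - a with hv
  have hv0 : v ≠ 0 := sub_ne_zero.2 hab.symm
  set W := (ℝ ∙ v)ᗮ with hW
  have hrank : Module.finrank ℝ W = d - 1 := by
    have : Fact (Module.finrank ℝ (Pt d) = (d - 1) + 1) := ⟨by simp; omega⟩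
    exact Submodule.finrank_orthogonal_span_singleton hv0
  set p := W.orthogonalProjectionOnto with hp
  have hnull := surf_image_orthogonalProjection W hs
  rw [← hrank] at hnull
  have hpos : 0 < (Measure.euclideanHausdorffMeasure (Module.finrank ℝ W) : Measure W)
      (Metric.ball (p a) ε) := Metric.measure_ball_pos _ _ hε
  -- The shadow of s on the orthogonal complement of b − a is null, while the ball has positive
  -- measure. A segment parallel to b − a projects to a single point; moving this point to w makes
  -- the segment miss s.
  obtain ⟨w, hw, hws⟩ : ∃ w ∈ Metric.ball (p a) ε, w ∉ p '' s := by
    by_contra! hcon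
    exact absurd (measure_mono_null hcon hnull) hpos.ne'
  refine ⟨(w - p a : W), by simpa [dist_eq_norm] using hw, ?_⟩
  rw [Set.disjoint_left]
  intro x hx hxs
  refine hws ⟨x, hxs, ?_⟩
  rw [segment_eq_image_lineMap] at hx
  obtain ⟨t, -, rfl⟩ := hx
  have hpv : p v = 0 := by
    rw [hp, Submodule.orthogonalProjectionOnto_eq_zero_iff, hW, Submodule.orthogonal_orthogonal]
    exact Submodule.mem_span_singleton_self v
  have hpw : p ((w - p a : W) : Pt d) = w - p a :=
    Submodule.orthogonalProjectionOnto_mem_subspace_eq_self _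
  rw [AffineMap.lineMap_apply, vsub_eq_sub, vadd_eq_add, add_sub_add_right_eq_sub, ← hv,
    map_add, map_smul, map_add, hpv, hpw]
  simp

/-- A connected open set is not disconnected by a set of zero surface measure. -/
theorem eq_empty_of_surf_closure_inter {d : ℕ} (hd : 1 ≤ d) {Ω A B : Set (Pt d)}
    (hΩ : IsOpen Ω) (hconn : IsPreconnected Ω) (hA : IsOpen A) (hB : IsOpen B)
    (hAΩ : A ⊆ Ω) (hBΩ : B ⊆ Ω) (hAB : Disjoint A B) (hcov : Ω ⊆ closure A ∪ closure B)
    (hnull : surf d (Ω ∩ (closure A ∩ closure B)) = 0) (hAne : A.Nonempty) : B = ∅ := by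
  by_contra hBne
  replace hBne := Set.nonempty_iff_ne_empty.2 hBne
  -- If B were nonempty, the two closures would meet at some x in Ω. Near x, a segment from A to B
  -- can be shifted off the null set; being connected and covered by both closures, it must still
  -- meet their intersection.
  obtain ⟨x, hxΩ, hxA, hxB⟩ := isPreconnected_closed_iff.1 hconn _ _ isClosed_closure
    isClosed_closure hcov
    (hAne.mono fun y hy => ⟨hAΩ hy, subset_closure hy⟩)
    (hBne.mono fun y hy => ⟨hBΩ hy, subset_closure hy⟩)
  obtain ⟨r, hr, hball⟩ := Metric.isOpen_iff.1 hΩ x hxΩ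
  obtain ⟨a, hax, haA⟩ := mem_closure_iff.1 hxA _ Metric.isOpen_ball (Metric.mem_ball_self hr)
  obtain ⟨b, hbx, hbB⟩ := mem_closure_iff.1 hxB _ Metric.isOpen_ball (Metric.mem_ball_self hr)
  obtain ⟨ε₁, hε₁, h1⟩ := Metric.isOpen_iff.1 (Metric.isOpen_ball.inter hA) a ⟨hax, haA⟩
  obtain ⟨ε₂, hε₂, h2⟩ := Metric.isOpen_iff.1 (Metric.isOpen_ball.inter hB) b ⟨hbx, hbB⟩
  obtain ⟨e, he, hdisj⟩ := exists_segment_disjoint hd hnull (hAB.ne_of_mem haA hbB)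
    (lt_min hε₁ hε₂)
  have ha' := h1 (show a + e ∈ Metric.ball a ε₁ by simpa using he.trans_le (min_le_left _ _))
  have hb' := h2 (show b + e ∈ Metric.ball b ε₂ by simpa using he.trans_le (min_le_right _ _))
  have hsub : segment ℝ (a + e) (b + e) ⊆ Ω :=
    ((convex_ball x r).segment_subset ha'.1 hb'.1).trans hball
  obtain ⟨y, hy, hyAB⟩ := isPreconnected_closed_iff.1
    (convex_segment (a + e) (b + e)).isPreconnected _ _ isClosed_closure isClosed_closure
    (hsub.trans hcov)
    ⟨_, left_mem_segment ℝ _ _, subset_closure ha'.2⟩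
    ⟨_, right_mem_segment ℝ _ _, subset_closure hb'.2⟩
  exact Set.disjoint_left.1 hdisj hy ⟨hsub hy, hyAB⟩

theorem Domain.volume_frontier {d : ℕ} (dom : Domain d) : volume (frontier dom.Ω) = 0 := by
  obtain ⟨s, hs, hsub⟩ := dom.polytopal
  refine measure_mono_null hsub ((measure_biUnion_null_iff s.countable_toSet).2 fun p hp => ?_)
  exact volume_hyperplane (hs p hp) p.2

/-! ### Meshes -/

namespace Discretisation

variable {d : ℕ} {dom : Domain d} {𝓜 𝓔 : Type*} [Fintype 𝓜] [Fintype 𝓔]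
  (D : Discretisation dom 𝓜 𝓔)

theorem normal_ne_zero (σ : 𝓔) : D.normal σ ≠ 0 := fun h => by
  simpa [h] using D.norm_normal σ

theorem inner_normal_of_mem_closure {σ : 𝓔} {x : Pt d} (hx : x ∈ closure (D.face σ)) :
    ⟪D.normal σ, x⟫ = D.offset σ := by
  have hclosed : IsClosed {x : Pt d | ⟪D.normal σ, x⟫ = D.offset σ} :=
    isClosed_eq (by fun_prop) continuous_const
  refine closure_minimal (fun y hy => ?_) hclosed hx
  obtain ⟨U, -, hU⟩ := D.face_open σ
  rw [hU] at hy
  exact hy.2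

theorem closure_cell_subset (K : 𝓜) : closure (D.cell K) ⊆ closure dom.Ω :=
  closure_mono (D.cell_subset K)

theorem isBounded_cell (K : 𝓜) : Bornology.IsBounded (D.cell K) :=
  dom.isBounded.subset (D.cell_subset K)

theorem volume_frontier_cell (K : 𝓜) : volume (frontier (D.cell K)) = 0 := by
  rw [D.frontier_cell]
  refine (measure_biUnion_null_iff (D.facesOf K).countable_toSet).2 fun σ _ => ?_
  exact measure_mono_null (fun x hx => D.inner_normal_of_mem_closure hx)
    (volume_hyperplane (D.normal_ne_zero σ) _)

theorem volume_cell_lt_top (K : 𝓜) : volume (D.cell K) < ⊤ :=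
  (D.isBounded_cell K).measure_lt_top

theorem volume_cell_pos (K : 𝓜) : 0 < volume (D.cell K) :=
  (D.cell_isOpen K).measure_pos _ (D.cell_nonempty K)

theorem cellMeas_pos (K : 𝓜) : 0 < D.cellMeas K :=
  ENNReal.toReal_pos (D.volume_cell_pos K).ne' (D.volume_cell_lt_top K).ne

theorem iUnion_cell_ae_eq : (⋃ K, D.cell K : Set (Pt d)) =ᵐ[volume] dom.Ω := by
  refine Filter.EventuallyLE.antisymm (iUnion_subset D.cell_subset).eventuallyLE ?_
  refine ae_le_set.2 (measure_mono_null (t := ⋃ K, frontier (D.cell K)) ?_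
    (measure_iUnion_null_iff.2 D.volume_frontier_cell))
  rintro x ⟨hx, hx'⟩
  have := subset_closure hx
  rw [D.closure_eq, mem_iUnion] at this
  obtain ⟨K, hK⟩ := this
  refine mem_iUnion.2 ⟨K, hK, ?_⟩
  rw [(D.cell_isOpen K).interior_eq]
  exact fun h => hx' (mem_iUnion.2 ⟨K, h⟩)

/-- An integral over `Ω` is the sum of the integrals over the cells. -/
theorem setIntegral_eq_sum {F : Pt d → ℝ} {f : 𝓜 → Pt d → ℝ}
    (hF : ∀ K, ∀ x ∈ D.cell K, F x = f K x) (hf : ∀ K, IntegrableOn (f K) (D.cell K)) :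
    ∫ x in dom.Ω, F x = ∑ K, ∫ x in D.cell K, f K x := by
  rw [← setIntegral_congr_set D.iUnion_cell_ae_eq,
    integral_iUnion_fintype (fun K => (D.cell_isOpen K).measurableSet) D.cell_disjoint]
  · exact Finset.sum_congr rfl fun K _ =>
      setIntegral_congr_fun (D.cell_isOpen K).measurableSet (hF K)
  · exact fun K => (hf K).congr_fun (fun x hx => (hF K x hx).symm)
      (D.cell_isOpen K).measurableSet

theorem setIntegral_const_cells {F : Pt d → ℝ} {f : 𝓜 → ℝ}
    (hF : ∀ K, ∀ x ∈ D.cell K, F x = f K) :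
    ∫ x in dom.Ω, F x = ∑ K, D.cellMeas K * f K := by
  rw [D.setIntegral_eq_sum (f := fun K _ => f K) hF
    fun K => integrableOn_const (D.volume_cell_lt_top K).ne]
  simp [cellMeas, Measure.real]

theorem recon_apply (v : Vec 𝓜 𝓔) {K : 𝓜} {x : Pt d} (hx : x ∈ D.cell K) :
    D.recon v x = v (Sum.inl K) := by
  classical
  unfold recon
  rw [Finset.sum_eq_single K]
  · simp [hx]
  · intro L _ hLK
    exact indicator_of_notMem
      (fun hxL => Set.disjoint_left.1 (D.cell_disjoint hLK) hxL hx) _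
  · simp

theorem exists_mem_facesOf (σ : 𝓔) : ∃ K, σ ∈ D.facesOf K := by
  have : {K | σ ∈ D.facesOf K}.ncard ≠ 0 := by
    rcases D.face_cells σ with h | h <;> omega
  exact Set.nonempty_of_ncard_ne_zero this

theorem face_subset_frontier_cell {K : 𝓜} {σ : 𝓔} (hσ : σ ∈ D.facesOf K) :
    closure (D.face σ) ⊆ frontier (D.cell K) := by
  rw [D.frontier_cell]
  exact subset_biUnion_of_mem (u := fun σ => closure (D.face σ)) hσ

/-- The part of the skeleton that is not covered by the (open) faces. -/
def edges : Set (Pt d) := ⋃ σ, closure (D.face σ) \ D.face σ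

theorem surf_edges : surf d D.edges = 0 :=
  measure_iUnion_null_iff.2 D.face_boundary

theorem exists_mem_face {K : 𝓜} {x : Pt d} (hx : x ∈ closure (D.cell K)) (hxK : x ∉ D.cell K)
    (hxe : x ∉ D.edges) : ∃ σ ∈ D.facesOf K, x ∈ D.face σ := by
  have : x ∈ frontier (D.cell K) := ⟨hx, by rwa [(D.cell_isOpen K).interior_eq]⟩
  rw [D.frontier_cell] at this
  obtain ⟨σ, hσ, hxσ⟩ := mem_iUnion₂.1 this
  refine ⟨σ, hσ, ?_⟩
  by_contra hcon
  exact hxe (mem_iUnion.2 ⟨σ, hxσ, hcon⟩)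

/-- Γ^D has positive surface measure and the edges have none, so some point of Γ^D lies in an open
face. Compliance and disjointness from Γ^N place this whole face in Γ^D. -/
theorem exists_dirichletFace : ∃ σ, σ ∈ D.dirichletFaces := by
  obtain ⟨x, hxD, hxe⟩ : ∃ x ∈ dom.ΓD, x ∉ D.edges := by
    by_contra! hcon
    exact dom.ΓD_pos.ne' (measure_mono_null hcon D.surf_edges)
  have hxf := dom.ΓD_subset hxD
  have hxΩ : x ∉ dom.Ω := by simpa [dom.isOpen.interior_eq] using hxf.2
  have hx := hxf.1
  rw [D.closure_eq, mem_iUnion] at hx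
  obtain ⟨K, hK⟩ := hx
  obtain ⟨σ, hσ, hxσ⟩ := D.exists_mem_face hK (fun h => hxΩ (D.cell_subset K h)) hxe
  refine ⟨σ, ?_⟩
  rcases D.face_cells σ with ⟨h1, h2⟩ | ⟨-, h2⟩
  · refine ⟨h1, (D.compliant σ h2).resolve_right fun h3 => ?_⟩
    exact Set.disjoint_left.1 dom.disjoint hxD (h3 hxσ)
  · exact absurd (h2 hxσ) hxΩ

/-- Induction along the mesh: a property which holds at the Dirichlet faces, and which propagates
from a cell to its faces and conversely, holds everywhere. -/
theorem mesh_induction (hd : 1 ≤ d) {P : 𝓜 ⊕ 𝓔 → Prop}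
    (hD : ∀ σ ∈ D.dirichletFaces, P (Sum.inr σ))
    (hP : ∀ K, ∀ σ ∈ D.facesOf K, (P (Sum.inl K) ↔ P (Sum.inr σ))) (i : 𝓜 ⊕ 𝓔) : P i := by
  -- The cells are sorted by whether P holds. A point of Ω in both closures is on an edge or on an
  -- open face shared by a cell of each sort; P would propagate across the latter. Only a null set
  -- is left to separate A from B.
  let A : Set (Pt d) := ⋃ K ∈ {K | P (Sum.inl K)}, D.cell K
  let B : Set (Pt d) := ⋃ K ∈ {K | ¬ P (Sum.inl K)}, D.cell K
  have hclA : closure A = ⋃ K ∈ {K | P (Sum.inl K)}, closure (D.cell K) :=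
    (Set.toFinite _).closure_biUnion _
  have hclB : closure B = ⋃ K ∈ {K | ¬ P (Sum.inl K)}, closure (D.cell K) :=
    (Set.toFinite _).closure_biUnion _
  have hAB : Disjoint A B := by
    simp only [A, B, Set.disjoint_iUnion_left, Set.disjoint_iUnion_right]
    intro K hK L hL
    exact D.cell_disjoint fun h => hK (h ▸ hL)
  have hB : B = ∅ := by
    refine eq_empty_of_surf_closure_inter hd dom.isOpen dom.isConnected.isPreconnected
      (isOpen_biUnion fun K _ => D.cell_isOpen K) (isOpen_biUnion fun K _ => D.cell_isOpen K)
      (iUnion₂_subset fun K _ => D.cell_subset K) (iUnion₂_subset fun K _ => D.cell_subset K)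
      hAB ?_ (measure_mono_null ?_ D.surf_edges) ?_
    · intro x hx
      have := subset_closure hx
      rw [D.closure_eq, mem_iUnion] at this
      obtain ⟨K, hK⟩ := this
      by_cases h : P (Sum.inl K)
      · left; rw [hclA]; exact mem_biUnion h hK
      · right; rw [hclB]; exact mem_biUnion h hK
    · rintro x ⟨hxΩ, hxA, hxB⟩
      by_contra hxe
      rw [hclA] at hxA
      rw [hclB] at hxB
      obtain ⟨K, hK, hxK⟩ := mem_iUnion₂.1 hxA
      obtain ⟨L, hL, hxL⟩ := mem_iUnion₂.1 hxB
      have hKL : K ≠ L := fun h => hL (h ▸ hK)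
      have hxL' : x ∉ D.cell L := fun h => Set.disjoint_left.1
        ((D.cell_disjoint hKL.symm).closure_right (D.cell_isOpen L)) h hxK
      have hxK' : x ∉ D.cell K := fun h => Set.disjoint_left.1
        ((D.cell_disjoint hKL).closure_right (D.cell_isOpen K)) h hxL
      obtain ⟨σ, hσ, hxσ⟩ := D.exists_mem_face hxK hxK' hxe
      obtain ⟨τ, hτ, hxτ⟩ := D.exists_mem_face hxL hxL' hxe
      have hστ : σ = τ := by
        by_contra hne
        exact Set.disjoint_left.1 (D.face_disjoint hne) hxσ hxτ
      subst hστ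
      exact hL ((hP L σ hτ).2 ((hP K σ hσ).1 hK))
    · obtain ⟨σ, hσ⟩ := D.exists_dirichletFace
      obtain ⟨K, hK⟩ := D.exists_mem_facesOf σ
      obtain ⟨x, hx⟩ := D.cell_nonempty K
      exact ⟨x, mem_biUnion (show P (Sum.inl K) from (hP K σ hK).2 (hD σ hσ)) hx⟩
  have hcell : ∀ K, P (Sum.inl K) := by
    intro K
    by_contra h
    obtain ⟨x, hx⟩ := D.cell_nonempty K
    have : x ∈ B := mem_biUnion (show K ∈ {K | ¬ P (Sum.inl K)} from h) hx
    simp [hB] at this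
  rcases i with K | σ
  · exact hcell K
  · obtain ⟨K, hK⟩ := D.exists_mem_facesOf σ
    exact (hP K σ hK).1 (hcell K)

end Discretisation

/-! ### Finite families of constants -/

theorem exists_pos_le_of_finite {ι : Type*} [Finite ι] {c : ι → ℝ} (hc : ∀ i, 0 < c i) :
    ∃ c₀ > 0, ∀ i, c₀ ≤ c i := by
  rcases isEmpty_or_nonempty ι with h | h
  · exact ⟨1, one_pos, fun i => h.elim i⟩
  · obtain ⟨i, hi⟩ := Finite.exists_min c
    exact ⟨c i, hc i, hi⟩

theorem exists_le_of_finite {ι : Type*} [Finite ι] (c : ι → ℝ) : ∃ C > 0, ∀ i, c i ≤ C := by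
  obtain ⟨C, hC⟩ := (Set.finite_range c).bddAbove
  exact ⟨max C 1, by positivity, fun i => (hC (mem_range_self i)).trans (le_max_left _ _)⟩

/-- If `ker A ⊆ ker B`, then `A` controls `B`. -/
theorem exists_norm_le_of_ker_le {E F G : Type*} [AddCommGroup E] [Module ℝ E]
    [NormedAddCommGroup F] [NormedSpace ℝ F] [FiniteDimensional ℝ F]
    [NormedAddCommGroup G] [NormedSpace ℝ G] (A : E →ₗ[ℝ] F) (B : E →ₗ[ℝ] G)
    (h : A.ker ≤ B.ker) : ∃ C > 0, ∀ v, ‖B v‖ ≤ C * ‖A v‖ := by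
  -- B factors through the range of A, and a linear map on this finite-dimensional space is bounded.
  let f : A.range →ₗ[ℝ] G := (A.ker.liftQ B h) ∘ₗ A.quotKerEquivRange.symm.toLinearMap
  refine ⟨‖LinearMap.toContinuousLinearMap f‖ + 1, by positivity, fun v => ?_⟩
  have h1 : f ⟨A v, A.mem_range_self v⟩ = B v := by
    simp only [f, LinearMap.comp_apply, LinearEquiv.coe_coe]
    rw [LinearMap.quotKerEquivRange_symm_apply_image A v (A.mem_range_self v)]
    rfl
  have h2 := (LinearMap.toContinuousLinearMap f).le_opNorm ⟨A v, A.mem_range_self v⟩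
  rw [LinearMap.coe_toContinuousLinearMap', h1] at h2
  refine h2.trans ?_
  have : ‖(⟨A v, A.mem_range_self v⟩ : A.range)‖ = ‖A v‖ := rfl
  rw [this]
  nlinarith [norm_nonneg (A v)]

namespace Discretisation

variable {d : ℕ} {dom : Domain d} {𝓜 𝓔 : Type*} [Fintype 𝓜] [Fintype 𝓔]
  (D : Discretisation dom 𝓜 𝓔)

/-! ### Pyramids -/

theorem center_add_smul_mem_closure (K : 𝓜) {y : Pt d} (hy : y ∈ closure (D.cell K)) {t : ℝ}
    (h0 : 0 ≤ t) (h1 : t ≤ 1) : D.center K + t • (y - D.center K) ∈ closure (D.cell K) :=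
  map_mem_closure (f := fun z => D.center K + t • (z - D.center K)) (by fun_prop) hy
    fun _ hz => (D.starConvex K).add_smul_sub_mem hz h0 h1

theorem pyramid_subset_closure {K : 𝓜} {σ : 𝓔} (hσ : σ ∈ D.facesOf K) :
    D.pyramid K σ ⊆ closure (D.cell K) := by
  rintro _ ⟨y, hy, t, ht, rfl⟩
  exact D.center_add_smul_mem_closure K
    (D.face_subset_frontier_cell hσ (subset_closure hy)).1 ht.1.le ht.2.le

theorem pyramid_nonempty (K : 𝓜) (σ : 𝓔) : (D.pyramid K σ).Nonempty := by
  obtain ⟨y, hy⟩ := (D.face_connected σ).nonempty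
  exact ⟨_, y, hy, 1 / 2, by norm_num, rfl⟩

/-- A point x has relative height τ(x) = ⟨n, x − c⟩/δ above the apex, and its central projection on
the hyperplane of the face is c + τ(x)⁻¹(x − c). The pyramid is cut out by 0 < τ < 1 and by the
condition that this projection lies in U. -/
theorem isOpen_pyramid {K : 𝓜} {σ : 𝓔} (hσ : σ ∈ D.facesOf K) : IsOpen (D.pyramid K σ) := by
  obtain ⟨U, hU, hface⟩ := D.face_open σ
  set c := D.center K
  set n := D.normal σ
  set δ := D.offset σ - ⟪n, c⟫ with hδ
  have hδ0 : δ ≠ 0 := sub_ne_zero.2 (D.center_notMem K σ hσ).symm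
  let τ : Pt d → ℝ := fun x => ⟪n, x - c⟫ / δ
  have hτ : Continuous τ := by fun_prop
  have hpyr : D.pyramid K σ = {x | τ x ∈ Ioo (0 : ℝ) 1} ∩
      (fun x => c + (τ x)⁻¹ • (x - c)) ⁻¹' U := by
    ext x
    constructor
    · rintro ⟨y, hy, t, ht, rfl⟩
      rw [hface] at hy
      have ht' : τ (c + t • (y - c)) = t := by
        have : ⟪n, y⟫ = D.offset σ := hy.2
        simp only [τ]
        rw [add_sub_cancel_left, inner_smul_right, inner_sub_right, this, ← hδ,
          mul_div_assoc, div_self hδ0, mul_one]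
      refine ⟨by rw [mem_ofPred_eq, ht']; exact ht, ?_⟩
      rw [mem_preimage, ht', add_sub_cancel_left, smul_smul, inv_mul_cancel₀ ht.1.ne', one_smul,
        add_sub_cancel]
      exact hy.1
    · rintro ⟨ht, hU'⟩
      rw [mem_ofPred_eq] at ht
      refine ⟨c + (τ x)⁻¹ • (x - c), ?_, τ x, ht, ?_⟩
      · rw [hface]
        refine ⟨hU', ?_⟩
        have h1 : ⟪n, x - c⟫ = τ x * δ := by simp only [τ]; field_simp
        rw [mem_ofPred_eq, inner_add_right, inner_smul_right, h1, inv_mul_cancel_left₀ ht.1.ne', hδ]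
        ring
      · rw [add_sub_cancel_left, smul_smul, mul_inv_cancel₀ ht.1.ne', one_smul, add_sub_cancel]
  rw [hpyr]
  refine ContinuousOn.isOpen_inter_preimage ?_ (isOpen_Ioo.preimage hτ) hU
  refine continuousOn_const.add (ContinuousOn.smul (hτ.continuousOn.inv₀ fun x hx => hx.1.ne') ?_)
  fun_prop

theorem volume_pyramid_lt_top {K : 𝓜} {σ : 𝓔} (hσ : σ ∈ D.facesOf K) :
    volume (D.pyramid K σ) < ⊤ :=
  (((D.isBounded_cell K).closure).subset (D.pyramid_subset_closure hσ)).measure_lt_top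

theorem volume_real_pyramid_pos {K : 𝓜} {σ : 𝓔} (hσ : σ ∈ D.facesOf K) :
    0 < volume.real (D.pyramid K σ) :=
  ENNReal.toReal_pos ((D.isOpen_pyramid hσ).measure_pos _ (D.pyramid_nonempty K σ)).ne'
    (D.volume_pyramid_lt_top hσ).ne

/-- Star-shapedness places the pyramid only in the closure of the cell, but the boundary of Ω lies
in finitely many hyperplanes and is null. -/
theorem restrict_pyramid_le {K : 𝓜} {σ : 𝓔} (hσ : σ ∈ D.facesOf K) :
    (volume.restrict (D.pyramid K σ) : Measure (Pt d)) ≤ volume.restrict dom.Ω := by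
  have h : (closure dom.Ω : Set (Pt d)) =ᵐ[volume] dom.Ω := by
    refine EventuallyLE.antisymm (ae_le_set.2 ?_) subset_closure.eventuallyLE
    have := dom.volume_frontier
    rwa [frontier, dom.isOpen.interior_eq] at this
  rw [← Measure.restrict_congr_set h]
  exact Measure.restrict_mono_set _
    ((D.pyramid_subset_closure hσ).trans (D.closure_cell_subset K))

/-! ### Discrete gradients -/

theorem gradCons_add (K : 𝓜) (u v : Vec 𝓜 𝓔) :
    D.gradCons K (u + v) = D.gradCons K u + D.gradCons K v := by
  simp only [gradCons, Pi.add_apply, ← smul_add, ← Finset.sum_add_distrib, ← add_smul]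
  congr 1
  refine Finset.sum_congr rfl fun σ _ => ?_
  congr 1
  ring

theorem gradCons_smul (K : 𝓜) (c : ℝ) (v : Vec 𝓜 𝓔) :
    D.gradCons K (c • v) = c • D.gradCons K v := by
  rw [gradCons, gradCons, smul_comm c, Finset.smul_sum (r := c)]
  congr 1
  refine Finset.sum_congr rfl fun σ _ => ?_
  rw [smul_smul, Pi.smul_apply, Pi.smul_apply, smul_eq_mul, smul_eq_mul]
  congr 1
  ring

/-- The discrete gradient as a linear map. -/
noncomputable def gradLin (η : ℝ) (K : 𝓜) (σ : 𝓔) : Vec 𝓜 𝓔 →ₗ[ℝ] Pt d where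
  toFun := D.grad η K σ
  map_add' u v := by
    simp only [grad, gradCons_add, Pi.add_apply, inner_add_left]
    module
  map_smul' c v := by
    simp only [grad, gradCons_smul, Pi.smul_apply, smul_eq_mul, inner_smul_left,
      RingHom.id_apply, conj_trivial]
    module

@[simp] theorem gradLin_apply (η : ℝ) (K : 𝓜) (σ : 𝓔) (v : Vec 𝓜 𝓔) :
    D.gradLin η K σ v = D.grad η K σ v := rfl

theorem dist_pos {K : 𝓜} {σ : 𝓔} (hσ : σ ∈ D.facesOf K) : 0 < D.dist K σ :=
  abs_pos.2 (sub_ne_zero.2 (D.center_notMem K σ hσ).symm)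

theorem outward_ne_zero {K : 𝓜} {σ : 𝓔} (hσ : σ ∈ D.facesOf K) : D.outward K σ ≠ 0 := by
  refine smul_ne_zero ?_ (D.normal_ne_zero σ)
  rw [Ne, Real.sign_eq_zero_iff]
  exact sub_ne_zero.2 (D.center_notMem K σ hσ).symm

/-- The line through `x_K` with a given direction meets the boundary of `K`. -/
theorem exists_smul_mem_frontier (K : 𝓜) {u : Pt d} (hu : u ≠ 0) :
    ∃ t : ℝ, D.center K + t • u ∈ frontier (D.cell K) := by
  by_contra! hcon
  have hpre : IsPreconnected (range fun t : ℝ => D.center K + t • u) :=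
    isPreconnected_range (by fun_prop)
  have hmem : D.center K ∈ range fun t : ℝ => D.center K + t • u := ⟨0, by simp⟩
  have hsub : (range fun t : ℝ => D.center K + t • u) ⊆
      D.cell K ∪ (closure (D.cell K))ᶜ := by
    rintro _ ⟨t, rfl⟩
    by_cases h : D.center K + t • u ∈ closure (D.cell K)
    · left
      by_contra h2
      exact hcon t ⟨h, by rwa [(D.cell_isOpen K).interior_eq]⟩
    · exact Or.inr h
  rcases hpre.subset_or_subset (D.cell_isOpen K) isClosed_closure.isOpen_compl
    (disjoint_compl_right.mono_left subset_closure) hsub with h | h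
  · obtain ⟨C, hC⟩ := (D.isBounded_cell K).exists_norm_le
    have hun : 0 < ‖u‖ := norm_pos_iff.2 hu
    -- The parameter is chosen so that this point of the line has norm at least C + 1.
    have h1 := hC _ (h ⟨(C + 1 + ‖D.center K‖) / ‖u‖, rfl⟩)
    have h0 := hC _ (D.center_mem K)
    have h2 := norm_sub_norm_le (((C + 1 + ‖D.center K‖) / ‖u‖) • u) (-D.center K)
    rw [sub_neg_eq_add, add_comm, norm_smul, Real.norm_eq_abs, abs_of_nonneg, norm_neg,
      div_mul_cancel₀ _ hun.ne', add_comm] at h2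
    · simp only at h1
      rw [add_comm (_ • u)] at h2
      linarith
    · have := norm_nonneg (D.center K)
      exact div_nonneg (by linarith) hun.le
  · exact h hmem (subset_closure (D.center_mem K))

theorem exists_inner_eq_zero {d : ℕ} (hd : 2 ≤ d) (G : Pt d) : ∃ u : Pt d, u ≠ 0 ∧ ⟪G, u⟫ = 0 := by
  have hne : (ℝ ∙ G)ᗮ ≠ ⊥ := by
    intro h
    have h1 := Submodule.finrank_add_finrank_orthogonal (ℝ ∙ G)
    have h2 : Module.finrank ℝ (ℝ ∙ G) ≤ 1 := by
      simpa using finrank_span_le_card (R := ℝ) ({G} : Set (Pt d))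
    rw [h, finrank_bot, finrank_euclideanSpace, Fintype.card_fin] at h1
    omega
  obtain ⟨u, hu, hu0⟩ := Submodule.exists_mem_ne_zero_of_ne_bot hne
  exact ⟨u, hu0, Submodule.mem_orthogonal_singleton_iff_inner_right.1 hu⟩

/-- If G_K ≠ 0, vanishing of all the ∇_{K,σ} makes G_K a nonzero multiple of every face normal. A
line through x_K orthogonal to G_K reaches the boundary of K in some closed face; being parallel to
the hyperplane of that face, it lies inside it, and so does x_K, a contradiction. -/
theorem gradCons_eq_zero_of_two_le (hd : 2 ≤ d) {η : ℝ} {K : 𝓜} {v : Vec 𝓜 𝓔}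
    (h : ∀ σ ∈ D.facesOf K, D.grad η K σ v = 0) : D.gradCons K v = 0 := by
  by_contra hG
  obtain ⟨u, hu, hGu⟩ := exists_inner_eq_zero hd (D.gradCons K v)
  obtain ⟨t, ht⟩ := D.exists_smul_mem_frontier K hu
  rw [D.frontier_cell] at ht
  obtain ⟨σ, hσ, hxσ⟩ := mem_iUnion₂.1 ht
  have hin := D.inner_normal_of_mem_closure hxσ
  have hg := h σ hσ
  unfold grad outward at hg
  rw [smul_smul] at hg
  generalize (η / D.dist K σ * (v (Sum.inr σ) - v (Sum.inl K)
      - ⟪D.gradCons K v, D.faceCenter σ - D.center K⟫)) *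
      Real.sign (D.offset σ - ⟪D.normal σ, D.center K⟫) = k at hg
  have hGk : D.gradCons K v = (-k) • D.normal σ := by
    rw [neg_smul]; exact eq_neg_of_add_eq_zero_left hg
  have hk : -k ≠ 0 := fun hk => hG (by rw [hGk, hk, zero_smul])
  rw [hGk, inner_smul_left] at hGu
  have hnu : ⟪D.normal σ, u⟫ = 0 := (mul_eq_zero.1 hGu).resolve_left (by simpa using hk)
  rw [inner_add_right, inner_smul_right, hnu, mul_zero, add_zero] at hin
  exact D.center_notMem K σ hσ hin

end Discretisation

namespace Discretisation

/-! ### Discrete gradients in dimension one -/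

section DimensionOne

theorem eq_inner_smul_of_norm_eq_one {o : Pt 1} (ho : ‖o‖ = 1) (x : Pt 1) : x = ⟪o, x⟫ • o := by
  have h : o 0 * o 0 = 1 := by
    have := real_inner_self_eq_norm_sq o
    rw [ho, PiLp.inner_apply] at this
    have h' : o 0 = 1 ∨ o 0 = -1 := by simpa using this
    rcases h' with h' | h' <;> rw [h'] <;> norm_num
  ext i
  rw [Subsingleton.elim i 0, PiLp.inner_apply]
  simp only [Fin.isValue, Finset.univ_unique, Fin.default_eq_zero, Finset.sum_singleton,
    PiLp.smul_apply, smul_eq_mul, RCLike.inner_apply, conj_trivial]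
  linear_combination (-x 0) * h

theorem volume_real_ball_one (x : Pt 1) {r : ℝ} (hr : 0 ≤ r) :
    volume.real (Metric.ball x r) = 2 * r := by
  have hΓ : Real.Gamma (1 / 2 + 1) = √Real.pi / 2 := by
    rw [Real.Gamma_add_one (by norm_num), Real.Gamma_one_half_eq]; ring
  have hπ : √Real.pi ≠ 0 := (Real.sqrt_pos.2 Real.pi_pos).ne'
  rw [Measure.real, EuclideanSpace.volume_ball]
  simp only [Fintype.card_fin, pow_one, Nat.cast_one, hΓ]
  rw [← ENNReal.ofReal_mul hr, ENNReal.toReal_ofReal (by positivity)]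
  field_simp

variable {dom : Domain 1} {𝓜 𝓔 : Type*} [Fintype 𝓜] [Fintype 𝓔] (D : Discretisation dom 𝓜 𝓔)

theorem norm_outward {d : ℕ} {dom : Domain d} {𝓜 𝓔 : Type*} [Fintype 𝓜] [Fintype 𝓔]
    (D : Discretisation dom 𝓜 𝓔) {K : 𝓜} {σ : 𝓔} (hσ : σ ∈ D.facesOf K) :
    ‖D.outward K σ‖ = 1 := by
  rw [outward, norm_smul, D.norm_normal, mul_one]
  rcases Real.sign_apply_eq_of_ne_zero _ (sub_ne_zero.2 (D.center_notMem K σ hσ).symm)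
    with h | h <;>
  simp [h]

theorem exists_face_eq_singleton (K : 𝓜) (σ : 𝓔) :
    ∃ y, D.face σ = {y} ∧ y - D.center K = D.dist K σ • D.outward K σ := by
  obtain ⟨y, hy⟩ := (D.face_connected σ).nonempty
  have hin : ∀ x ∈ D.face σ, ⟪D.normal σ, x⟫ = D.offset σ := fun x hx =>
    D.inner_normal_of_mem_closure (subset_closure hx)
  refine ⟨y, ?_, ?_⟩
  · refine Subset.antisymm (fun x hx => ?_) (singleton_subset_iff.2 hy)
    rw [mem_singleton_iff, eq_inner_smul_of_norm_eq_one (D.norm_normal σ) x, hin x hx,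
      eq_inner_smul_of_norm_eq_one (D.norm_normal σ) y, hin y hy]
  · rw [eq_inner_smul_of_norm_eq_one (D.norm_normal σ) (y - D.center K), inner_sub_right, hin y hy,
      dist, outward, smul_smul]
    congr 1
    rcases lt_trichotomy (D.offset σ - ⟪D.normal σ, D.center K⟫) 0 with h | h | h
    · rw [abs_of_neg h, Real.sign_of_neg h]; ring
    · simp [h]
    · rw [abs_of_pos h, Real.sign_of_pos h]; ring

theorem surf_one_singleton (y : Pt 1) : surf 1 {y} = 1 := by
  simp [surf]

theorem faceMeas_eq_one (σ : 𝓔) : D.faceMeas σ = 1 := by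
  obtain ⟨K, -⟩ := D.exists_mem_facesOf σ
  obtain ⟨y, hy, -⟩ := D.exists_face_eq_singleton K σ
  rw [faceMeas, hy, Measure.real, surf_one_singleton, ENNReal.toReal_one]

theorem faceCenter_sub_center (K : 𝓜) (σ : 𝓔) :
    D.faceCenter σ - D.center K = D.dist K σ • D.outward K σ := by
  obtain ⟨y, hy, h⟩ := D.exists_face_eq_singleton K σ
  rw [← h, faceCenter, hy, setAverage_eq, integral_singleton, Measure.real, surf_one_singleton]
  simp

/-- On a line, points of the cell close to y lie on the same ray from x_K and beyond the given
point, so star-shapedness reaches it. In general star-shapedness yields only the closure. -/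
theorem center_add_mem_cell {K : 𝓜} {y : Pt 1} (hy : y ∈ closure (D.cell K))
    (hyc : y ≠ D.center K) {r : ℝ} (hr0 : 0 ≤ r) (hr1 : r < 1) :
    D.center K + r • (y - D.center K) ∈ D.cell K := by
  set c := D.center K
  have hn : 0 < ‖y - c‖ := norm_pos_iff.2 (sub_ne_zero.2 hyc)
  set o := ‖y - c‖⁻¹ • (y - c) with ho
  have ho1 : ‖o‖ = 1 := by rw [ho, norm_smul, norm_inv, norm_norm, inv_mul_cancel₀ hn.ne']
  have hyo : ⟪o, y - c⟫ = ‖y - c‖ := by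
    rw [ho, inner_smul_left, real_inner_self_eq_norm_sq]
    simp only [conj_trivial]
    field_simp
  have hopen : IsOpen {z : Pt 1 | r * ‖y - c‖ < ⟪o, z - c⟫} :=
    isOpen_lt continuous_const (by fun_prop)
  obtain ⟨z, hz, hzK⟩ := mem_closure_iff.1 hy _ hopen
    (show r * ‖y - c‖ < ⟪o, y - c⟫ by rw [hyo]; nlinarith)
  rw [mem_ofPred_eq] at hz
  have hpos : 0 < ⟪o, z - c⟫ := (mul_nonneg hr0 hn.le).trans_lt hz
  have := (D.starConvex K).add_smul_sub_mem hzK (t := r * ‖y - c‖ / ⟪o, z - c⟫)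
    (by positivity) ((div_le_one hpos).2 hz.le)
  have hzc := eq_inner_smul_of_norm_eq_one ho1 (z - c)
  generalize ⟪o, z - c⟫ = θ at hzc hpos this
  convert this using 2
  rw [show D.center K = c from rfl, hzc, smul_smul, div_mul_cancel₀ _ hpos.ne', ho, smul_smul,
    mul_assoc, mul_inv_cancel₀ hn.ne',
    mul_one]

theorem pyramid_subset_cell {K : 𝓜} {σ : 𝓔} (hσ : σ ∈ D.facesOf K) :
    D.pyramid K σ ⊆ D.cell K := by
  rintro _ ⟨y, hy, t, ht, rfl⟩
  have hf := D.face_subset_frontier_cell hσ (subset_closure hy)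
  refine D.center_add_mem_cell hf.1 ?_ ht.1.le ht.2
  rintro rfl
  exact hf.2 ((D.cell_isOpen K).interior_eq.symm ▸ D.center_mem K)

/-- The pyramid is an interval, and contains the open ball of diameter d_{K,σ} centred halfway to
the face. -/
theorem dist_le_volume_pyramid {K : 𝓜} {σ : 𝓔} (hσ : σ ∈ D.facesOf K) :
    D.dist K σ ≤ volume.real (D.pyramid K σ) := by
  obtain ⟨y, hy, h⟩ := D.exists_face_eq_singleton K σ
  have hs := D.dist_pos hσ
  have ho := D.norm_outward hσ
  set s := D.dist K σ
  set o := D.outward K σ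
  set c := D.center K
  have hsub : Metric.ball (c + (s / 2) • o) (s / 2) ⊆ D.pyramid K σ := by
    intro x hx
    have hxo := eq_inner_smul_of_norm_eq_one ho (x - c)
    rw [Metric.mem_ball, dist_eq_norm, ← sub_sub, hxo, ← sub_smul, norm_smul, ho, mul_one,
      Real.norm_eq_abs, abs_lt] at hx
    refine ⟨y, hy ▸ rfl, ⟪o, x - c⟫ / s, ⟨by apply div_pos <;> linarith, ?_⟩, ?_⟩
    · rw [div_lt_one hs]; linarith
    · rw [show D.center K = c from rfl, h, smul_smul, div_mul_cancel₀ _ hs.ne', ← hxo,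
        add_sub_cancel]
  have h1 := measureReal_mono hsub (D.volume_pyramid_lt_top hσ).ne
  rw [volume_real_ball_one _ (by positivity)] at h1
  linarith

/-- A common point would put the two faces on one ray from x_K: they either coincide, or the nearer
one lies in the open cell instead of on its boundary. -/
theorem pyramid_disjoint {K : 𝓜} {σ τ : 𝓔} (hσ : σ ∈ D.facesOf K) (hτ : τ ∈ D.facesOf K)
    (hne : σ ≠ τ) : Disjoint (D.pyramid K σ) (D.pyramid K τ) := by
  have aux : ∀ σ ∈ D.facesOf K, ∀ τ ∈ D.facesOf K, σ ≠ τ → ∀ y ∈ D.face σ, ∀ z ∈ D.face τ,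
      ∀ t > (0 : ℝ), ∀ s > (0 : ℝ), t ≤ s → t • (y - D.center K) ≠ s • (z - D.center K) := by
    intro σ hσ τ hτ hne y hy z hz t ht s hs hts heq
    have hzy : z = D.center K + (t / s) • (y - D.center K) := by
      rw [div_eq_inv_mul, ← smul_smul, heq, smul_smul, inv_mul_cancel₀ hs.ne', one_smul,
        add_sub_cancel]
    have hyf := D.face_subset_frontier_cell hσ (subset_closure hy)
    have hzf := D.face_subset_frontier_cell hτ (subset_closure hz)
    rw [frontier, (D.cell_isOpen K).interior_eq] at hyf hzf
    rcases hts.eq_or_lt with rfl | hlt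
    · rw [div_self ht.ne', one_smul, add_sub_cancel] at hzy
      exact Set.disjoint_left.1 (D.face_disjoint hne) hy (hzy ▸ hz)
    · refine hzf.2 (hzy ▸ D.center_add_mem_cell hyf.1 ?_ (by positivity) ((div_lt_one hs).2 hlt))
      rintro rfl
      exact hyf.2 (D.center_mem K)
  rw [Set.disjoint_left]
  rintro _ ⟨y, hy, t, ht, rfl⟩ ⟨z, hz, s, hs, h⟩
  rw [add_right_inj] at h
  rcases le_total t s with hts | hts
  · exact aux σ hσ τ hτ hne y hy z hz t ht.1 s hs.1 hts h
  · exact aux τ hτ σ hσ hne.symm z hz y hy s hs.1 t ht.1 hts h.symm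

theorem sum_dist_le_cellMeas (K : 𝓜) : ∑ σ ∈ D.facesOf K, D.dist K σ ≤ D.cellMeas K := by
  calc ∑ σ ∈ D.facesOf K, D.dist K σ ≤ ∑ σ ∈ D.facesOf K, volume.real (D.pyramid K σ) :=
        Finset.sum_le_sum fun σ hσ => D.dist_le_volume_pyramid hσ
    _ = volume.real (⋃ σ ∈ D.facesOf K, D.pyramid K σ) :=
        (measureReal_biUnion_finset
          (fun σ hσ τ hτ hne => D.pyramid_disjoint hσ hτ hne)
          (fun σ hσ => (D.isOpen_pyramid hσ).measurableSet)
          (fun σ hσ => (D.volume_pyramid_lt_top hσ).ne)).symm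
    _ ≤ D.cellMeas K :=
        measureReal_mono (iUnion₂_subset fun σ hσ => D.pyramid_subset_cell hσ)
          (D.volume_cell_lt_top K).ne

/-- Here the barycentre is x_K + d_{K,σ} n_{K,σ}, so a zero gradient determines the jump: (v_σ −
v_K) n_{K,σ} = (1 − 1/η) d_{K,σ} G_K. Substituting in the definition of G_K ≠ 0 gives |K| = (1 −
1/η) ∑ d_{K,σ}, which is impossible because ∑ d_{K,σ} ≤ |K|. -/
theorem gradCons_eq_zero_of_eq_one {η : ℝ} (hη : 0 < η) {K : 𝓜} {v : Vec 𝓜 𝓔}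
    (h : ∀ σ ∈ D.facesOf K, D.grad η K σ v = 0) : D.gradCons K v = 0 := by
  by_contra hG
  have key : ∀ σ ∈ D.facesOf K,
      (D.faceMeas σ * (v (Sum.inr σ) - v (Sum.inl K))) • D.outward K σ
        = ((1 - η⁻¹) * D.dist K σ) • D.gradCons K v := by
    intro σ hσ
    have hg := h σ hσ
    have hd := D.dist_pos hσ
    have ho := D.norm_outward hσ
    rw [grad, D.faceCenter_sub_center K σ, inner_smul_right] at hg
    rw [D.faceMeas_eq_one σ, one_mul]
    generalize v (Sum.inr σ) - v (Sum.inl K) = δ at hg ⊢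
    have hGo := eq_inner_smul_of_norm_eq_one ho (D.gradCons K v)
    rw [real_inner_comm] at hGo
    set γ := ⟪D.gradCons K v, D.outward K σ⟫
    rw [hGo, ← add_smul, smul_eq_zero] at hg
    have h0 : γ + η / D.dist K σ * (δ - D.dist K σ * γ) = 0 :=
      hg.resolve_right (D.outward_ne_zero hσ)
    rw [hGo, smul_smul]
    congr 1
    field_simp at h0 ⊢
    linarith
  have hsum : D.cellMeas K • D.gradCons K v
      = ((1 - η⁻¹) * ∑ σ ∈ D.facesOf K, D.dist K σ) • D.gradCons K v := by
    conv_lhs => rw [gradCons]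
    rw [smul_smul, mul_inv_cancel₀ (D.cellMeas_pos K).ne', one_smul, Finset.sum_congr rfl key,
      ← Finset.sum_smul, ← Finset.mul_sum]
  have heq : D.cellMeas K = (1 - η⁻¹) * ∑ σ ∈ D.facesOf K, D.dist K σ :=
    smul_left_injective ℝ hG hsum
  have h1 := D.sum_dist_le_cellMeas K
  have h2 := D.cellMeas_pos K
  have h3 : 0 ≤ ∑ σ ∈ D.facesOf K, D.dist K σ := Finset.sum_nonneg fun σ hσ => (D.dist_pos hσ).le
  have h4 : 0 < η⁻¹ := inv_pos.2 hη
  rcases h3.eq_or_lt with h3 | h3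
  · rw [← h3, mul_zero] at heq
    exact h2.ne' heq
  · nlinarith [mul_pos h4 h3]

end DimensionOne

/-! ### Control of the jumps by the discrete gradient, in any dimension -/

variable {d : ℕ} {dom : Domain d} {𝓜 𝓔 : Type*} [Fintype 𝓜] [Fintype 𝓔]
  (D : Discretisation dom 𝓜 𝓔)

/-- A vector with vanishing discrete gradient in a cell is constant there. -/
theorem eq_of_grad_eq_zero (hd : 1 ≤ d) {η : ℝ} (hη : 0 < η) {K : 𝓜} {v : Vec 𝓜 𝓔}
    (h : ∀ σ ∈ D.facesOf K, D.grad η K σ v = 0) {σ : 𝓔} (hσ : σ ∈ D.facesOf K) :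
    v (Sum.inr σ) - v (Sum.inl K) = 0 := by
  have hG : D.gradCons K v = 0 := by
    rcases hd.eq_or_lt with rfl | hd
    · exact D.gradCons_eq_zero_of_eq_one hη h
    · exact D.gradCons_eq_zero_of_two_le hd h
  have hg := h σ hσ
  rw [grad, hG, zero_add, inner_zero_left, sub_zero, smul_eq_zero] at hg
  have := hg.resolve_right (D.outward_ne_zero hσ)
  exact (mul_eq_zero.1 this).resolve_left (div_pos hη (D.dist_pos hσ)).ne'

/-- The discrete gradient controls the jumps between a cell and its faces. -/
theorem exists_sq_sub_le_sum_grad (hd : 1 ≤ d) {η : ℝ} (hη : 0 < η) (K : 𝓜) :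
    ∃ C > 0, ∀ v : Vec 𝓜 𝓔, ∀ σ ∈ D.facesOf K,
      (v (Sum.inr σ) - v (Sum.inl K)) ^ 2 ≤ C * ∑ τ ∈ D.facesOf K, ‖D.grad η K τ v‖ ^ 2 := by
  let A : Vec 𝓜 𝓔 →ₗ[ℝ] ({σ // σ ∈ D.facesOf K} → Pt d) :=
    LinearMap.pi fun σ => D.gradLin η K σ
  let B : Vec 𝓜 𝓔 →ₗ[ℝ] ({σ // σ ∈ D.facesOf K} → ℝ) :=
    LinearMap.pi fun σ => (LinearMap.proj (Sum.inr σ.1) : Vec 𝓜 𝓔 →ₗ[ℝ] ℝ) -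
      LinearMap.proj (Sum.inl K)
  -- Gradients on the cell determine the jumps, so finite dimension supplies a constant, which
  -- depends on the mesh and on η.
  obtain ⟨C, hC, hAB⟩ := exists_norm_le_of_ker_le A B (by
    intro v hv
    rw [LinearMap.mem_ker] at hv ⊢
    ext σ
    refine D.eq_of_grad_eq_zero hd hη (fun τ hτ => ?_) σ.2
    exact congrFun hv ⟨τ, hτ⟩)
  refine ⟨C ^ 2, by positivity, fun v σ hσ => ?_⟩
  have h1 : |v (Sum.inr σ) - v (Sum.inl K)| ≤ ‖B v‖ := norm_le_pi_norm (B v) ⟨σ, hσ⟩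
  have h2 : ‖A v‖ ^ 2 ≤ ∑ τ ∈ D.facesOf K, ‖D.grad η K τ v‖ ^ 2 := by
    have h0 : 0 ≤ ∑ τ ∈ D.facesOf K, ‖D.grad η K τ v‖ ^ 2 :=
      Finset.sum_nonneg fun _ _ => sq_nonneg _
    rw [← Real.le_sqrt (norm_nonneg _) h0]
    refine (pi_norm_le_iff_of_nonneg (Real.sqrt_nonneg _)).2 fun τ => Real.le_sqrt_of_sq_le ?_
    exact Finset.single_le_sum (f := fun τ => ‖D.grad η K τ v‖ ^ 2)
      (fun _ _ => sq_nonneg _) τ.2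
  calc (v (Sum.inr σ) - v (Sum.inl K)) ^ 2 = |v (Sum.inr σ) - v (Sum.inl K)| ^ 2 := (sq_abs _).symm
    _ ≤ (C * ‖A v‖) ^ 2 := by gcongr; exact h1.trans (hAB v)
    _ = C ^ 2 * ‖A v‖ ^ 2 := by ring
    _ ≤ _ := by gcongr

end Discretisation

namespace Discretisation

variable {d : ℕ} {dom : Domain d} {𝓜 𝓔 : Type*} [Fintype 𝓜] [Fintype 𝓔]
  (D : Discretisation dom 𝓜 𝓔)

/-! ### Jumps and the discrete Poincaré inequality -/

/-- The sum of the squares of the jumps between a cell and its faces. -/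
def localJumps (K : 𝓜) (v : Vec 𝓜 𝓔) : ℝ :=
  ∑ σ ∈ D.facesOf K, (v (Sum.inr σ) - v (Sum.inl K)) ^ 2

theorem localJumps_nonneg (K : 𝓜) (v : Vec 𝓜 𝓔) : 0 ≤ D.localJumps K v :=
  Finset.sum_nonneg fun _ _ => sq_nonneg _

theorem sq_sub_le_localJumps {K : 𝓜} {σ : 𝓔} (hσ : σ ∈ D.facesOf K) (v : Vec 𝓜 𝓔) :
    (v (Sum.inr σ) - v (Sum.inl K)) ^ 2 ≤ D.localJumps K v :=
  Finset.single_le_sum (f := fun σ => (v (Sum.inr σ) - v (Sum.inl K)) ^ 2)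
    (fun _ _ => sq_nonneg _) hσ

theorem localJumps_le_sum (K : 𝓜) (v : Vec 𝓜 𝓔) : D.localJumps K v ≤ ∑ L, D.localJumps L v :=
  Finset.single_le_sum (f := fun L => D.localJumps L v)
    (fun L _ => D.localJumps_nonneg L v) (Finset.mem_univ K)

/-- Values vanish on Dirichlet faces, and each passage between a cell and a face costs one jump. -/
theorem exists_sq_le_jumps (hd : 1 ≤ d) :
    ∃ C > 0, ∀ v ∈ D.V0, ∀ i, v i ^ 2 ≤ C * ∑ K, D.localJumps K v := by
  have key : ∀ i, ∃ C : ℝ, ∀ v ∈ D.V0, v i ^ 2 ≤ C * ∑ K, D.localJumps K v := by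
    have step : ∀ i j : 𝓜 ⊕ 𝓔, (∀ v : Vec 𝓜 𝓔, (v j - v i) ^ 2 ≤ ∑ K, D.localJumps K v) →
        (∃ C : ℝ, ∀ v ∈ D.V0, v i ^ 2 ≤ C * ∑ K, D.localJumps K v) →
        ∃ C : ℝ, ∀ v ∈ D.V0, v j ^ 2 ≤ C * ∑ K, D.localJumps K v := by
      rintro i j hij ⟨C, hC⟩
      -- From v_j² ≤ 2 v_i² + 2 (v_j − v_i)².
      refine ⟨2 * C + 2, fun v hv => ?_⟩
      nlinarith [hij v, hC v hv, sq_nonneg (v i - (v j - v i))]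
    refine D.mesh_induction hd (fun σ hσ => ⟨0, fun v hv => by simp [hv σ hσ]⟩) fun K σ hσ => ?_
    have h : ∀ v : Vec 𝓜 𝓔, (v (Sum.inr σ) - v (Sum.inl K)) ^ 2 ≤ ∑ K, D.localJumps K v :=
      fun v => (D.sq_sub_le_localJumps hσ v).trans (D.localJumps_le_sum K v)
    exact ⟨step _ _ h, step _ _ fun v => by rw [← neg_sub, neg_sq]; exact h v⟩
  choose c hc using key
  obtain ⟨C, hC, hCle⟩ := exists_le_of_finite c
  exact ⟨C, hC, fun v hv i => (hc i v hv).trans (mul_le_mul_of_nonneg_right (hCle i)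
    (Finset.sum_nonneg fun K _ => D.localJumps_nonneg K v))⟩

/-! ### Bilinear forms -/

/-- Properties of a tensor field on the pyramids of the mesh that make `a_D^Λ` a bilinear form
which controls the jumps. -/
structure IsElliptic (Λ : Pt d → Pt d →L[ℝ] Pt d) : Prop where
  integrableOn : ∀ K, ∀ σ ∈ D.facesOf K, ∀ ξ ζ : Pt d,
    IntegrableOn (fun x => ⟪ξ, Λ x ζ⟫) (D.pyramid K σ)
  lower : ∃ lo > (0 : ℝ), ∀ K, ∀ σ ∈ D.facesOf K,
    ∀ᵐ x ∂volume.restrict (D.pyramid K σ), ∀ ξ : Pt d, lo * ‖ξ‖ ^ 2 ≤ ⟪ξ, Λ x ξ⟫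

variable {D} {Λ : Pt d → Pt d →L[ℝ] Pt d}

theorem integrableOn_pyramid_inner {C : ℝ}
    (hmeas : AEStronglyMeasurable Λ (volume.restrict dom.Ω)) {ξ ζ : Pt d}
    (hbd : ∀ᵐ x ∂volume.restrict dom.Ω, ‖⟪ξ, Λ x ζ⟫‖ ≤ C) {K : 𝓜} {σ : 𝓔}
    (hσ : σ ∈ D.facesOf K) : IntegrableOn (fun x => ⟪ξ, Λ x ζ⟫) (D.pyramid K σ) := by
  have hle := D.restrict_pyramid_le hσ
  have : IsFiniteMeasure ((volume : Measure (Pt d)).restrict (D.pyramid K σ)) :=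
    ⟨by simpa using D.volume_pyramid_lt_top hσ⟩
  refine Integrable.of_bound ?_ C (ae_mono hle hbd)
  have h1 : AEStronglyMeasurable (fun x => Λ x ζ) (volume.restrict dom.Ω) :=
    (ContinuousLinearMap.apply ℝ (Pt d) ζ).continuous.comp_aestronglyMeasurable hmeas
  exact (aestronglyMeasurable_const.inner h1).mono_measure hle

theorem _root_.HFV.IsDiffusionTensor.isElliptic {lo hi : ℝ} (hlo : 0 < lo)
    (h : IsDiffusionTensor dom.Ω Λ lo hi) : D.IsElliptic Λ where
  integrableOn K σ hσ ξ ζ := by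
    refine integrableOn_pyramid_inner (C := ‖ξ‖ * (hi * ‖ζ‖)) h.meas ?_ hσ
    filter_upwards [h.upper] with x hx
    exact (norm_inner_le_norm _ _).trans (mul_le_mul_of_nonneg_left (hx ζ) (norm_nonneg _))
  lower := ⟨lo, hlo, fun _ _ hσ => ae_mono (D.restrict_pyramid_le hσ) h.lower⟩

theorem _root_.HFV.IsSymmDiffusionTensor.isElliptic {lo hi : ℝ} (hlo : 0 < lo)
    (h : IsSymmDiffusionTensor dom.Ω Λ lo hi) : D.IsElliptic Λ where
  integrableOn K σ hσ ξ ζ := by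
    refine integrableOn_pyramid_inner
      (C := hi * ‖ξ + ζ‖ ^ 2 + hi * ‖ξ - ζ‖ ^ 2) h.meas ?_ hσ
    filter_upwards [h.symm, h.lower, h.upper] with x hs hl hu
    -- The upper bound concerns only the quadratic form; polarisation, which uses the symmetry,
    -- extends it to mixed products.
    have e1 : ⟪ξ + ζ, Λ x (ξ + ζ)⟫ - ⟪ξ - ζ, Λ x (ξ - ζ)⟫ = 4 * ⟪ξ, Λ x ζ⟫ := by
      have : ⟪ζ, Λ x ξ⟫ = ⟪ξ, Λ x ζ⟫ := by rw [← hs ζ ξ, real_inner_comm]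
      simp only [map_add, map_sub, inner_add_left, inner_add_right, inner_sub_left,
        inner_sub_right, this]
      ring
    have p1 := (mul_nonneg hlo.le (sq_nonneg ‖ξ + ζ‖)).trans (hl (ξ + ζ))
    have p2 := (mul_nonneg hlo.le (sq_nonneg ‖ξ - ζ‖)).trans (hl (ξ - ζ))
    rw [Real.norm_eq_abs, abs_le]
    constructor <;> linarith [hu (ξ + ζ), hu (ξ - ζ)]
  lower := ⟨lo, hlo, fun _ _ hσ => ae_mono (D.restrict_pyramid_le hσ) h.lower⟩

namespace IsElliptic

theorem aLoc_add_left (hΛ : D.IsElliptic Λ) (η : ℝ) (K : 𝓜) (u u' v : Vec 𝓜 𝓔) :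
    D.aLoc η Λ K (u + u') v = D.aLoc η Λ K u v + D.aLoc η Λ K u' v := by
  simp only [aLoc, ← Finset.sum_add_distrib]
  refine Finset.sum_congr rfl fun σ hσ => ?_
  rw [← integral_add (hΛ.integrableOn K σ hσ _ _) (hΛ.integrableOn K σ hσ _ _)]
  simp only [← gradLin_apply, map_add, inner_add_right]

theorem aLoc_add_right (hΛ : D.IsElliptic Λ) (η : ℝ) (K : 𝓜) (u v v' : Vec 𝓜 𝓔) :
    D.aLoc η Λ K u (v + v') = D.aLoc η Λ K u v + D.aLoc η Λ K u v' := by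
  simp only [aLoc, ← Finset.sum_add_distrib]
  refine Finset.sum_congr rfl fun σ hσ => ?_
  rw [← integral_add (hΛ.integrableOn K σ hσ _ _) (hΛ.integrableOn K σ hσ _ _)]
  simp only [← gradLin_apply, map_add, inner_add_left]

end IsElliptic

theorem aLoc_smul_left (η : ℝ) (Λ : Pt d → Pt d →L[ℝ] Pt d) (K : 𝓜) (c : ℝ) (u v : Vec 𝓜 𝓔) :
    D.aLoc η Λ K (c • u) v = c • D.aLoc η Λ K u v := by
  simp only [aLoc, Finset.smul_sum]
  refine Finset.sum_congr rfl fun σ _ => ?_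
  rw [← integral_smul]
  simp only [← gradLin_apply, map_smul, inner_smul_right, smul_eq_mul]

theorem aLoc_smul_right (η : ℝ) (Λ : Pt d → Pt d →L[ℝ] Pt d) (K : 𝓜) (c : ℝ) (u v : Vec 𝓜 𝓔) :
    D.aLoc η Λ K u (c • v) = c • D.aLoc η Λ K u v := by
  simp only [aLoc, Finset.smul_sum]
  refine Finset.sum_congr rfl fun σ _ => ?_
  rw [← integral_smul]
  simp only [← gradLin_apply, map_smul, inner_smul_left, smul_eq_mul, conj_trivial]

namespace IsElliptic

/-- The form `a_D^Λ` as a bilinear map. -/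
noncomputable def bilin (hΛ : D.IsElliptic Λ) (η : ℝ) : Vec 𝓜 𝓔 →ₗ[ℝ] Vec 𝓜 𝓔 →ₗ[ℝ] ℝ :=
  LinearMap.mk₂ ℝ (D.aForm η Λ)
    (fun u u' v => by simp only [aForm, hΛ.aLoc_add_left, Finset.sum_add_distrib])
    (fun c u v => by simp only [aForm, aLoc_smul_left, Finset.smul_sum])
    (fun u v v' => by simp only [aForm, hΛ.aLoc_add_right, Finset.sum_add_distrib])
    (fun c u v => by simp only [aForm, aLoc_smul_right, Finset.smul_sum])

theorem bilin_apply (hΛ : D.IsElliptic Λ) (η : ℝ) (u v : Vec 𝓜 𝓔) :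
    hΛ.bilin η u v = D.aForm η Λ u v := rfl

theorem continuous_aForm_self (hΛ : D.IsElliptic Λ) (η : ℝ) :
    Continuous fun v => D.aForm η Λ v v := by
  have : Continuous fun v => (hΛ.bilin η).toContinuousBilinearMap v v := by fun_prop
  exact this

/-- Local coercivity: `a_K^Λ` controls the jumps in the cell `K`. -/
theorem exists_localJumps_le (hd : 1 ≤ d) {η : ℝ} (hη : 0 < η) (hΛ : D.IsElliptic Λ) :
    ∃ c > 0, ∀ K, ∀ v, c * D.localJumps K v ≤ D.aLoc η Λ K v v := by
  obtain ⟨lo, hlo, hlower⟩ := hΛ.lower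
  have key : ∀ K, ∃ c > 0, ∀ v, c * D.localJumps K v ≤ D.aLoc η Λ K v v := by
    intro K
    obtain ⟨C, hC, hgrad⟩ := D.exists_sq_sub_le_sum_grad hd hη K
    obtain ⟨p, hp, hvol⟩ := exists_pos_le_of_finite
      (c := fun σ : {σ // σ ∈ D.facesOf K} => volume.real (D.pyramid K σ.1))
      fun σ => D.volume_real_pyramid_pos σ.2
    -- The discrete gradient is constant on each pyramid, so ellipticity integrates to its squared
    -- norm times a volume at least p.
    have hlow : ∀ v, lo * p * ∑ σ ∈ D.facesOf K, ‖D.grad η K σ v‖ ^ 2 ≤ D.aLoc η Λ K v v := by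
      intro v
      rw [aLoc, Finset.mul_sum]
      refine Finset.sum_le_sum fun σ hσ => ?_
      have hconst : IntegrableOn (fun _ => lo * ‖D.grad η K σ v‖ ^ 2) (D.pyramid K σ) :=
        integrableOn_const (D.volume_pyramid_lt_top hσ).ne
      have h1 := integral_mono_ae hconst (hΛ.integrableOn K σ hσ (D.grad η K σ v)
        (D.grad η K σ v)) ((hlower K σ hσ).mono fun x hx => hx _)
      rw [setIntegral_const, smul_eq_mul] at h1
      refine le_trans ?_ h1
      have h2 : p ≤ volume.real (D.pyramid K σ) := hvol ⟨σ, hσ⟩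
      have h3 : 0 ≤ lo * ‖D.grad η K σ v‖ ^ 2 := by positivity
      nlinarith
    have hm : (0 : ℝ) < (D.facesOf K).card + 1 := by positivity
    refine ⟨lo * p / (((D.facesOf K).card + 1) * C), by positivity, fun v => ?_⟩
    refine le_trans ?_ (hlow v)
    have h1 : D.localJumps K v ≤
        ((D.facesOf K).card + 1) * (C * ∑ σ ∈ D.facesOf K, ‖D.grad η K σ v‖ ^ 2) := by
      have h0 : 0 ≤ C * ∑ σ ∈ D.facesOf K, ‖D.grad η K σ v‖ ^ 2 := by positivity
      have := Finset.sum_le_card_nsmul (D.facesOf K)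
        (fun σ => (v (Sum.inr σ) - v (Sum.inl K)) ^ 2) _ (fun σ hσ => hgrad v σ hσ)
      rw [nsmul_eq_mul] at this
      rw [localJumps]
      linarith
    rw [div_mul_eq_mul_div, div_le_iff₀ (by positivity)]
    calc lo * p * D.localJumps K v ≤ lo * p *
          (((D.facesOf K).card + 1) * (C * ∑ σ ∈ D.facesOf K, ‖D.grad η K σ v‖ ^ 2)) := by
          gcongr
      _ = _ := by ring
  choose c hc0 hc using key
  obtain ⟨c₀, hc₀, hle⟩ := exists_pos_le_of_finite hc0
  exact ⟨c₀, hc₀, fun K v =>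
    (mul_le_mul_of_nonneg_right (hle K) (D.localJumps_nonneg K v)).trans (hc K v)⟩

/-- Coercivity of `a_D^Λ` on `V_{D,0}`. -/
theorem exists_coercive (hd : 1 ≤ d) {η : ℝ} (hη : 0 < η) (hΛ : D.IsElliptic Λ) :
    ∃ c > 0, ∀ v ∈ D.V0, ∀ i, c * v i ^ 2 ≤ D.aForm η Λ v v := by
  obtain ⟨c, hc, h1⟩ := hΛ.exists_localJumps_le hd hη
  obtain ⟨C, hC, h2⟩ := D.exists_sq_le_jumps hd
  refine ⟨c / C, by positivity, fun v hv i => ?_⟩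
  calc c / C * v i ^ 2 ≤ c / C * (C * ∑ K, D.localJumps K v) := by gcongr; exact h2 v hv i
    _ = ∑ K, c * D.localJumps K v := by rw [← Finset.mul_sum]; field_simp
    _ ≤ _ := Finset.sum_le_sum fun K _ => h1 K v

theorem aLoc_self_nonneg (hΛ : D.IsElliptic Λ) (η : ℝ) (K : 𝓜) (v : Vec 𝓜 𝓔) :
    0 ≤ D.aLoc η Λ K v v := by
  obtain ⟨lo, hlo, hlower⟩ := hΛ.lower
  refine Finset.sum_nonneg fun σ hσ => integral_nonneg_of_ae ?_
  filter_upwards [hlower K σ hσ] with x hx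
  exact (by positivity : 0 ≤ lo * ‖D.grad η K σ v‖ ^ 2).trans (hx _)

theorem aForm_self_nonneg (hΛ : D.IsElliptic Λ) (η : ℝ) (v : Vec 𝓜 𝓔) :
    0 ≤ D.aForm η Λ v v :=
  Finset.sum_nonneg fun K _ => hΛ.aLoc_self_nonneg η K v

end IsElliptic

theorem aForm_comm {lo hi : ℝ} (h : IsSymmDiffusionTensor dom.Ω Λ lo hi) (η : ℝ)
    (u v : Vec 𝓜 𝓔) : D.aForm η Λ u v = D.aForm η Λ v u := by
  refine Finset.sum_congr rfl fun K _ => Finset.sum_congr rfl fun σ hσ => ?_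
  refine integral_congr_ae ?_
  filter_upwards [ae_mono (D.restrict_pyramid_le hσ) h.symm] with x hx
  rw [← hx, real_inner_comm]

end Discretisation

/-! ### The primitive of the inverse statistics -/

theorem Statistics.hasDerivAt_integral_g (S : Statistics) (s : ℝ) :
    HasDerivAt (fun s => ∫ t in (0 : ℝ)..s, S.g t) (S.g s) s :=
  intervalIntegral.integral_hasDerivAt_right (S.continuous_g.intervalIntegrable _ _)
    S.continuous_g.aestronglyMeasurable.stronglyMeasurableAtFilter S.continuous_g.continuousAt

/-- The primitive of the increasing function g is convex and lies above its tangent at 0. -/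
theorem Statistics.mul_le_integral_g (S : Statistics) (s : ℝ) :
    S.g 0 * s ≤ ∫ t in (0 : ℝ)..s, S.g t := by
  rcases le_total 0 s with hs | hs
  · have := intervalIntegral.integral_mono_on hs (intervalIntegrable_const (c := S.g 0))
      (S.continuous_g.intervalIntegrable (μ := volume) _ _)
      fun t ht => S.strictMono_g.monotone ht.1
    rw [intervalIntegral.integral_const, smul_eq_mul] at this
    linarith
  · have := intervalIntegral.integral_mono_on hs
      (S.continuous_g.intervalIntegrable (μ := volume) _ _)
      (intervalIntegrable_const (c := S.g 0)) fun t ht => S.strictMono_g.monotone ht.2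
    rw [intervalIntegral.integral_const, smul_eq_mul] at this
    rw [intervalIntegral.integral_symm]
    linarith

/-! ### The space V_{D,0} -/

namespace Discretisation

variable {d : ℕ} {dom : Domain d} {𝓜 𝓔 : Type*} [Fintype 𝓜] [Fintype 𝓔]
  (D : Discretisation dom 𝓜 𝓔)

theorem zero_mem_V0 : (0 : Vec 𝓜 𝓔) ∈ D.V0 := fun _ _ => rfl

variable {D}

theorem add_mem_V0 {u v : Vec 𝓜 𝓔} (hu : u ∈ D.V0) (hv : v ∈ D.V0) : u + v ∈ D.V0 :=
  fun σ hσ => by rw [Pi.add_apply, hu σ hσ, hv σ hσ, add_zero]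

theorem sub_mem_V0 {u v : Vec 𝓜 𝓔} (hu : u ∈ D.V0) (hv : v ∈ D.V0) : u - v ∈ D.V0 :=
  fun σ hσ => by rw [Pi.sub_apply, hu σ hσ, hv σ hσ, sub_zero]

theorem smul_mem_V0 (c : ℝ) {v : Vec 𝓜 𝓔} (hv : v ∈ D.V0) : c • v ∈ D.V0 :=
  fun σ hσ => by rw [Pi.smul_apply, hv σ hσ, smul_zero]

variable (D)

theorem isClosed_V0 : IsClosed D.V0 := by
  have : D.V0 = ⋂ σ ∈ D.dirichletFaces, {v : Vec 𝓜 𝓔 | v (Sum.inr σ) = 0} := by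
    ext v; simp [V0]
  rw [this]
  exact isClosed_biInter fun σ _ => isClosed_eq (continuous_apply _) continuous_const

end Discretisation

open Discretisation

/-! ### Existence and uniqueness of the discrete thermal equilibrium -/

section Equilibrium

variable {d : ℕ} {dom : Domain d} {𝓜 𝓔 : Type*} [Fintype 𝓜] [Fintype 𝓔]
  (data : PhysicalData dom) (D : Discretisation dom 𝓜 𝓔)

theorem PhysicalData.isElliptic_Λφ : D.IsElliptic data.Λφ := by
  obtain ⟨lo, hi, hlo, -, h⟩ := data.Λφ_tensor
  exact h.isElliptic hlo

theorem PhysicalData.isElliptic_ΛN : D.IsElliptic data.ΛN := by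
  obtain ⟨lo, hi, hlo, -, h, -⟩ := data.ΛNP_tensor
  exact h.isElliptic hlo

theorem PhysicalData.isElliptic_ΛP : D.IsElliptic data.ΛP := by
  obtain ⟨lo, hi, hlo, -, -, h⟩ := data.ΛNP_tensor
  exact h.isElliptic hlo

theorem PhysicalData.aForm_Λφ_comm (η : ℝ) (u v : Vec 𝓜 𝓔) :
    D.aForm η data.Λφ u v = D.aForm η data.Λφ v u := by
  obtain ⟨lo, hi, hlo, -, h⟩ := data.Λφ_tensor
  exact aForm_comm h η u v

theorem restrict_cell_le (K : 𝓜) :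
    (volume.restrict (D.cell K) : Measure (Pt d)) ≤ volume.restrict dom.Ω :=
  Measure.restrict_mono_set _ (D.cell_subset K)

theorem PhysicalData.integrableOn_C (K : 𝓜) : IntegrableOn data.C (D.cell K) := by
  have : IsFiniteMeasure ((volume : Measure (Pt d)).restrict (D.cell K)) :=
    ⟨by simpa using D.volume_cell_lt_top K⟩
  exact (data.C_memLp.mono_measure (restrict_cell_le D K)).integrable le_top

theorem Lφ_eq (η : ℝ) (v : Vec 𝓜 𝓔) :
    Lφ data D η v = ∑ K, (∫ x in D.cell K, data.C x) * v (Sum.inl K)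
      - D.aForm η data.Λφ (D.interpolate data.φD) v := by
  rw [Lφ, D.setIntegral_eq_sum (f := fun K x => data.C x * v (Sum.inl K))
    (fun K x hx => by rw [D.recon_apply v hx])
    fun K => (data.integrableOn_C D K).mul_const _]
  simp only [integral_mul_const]

/-- The discrete Poisson equation, tested against `V_{D,0}`. -/
def IsPoisson (η : ℝ) (N P φ : Vec 𝓜 𝓔) : Prop :=
  ∀ v ∈ D.V0, D.aForm η data.Λφ φ v = ∑ K, (∫ x in D.cell K, data.C x) * v (Sum.inl K)
    + ∑ K, D.cellMeas K * ((P (Sum.inl K) - N (Sum.inl K)) * v (Sum.inl K))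

variable {data D}

theorem aForm_sub_left (η : ℝ) (u u' v : Vec 𝓜 𝓔) :
    D.aForm η data.Λφ (u - u') v = D.aForm η data.Λφ u v - D.aForm η data.Λφ u' v := by
  simp only [← (data.isElliptic_Λφ D).bilin_apply, map_sub, LinearMap.sub_apply]

/-- The doping term is common to both equations and drops out. -/
theorem IsPoisson.sub {η : ℝ} {N P φ N' P' φ' : Vec 𝓜 𝓔} (h' : IsPoisson data D η N' P' φ')
    (h : IsPoisson data D η N P φ) {v : Vec 𝓜 𝓔} (hv : v ∈ D.V0) :
    D.aForm η data.Λφ (φ' - φ) v = ∑ K, D.cellMeas K *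
      (((P' (Sum.inl K) - P (Sum.inl K)) - (N' (Sum.inl K) - N (Sum.inl K))) * v (Sum.inl K)) := by
  rw [aForm_sub_left, h' v hv, h v hv, add_sub_add_left_eq_sub, ← Finset.sum_sub_distrib]
  exact Finset.sum_congr rfl fun K _ => by ring

/-- The lifting φ^D enters both sides through the same term −a(φ^D_D, v). -/
theorem isPoisson_iff {η : ℝ} {N P φ : Vec 𝓜 𝓔} :
    IsPoisson data D η N P φ ↔ ∀ v ∈ D.V0,
      D.aForm η data.Λφ (φ - D.interpolate data.φD) v = Lφ data D η v
        + ∑ K, D.cellMeas K * ((P (Sum.inl K) - N (Sum.inl K)) * v (Sum.inl K)) := by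
  refine forall₂_congr fun v _ => ?_
  rw [aForm_sub_left, Lφ_eq]
  constructor <;> intro h <;> linarith

theorem isThermalEquilibrium_iff {η : ℝ} {Ne Pe φe : Vec 𝓜 𝓔} :
    IsThermalEquilibrium data D η Ne Pe φe ↔
      φe - D.interpolate data.φD ∈ D.V0 ∧ (∀ i, Ne i = data.stat.g (data.αN + φe i)) ∧
        (∀ i, Pe i = data.stat.g (data.αP - φe i)) ∧ IsPoisson data D η Ne Pe φe := by
  have aux : (∀ i, Ne i = data.stat.g (data.αN + φe i)) →
      (∀ i, Pe i = data.stat.g (data.αP - φe i)) → ∀ v : Vec 𝓜 𝓔,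
      ∫ x in dom.Ω, (data.stat.g (data.αP - D.recon φe x)
          - data.stat.g (data.αN + D.recon φe x)) * D.recon v x
        = ∑ K, D.cellMeas K * ((Pe (Sum.inl K) - Ne (Sum.inl K)) * v (Sum.inl K)) := by
    intro hN hP v
    refine D.setIntegral_const_cells fun K x hx => ?_
    rw [D.recon_apply φe hx, D.recon_apply v hx, hN, hP]
  constructor
  · rintro ⟨h1, h2, h3, h4⟩
    refine ⟨h1, h3, h4, isPoisson_iff.2 fun v hv => ?_⟩
    rw [← aux h3 h4, h2 v hv]
  · rintro ⟨h1, h3, h4, h2⟩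
    refine ⟨h1, fun v hv => ?_, h3, h4⟩
    rw [aux h3 h4, isPoisson_iff.1 h2 v hv]

theorem eq_zero_of_aForm_self_nonpos (hd : 1 ≤ d) {η : ℝ} (hη : 0 < η) {v : Vec 𝓜 𝓔}
    (hv : v ∈ D.V0) (h : D.aForm η data.Λφ v v ≤ 0) : v = 0 := by
  obtain ⟨c, hc, hcoer⟩ := (data.isElliptic_Λφ D).exists_coercive hd hη
  ext i
  have h1 := hcoer v hv i
  have h2 : v i ^ 2 ≤ 0 := by
    by_contra! h3
    nlinarith [mul_pos hc h3]
  simpa using le_antisymm h2 (sq_nonneg _)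

/-- The charge g(α_P − φ) − g(α_N + φ) decreases with φ, so testing the difference of the two
Poisson equations with φ − φ' gives a(φ − φ', φ − φ') ≤ 0. -/
theorem IsThermalEquilibrium.unique (hd : 1 ≤ d) {η : ℝ} (hη : 0 < η)
    {N P φ N' P' φ' : Vec 𝓜 𝓔} (h : IsThermalEquilibrium data D η N P φ)
    (h' : IsThermalEquilibrium data D η N' P' φ') : N = N' ∧ P = P' ∧ φ = φ' := by
  obtain ⟨h1, h2, h3, h4⟩ := isThermalEquilibrium_iff.1 h
  obtain ⟨h1', h2', h3', h4'⟩ := isThermalEquilibrium_iff.1 h'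
  have hv : φ - φ' ∈ D.V0 := by
    have := sub_mem_V0 h1 h1'
    rwa [sub_sub_sub_cancel_right] at this
  have hφ : φ - φ' = 0 := by
    refine eq_zero_of_aForm_self_nonpos (data := data) hd hη hv ?_
    rw [h4.sub h4' hv]
    refine Finset.sum_nonpos fun K _ =>
      mul_nonpos_of_nonneg_of_nonpos (D.cellMeas_pos K).le ?_
    rw [h2, h3, h2', h3', Pi.sub_apply]
    have hg := data.stat.strictMono_g.monotone
    rcases le_total (φ (Sum.inl K)) (φ' (Sum.inl K)) with hle | hle
    · refine mul_nonpos_of_nonneg_of_nonpos (sub_nonneg.2 ?_) (by linarith)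
      have e1 := hg (show data.αN + φ (Sum.inl K) ≤ data.αN + φ' (Sum.inl K) by linarith)
      have e2 := hg (show data.αP - φ' (Sum.inl K) ≤ data.αP - φ (Sum.inl K) by linarith)
      linarith
    · refine mul_nonpos_of_nonpos_of_nonneg (sub_nonpos.2 ?_) (by linarith)
      have e1 := hg (show data.αN + φ' (Sum.inl K) ≤ data.αN + φ (Sum.inl K) by linarith)
      have e2 := hg (show data.αP - φ (Sum.inl K) ≤ data.αP - φ' (Sum.inl K) by linarith)
      linarith
  have hφ' : φ = φ' := sub_eq_zero.1 hφ
  refine ⟨?_, ?_, hφ'⟩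
  · ext i; rw [h2, h2', hφ']
  · ext i; rw [h3, h3', hφ']

variable (data D)

/-- The energy functional whose minimiser over `V_{D,0}` is `φ^e - φ_D^D`. -/
noncomputable def equilibriumEnergy (η : ℝ) (ψ : Vec 𝓜 𝓔) : ℝ :=
  1 / 2 * D.aForm η data.Λφ ψ ψ - Lφ data D η ψ
    + ∑ K, D.cellMeas K *
      ((∫ t in (0 : ℝ)..(data.αN + (D.interpolate data.φD (Sum.inl K) + ψ (Sum.inl K))),
          data.stat.g t)
        + ∫ t in (0 : ℝ)..(data.αP - (D.interpolate data.φD (Sum.inl K) + ψ (Sum.inl K))),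
          data.stat.g t)

/-- `L_D^φ` as a linear map. -/
noncomputable def LφLin (η : ℝ) : Vec 𝓜 𝓔 →ₗ[ℝ] ℝ where
  toFun := Lφ data D η
  map_add' u v := by
    simp only [Lφ_eq, ← (data.isElliptic_Λφ D).bilin_apply, map_add, Pi.add_apply, mul_add,
      Finset.sum_add_distrib]
    ring
  map_smul' c v := by
    simp only [Lφ_eq, ← (data.isElliptic_Λφ D).bilin_apply, map_smul, Pi.smul_apply, smul_eq_mul,
      RingHom.id_apply, mul_sub, Finset.mul_sum]
    congr 1
    exact Finset.sum_congr rfl fun K _ => by ring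

theorem continuous_equilibriumEnergy (η : ℝ) : Continuous (equilibriumEnergy data D η) := by
  have h1 := (data.isElliptic_Λφ D).continuous_aForm_self η
  have h2 : Continuous (Lφ data D η) := (LφLin data D η).continuous_of_finiteDimensional
  have h3 : Continuous fun s => ∫ t in (0 : ℝ)..s, data.stat.g t :=
    continuous_iff_continuousAt.2 fun s => (data.stat.hasDerivAt_integral_g s).continuousAt
  refine ((continuous_const.mul h1).sub h2).add (continuous_finsetSum _ fun K _ => ?_)
  exact continuous_const.mul ((h3.comp (by fun_prop)).add (h3.comp (by fun_prop)))

theorem exists_isMinOn_equilibriumEnergy (hd : 1 ≤ d) {η : ℝ} (hη : 0 < η) :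
    ∃ ψ ∈ D.V0, IsMinOn (equilibriumEnergy data D η) D.V0 ψ := by
  obtain ⟨c, hc, hcoer⟩ := (data.isElliptic_Λφ D).exists_coercive hd hη
  set A := ‖LinearMap.toContinuousLinearMap (LφLin data D η)‖
  -- Tangent bounds for the two primitives add up to a constant, since φ enters them with opposite
  -- signs.
  set C := ∑ K, D.cellMeas K * (data.stat.g 0 * (data.αN + data.αP))
  have hlow : ∀ ψ ∈ D.V0, 1 / 2 * (c * ‖ψ‖ ^ 2) - A * ‖ψ‖ + C ≤ equilibriumEnergy data D η ψ := by
    intro ψ hψ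
    have h1 : c * ‖ψ‖ ^ 2 ≤ D.aForm η data.Λφ ψ ψ := by
      rw [← le_div_iff₀' hc, ← Real.le_sqrt (norm_nonneg _)
        (div_nonneg ((data.isElliptic_Λφ D).aForm_self_nonneg η ψ) hc.le)]
      refine (pi_norm_le_iff_of_nonneg (Real.sqrt_nonneg _)).2 fun i => Real.le_sqrt_of_sq_le ?_
      rw [le_div_iff₀' hc, Real.norm_eq_abs, sq_abs]
      exact hcoer ψ hψ i
    have h2 : Lφ data D η ψ ≤ A * ‖ψ‖ := (le_abs_self _).trans
      ((LinearMap.toContinuousLinearMap (LφLin data D η)).le_opNorm ψ)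
    have h3 : C ≤ ∑ K, D.cellMeas K *
      ((∫ t in (0 : ℝ)..(data.αN + (D.interpolate data.φD (Sum.inl K) + ψ (Sum.inl K))),
          data.stat.g t)
        + ∫ t in (0 : ℝ)..(data.αP - (D.interpolate data.φD (Sum.inl K) + ψ (Sum.inl K))),
          data.stat.g t) := by
      refine Finset.sum_le_sum fun K _ => mul_le_mul_of_nonneg_left ?_ (D.cellMeas_pos K).le
      have e1 := data.stat.mul_le_integral_g
        (data.αN + (D.interpolate data.φD (Sum.inl K) + ψ (Sum.inl K)))
      have e2 := data.stat.mul_le_integral_g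
        (data.αP - (D.interpolate data.φD (Sum.inl K) + ψ (Sum.inl K)))
      linarith
    unfold equilibriumEnergy
    linarith
  refine (continuous_equilibriumEnergy data D η).continuousOn.exists_isMinOn' D.isClosed_V0
    D.zero_mem_V0 ?_
  rw [eventually_inf_principal]
  set J := equilibriumEnergy data D η 0
  have hA : 0 ≤ A := norm_nonneg _
  -- Beyond this radius, ½c‖ψ‖² − A‖ψ‖ ≥ (|C| + |J|)‖ψ‖ ≥ |C| + |J|, so the energy exceeds its value
  -- J at 0.
  filter_upwards [(tendsto_norm_cocompact_atTop (E := Vec 𝓜 𝓔)).eventually_ge_atTop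
    (max 1 (2 * (A + |C| + |J|) / c))] with ψ hψ hψV
  refine le_trans ?_ (hlow ψ hψV)
  have h1 : 1 ≤ ‖ψ‖ := (le_max_left _ _).trans hψ
  have h2 : 2 * (A + |C| + |J|) ≤ ‖ψ‖ * c := (div_le_iff₀ hc).1 ((le_max_right _ _).trans hψ)
  have h3 := mul_le_mul_of_nonneg_right h2 (norm_nonneg ψ)
  have h4 : |C| + |J| ≤ (|C| + |J|) * ‖ψ‖ := le_mul_of_one_le_right (by positivity) h1
  nlinarith [neg_abs_le C, le_abs_self J]

variable {data D} in
theorem hasDerivAt_equilibriumEnergy (η : ℝ) (ψ v : Vec 𝓜 𝓔) :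
    HasDerivAt (fun t : ℝ => equilibriumEnergy data D η (ψ + t • v))
      (D.aForm η data.Λφ ψ v - Lφ data D η v + ∑ K, D.cellMeas K *
        ((data.stat.g (data.αN + (D.interpolate data.φD (Sum.inl K) + ψ (Sum.inl K)))
          - data.stat.g (data.αP - (D.interpolate data.φD (Sum.inl K) + ψ (Sum.inl K))))
          * v (Sum.inl K))) 0 := by
  have e1 : ∀ t : ℝ, 1 / 2 * D.aForm η data.Λφ (ψ + t • v) (ψ + t • v)
      = 1 / 2 * D.aForm η data.Λφ ψ ψ + t * D.aForm η data.Λφ ψ v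
        + t ^ 2 * (1 / 2 * D.aForm η data.Λφ v v) := by
    intro t
    -- Symmetry of Λ_φ merges the two cross terms, so the derivative of the quadratic part is a(ψ,
    -- v).
    have hs := data.aForm_Λφ_comm D η v ψ
    simp only [← (data.isElliptic_Λφ D).bilin_apply, map_add, map_smul, LinearMap.add_apply,
      LinearMap.smul_apply, smul_eq_mul] at hs ⊢
    rw [hs]
    ring
  have e2 : ∀ t : ℝ, Lφ data D η (ψ + t • v) = Lφ data D η ψ + t * Lφ data D η v := by
    intro t
    have := (LφLin data D η).map_add ψ (t • v)
    rw [map_smul] at this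
    exact this
  unfold equilibriumEnergy
  simp only [e1, e2]
  refine HasDerivAt.add (HasDerivAt.sub ?_ ?_) (HasDerivAt.fun_sum fun K _ => ?_)
  · have h1 : HasDerivAt (fun t : ℝ => t * D.aForm η data.Λφ ψ v) (D.aForm η data.Λφ ψ v) 0 :=
      hasDerivAt_mul_const _
    have h2 : HasDerivAt (fun t : ℝ => t ^ 2 * (1 / 2 * D.aForm η data.Λφ v v)) 0 0 := by
      simpa using (hasDerivAt_pow 2 (0 : ℝ)).mul_const (1 / 2 * D.aForm η data.Λφ v v)
    have h3 := (h1.const_add (1 / 2 * D.aForm η data.Λφ ψ ψ)).fun_add h2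
    rwa [add_zero] at h3
  · exact (hasDerivAt_mul_const _).const_add _
  · rw [sub_mul, sub_eq_add_neg, ← mul_neg]
    refine HasDerivAt.const_mul _ (HasDerivAt.add ?_ ?_)
    · refine HasDerivAt.comp_of_eq (0 : ℝ) (data.stat.hasDerivAt_integral_g _) ?_ (by simp)
      simpa using (((hasDerivAt_mul_const (v (Sum.inl K))).const_add (ψ (Sum.inl K))).const_add
        (D.interpolate data.φD (Sum.inl K))).const_add data.αN
    · refine HasDerivAt.comp_of_eq (0 : ℝ) (data.stat.hasDerivAt_integral_g _) ?_ (by simp)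
      simpa using (((hasDerivAt_mul_const (v (Sum.inl K))).const_add (ψ (Sum.inl K))).const_add
        (D.interpolate data.φD (Sum.inl K))).const_sub data.αP

/-- The Euler–Lagrange equation of the energy on V_{D,0} is the nonlinear discrete Poisson equation.
-/
theorem exists_isThermalEquilibrium (hd : 1 ≤ d) {η : ℝ} (hη : 0 < η) :
    ∃ Ne Pe φe : Vec 𝓜 𝓔, IsThermalEquilibrium data D η Ne Pe φe := by
  obtain ⟨ψ, hψ, hmin⟩ := exists_isMinOn_equilibriumEnergy data D hd hη
  refine ⟨_, _, D.interpolate data.φD + ψ, isThermalEquilibrium_iff.2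
    ⟨by rwa [add_sub_cancel_left], fun _ => rfl, fun _ => rfl, isPoisson_iff.2 fun v hv => ?_⟩⟩
  have hloc : IsLocalMin (fun t : ℝ => equilibriumEnergy data D η (ψ + t • v)) 0 := by
    refine Eventually.of_forall fun t => ?_
    simp only [zero_smul, add_zero]
    exact hmin (add_mem_V0 hψ (smul_mem_V0 t hv))
  have h0 := hloc.hasDerivAt_eq_zero (hasDerivAt_equilibriumEnergy η ψ v)
  rw [add_sub_cancel_left, ← sub_eq_zero, ← h0, ← sub_sub, sub_eq_add_neg, ← Finset.sum_neg_distrib]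
  congr 1
  refine Finset.sum_congr rfl fun K _ => ?_
  simp only [Pi.add_apply]
  ring

end Equilibrium

open Discretisation

/-! ### Reconstructed densities and dissipation -/

namespace Discretisation

variable {d : ℕ} {dom : Domain d} {𝓜 𝓔 : Type*} [Fintype 𝓜] [Fintype 𝓔]
  {D : Discretisation dom 𝓜 𝓔} {S : Statistics} {m : ℝ → ℝ → ℝ} {Λ : Pt d → Pt d →L[ℝ] Pt d}
  {u : Vec 𝓜 𝓔}

theorem rLoc_nonneg (hm : S.IsMean m) (hu : ∀ i, u i ∈ S.I) (K : 𝓜) : 0 ≤ D.rLoc m K u :=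
  div_nonneg (Finset.sum_nonneg fun _ _ => (hm.mem _ (hu _) _ (hu _)).1.le) (Nat.cast_nonneg _)

theorem T_summand_nonneg (hm : S.IsMean m) (hu : ∀ i, u i ∈ S.I) (hΛ : D.IsElliptic Λ) (η : ℝ)
    (K : 𝓜) (w : Vec 𝓜 𝓔) : 0 ≤ D.rLoc m K u * D.aLoc η Λ K w w :=
  mul_nonneg (rLoc_nonneg hm hu K) (hΛ.aLoc_self_nonneg η K w)

theorem T_self_nonneg (hm : S.IsMean m) (hu : ∀ i, u i ∈ S.I) (hΛ : D.IsElliptic Λ) (η : ℝ)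
    (w : Vec 𝓜 𝓔) : 0 ≤ D.T η m Λ u w w :=
  Finset.sum_nonneg fun K _ => T_summand_nonneg hm hu hΛ η K w

/-- The dissipation controls each jump of `w`, weighted by `m_h`. -/
theorem exists_mh_mul_sq_le_T (hm : S.IsMean m) (hd : 1 ≤ d) {η : ℝ} (hη : 0 < η)
    (hΛ : D.IsElliptic Λ) :
    ∃ C > 0, ∀ u : Vec 𝓜 𝓔, (∀ i, u i ∈ S.I) → ∀ w, ∀ K, ∀ σ ∈ D.facesOf K,
      S.mh (u (Sum.inl K)) (u (Sum.inr σ)) * (w (Sum.inr σ) - w (Sum.inl K)) ^ 2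
        ≤ C * D.T η m Λ u w w := by
  obtain ⟨c, hc, hloc⟩ := hΛ.exists_localJumps_le hd hη
  obtain ⟨q, hq, hcard⟩ := exists_le_of_finite fun K => ((D.facesOf K).card : ℝ)
  refine ⟨q / c, by positivity, fun u hu w K σ hσ => ?_⟩
  set x := u (Sum.inl K)
  set y := u (Sum.inr σ)
  have hpos : (0 : ℝ) < (D.facesOf K).card := by exact_mod_cast Finset.card_pos.2 ⟨σ, hσ⟩
  -- r_K averages positive means over at most q faces, so each of them is at most q·r_K.
  have h1 : S.mh x y ≤ q * D.rLoc m K u := by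
    have h2 : m x y ≤ ∑ σ ∈ D.facesOf K, m (u (Sum.inl K)) (u (Sum.inr σ)) :=
      Finset.single_le_sum (f := fun σ => m (u (Sum.inl K)) (u (Sum.inr σ)))
        (fun σ _ => (hm.mem _ (hu _) _ (hu _)).1.le) hσ
    have h3 : (D.facesOf K).card * D.rLoc m K u
        = ∑ σ ∈ D.facesOf K, m (u (Sum.inl K)) (u (Sum.inr σ)) := by
      rw [rLoc, mul_div_cancel₀ _ hpos.ne']
    have h4 := mul_le_mul_of_nonneg_right (hcard K) (rLoc_nonneg (D := D) hm hu K)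
    exact (hm.mh_le _ (hu _) _ (hu _)).trans (h2.trans (h3 ▸ h4))
  have h5 : c * (w (Sum.inr σ) - w (Sum.inl K)) ^ 2 ≤ D.aLoc η Λ K w w :=
    (mul_le_mul_of_nonneg_left (D.sq_sub_le_localJumps hσ w) hc.le).trans (hloc K w)
  have h6 : D.rLoc m K u * D.aLoc η Λ K w w ≤ D.T η m Λ u w w :=
    Finset.single_le_sum (f := fun K => D.rLoc m K u * D.aLoc η Λ K w w)
      (fun K _ => T_summand_nonneg hm hu hΛ η K w) (Finset.mem_univ K)
  have h7 := rLoc_nonneg (D := D) hm hu K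
  calc S.mh x y * (w (Sum.inr σ) - w (Sum.inl K)) ^ 2
      ≤ q * D.rLoc m K u * (w (Sum.inr σ) - w (Sum.inl K)) ^ 2 := by gcongr
    _ = q / c * (D.rLoc m K u * (c * (w (Sum.inr σ) - w (Sum.inl K)) ^ 2)) := by field_simp
    _ ≤ q / c * (D.rLoc m K u * D.aLoc η Λ K w w) := by gcongr
    _ ≤ _ := by gcongr

/-- Densities bounded away from `0` and `a`, from a bound on the dissipation. -/
theorem exists_abs_h_le (S : Statistics) (hd : 1 ≤ d) (D : Discretisation dom 𝓜 𝓔) (b C : ℝ) :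
    ∃ B, ∀ u w : Vec 𝓜 𝓔, (∀ i, u i ∈ S.I) → w ∈ D.V0 → (∀ i, |S.h (u i) - w i| ≤ b) →
      (∀ K, ∀ σ ∈ D.facesOf K, S.mh (u (Sum.inl K)) (u (Sum.inr σ)) *
        (w (Sum.inr σ) - w (Sum.inl K)) ^ 2 ≤ C) → ∀ i, |S.h (u i)| ≤ B := by
  have key : ∀ i, ∃ B, ∀ u w : Vec 𝓜 𝓔, (∀ i, u i ∈ S.I) → w ∈ D.V0 →
      (∀ i, |S.h (u i) - w i| ≤ b) →
      (∀ K, ∀ σ ∈ D.facesOf K, S.mh (u (Sum.inl K)) (u (Sum.inr σ)) *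
        (w (Sum.inr σ) - w (Sum.inl K)) ^ 2 ≤ C) → |S.h (u i)| ≤ B := by
    have hdiff : ∀ u w : Vec 𝓜 𝓔, (∀ i, |S.h (u i) - w i| ≤ b) → ∀ i j,
        |S.h (u i) - S.h (u j)| ≤ |w i - w j| + 2 * b := by
      intro u w h i j
      have := abs_add_three (w i - w j) (S.h (u i) - w i) (w j - S.h (u j))
      rw [show w i - w j + (S.h (u i) - w i) + (w j - S.h (u j)) = S.h (u i) - S.h (u j) by ring,
        abs_sub_comm (w j)] at this
      linarith [h i, h j]
    -- On Dirichlet faces w = 0, so |h(u)| ≤ b. Passing to a neighbour enlarges B by an explicit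
    -- amount; the symmetry of m_h allows both directions.
    refine D.mesh_induction hd (fun σ hσ => ⟨b, fun u w hu hw hb _ => ?_⟩) fun K σ hσ => ⟨?_, ?_⟩
    · simpa [hw σ hσ] using hb (Sum.inr σ)
    · rintro ⟨B, hB⟩
      refine ⟨B + max (max 1 (2 * (2 * b))) (4 * C / S.g (-B - 1)), fun u w hu hw hb hC => ?_⟩
      refine S.abs_h_le_of_mh_mul_sq_le (C := C) (hu _) (hu (Sum.inl K)) (hB u w hu hw hb hC)
        (hdiff u w hb _ _) (abs_nonneg _) ?_
      rw [sq_abs, S.mh_comm]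
      exact hC K σ hσ
    · rintro ⟨B, hB⟩
      refine ⟨B + max (max 1 (2 * (2 * b))) (4 * C / S.g (-B - 1)), fun u w hu hw hb hC => ?_⟩
      refine S.abs_h_le_of_mh_mul_sq_le (C := C) (hu _) (hu (Sum.inr σ)) (hB u w hu hw hb hC)
        (hdiff u w hb _ _) (abs_nonneg _) ?_
      rw [sq_abs, ← neg_sub, neg_sq]
      exact hC K σ hσ
  choose B hB using key
  obtain ⟨B₀, -, hle⟩ := exists_le_of_finite B
  exact ⟨B₀, fun u w hu hw hb hC i => (hB i u w hu hw hb hC).trans (hle i)⟩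

/-- The dissipation controls `w` as long as the densities are bounded away from `0`. -/
theorem exists_sq_le_T (hm : S.IsMean m) (hd : 1 ≤ d) {η : ℝ} (hη : 0 < η)
    (hΛ : D.IsElliptic Λ) (B : ℝ) :
    ∃ C > 0, ∀ u w : Vec 𝓜 𝓔, (∀ i, u i ∈ S.I) → (∀ i, |S.h (u i)| ≤ B) → w ∈ D.V0 →
      ∀ i, w i ^ 2 ≤ C * D.T η m Λ u w w := by
  obtain ⟨c, hc, hloc⟩ := hΛ.exists_localJumps_le hd hη
  obtain ⟨C, hC, hPoinc⟩ := D.exists_sq_le_jumps hd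
  have hg := S.g_pos (-B)
  refine ⟨C / (S.g (-B) * c), by positivity, fun u w hu hB hw i => ?_⟩
  have hgu : ∀ i, S.g (-B) ≤ u i := fun i => (S.le_h_iff (hu i)).1 (abs_le.1 (hB i)).1
  have hr : ∀ K, S.g (-B) * c * D.localJumps K w ≤ D.rLoc m K u * D.aLoc η Λ K w w := by
    intro K
    rcases (D.facesOf K).eq_empty_or_nonempty with he | hne
    · simp [localJumps, rLoc, he]
    · have hpos : (0 : ℝ) < (D.facesOf K).card := by exact_mod_cast Finset.card_pos.2 hne
      -- Every mean dominates the smaller of its arguments, and all densities are at least g(−B).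
      have h1 : S.g (-B) ≤ D.rLoc m K u := by
        rw [rLoc, le_div_iff₀ hpos, mul_comm, ← nsmul_eq_mul]
        refine Finset.card_nsmul_le_sum _ _ _ fun σ _ => ?_
        exact (le_min (hgu _) (hgu _)).trans
          ((S.min_le_mh (hu _) (hu _)).trans (hm.mh_le _ (hu _) _ (hu _)))
      have h2 := D.localJumps_nonneg K w
      calc S.g (-B) * c * D.localJumps K w = S.g (-B) * (c * D.localJumps K w) := by ring
        _ ≤ D.rLoc m K u * D.aLoc η Λ K w w :=
          mul_le_mul h1 (hloc K w) (by positivity) (hg.le.trans h1)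
  calc w i ^ 2 ≤ C * ∑ K, D.localJumps K w := hPoinc w hw i
    _ = C / (S.g (-B) * c) * ∑ K, S.g (-B) * c * D.localJumps K w := by
        rw [← Finset.mul_sum]; field_simp
    _ ≤ _ := by
        refine mul_le_mul_of_nonneg_left ?_ (by positivity)
        exact Finset.sum_le_sum fun K _ => hr K

end Discretisation

/-! ### Entropy -/

section Entropy

variable {d : ℕ} {dom : Domain d} {𝓜 𝓔 : Type*} [Fintype 𝓜] [Fintype 𝓔]
  {data : PhysicalData dom} {D : Discretisation dom 𝓜 𝓔} {η Δt : ℝ} {m : ℝ → ℝ → ℝ}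

theorem entropy_eq (Ne Pe φe N P φ : Vec 𝓜 𝓔) :
    entropy data D η Ne Pe φe N P φ =
      ∑ K, D.cellMeas K * data.stat.relH (N (Sum.inl K)) (Ne (Sum.inl K))
      + ∑ K, D.cellMeas K * data.stat.relH (P (Sum.inl K)) (Pe (Sum.inl K))
      + 1 / 2 * D.aForm η data.Λφ (φ - φe) (φ - φe) := by
  rw [entropy, D.setIntegral_const_cells fun K x hx => by
      rw [D.recon_apply N hx, D.recon_apply Ne hx],
    D.setIntegral_const_cells fun K x hx => by
      rw [D.recon_apply P hx, D.recon_apply Pe hx]]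

theorem l2NormSq_recon_sub (u v : Vec 𝓜 𝓔) :
    l2NormSq dom.Ω (fun x => D.recon u x - D.recon v x)
      = ∑ K, D.cellMeas K * (u (Sum.inl K) - v (Sum.inl K)) ^ 2 :=
  D.setIntegral_const_cells fun K x hx => by
    beta_reduce
    rw [D.recon_apply u hx, D.recon_apply v hx]

theorem PhysicalData.integrableOn_R {n p : ℝ} (hn : n ∈ data.stat.I) (hp : p ∈ data.stat.I)
    (K : 𝓜) : IntegrableOn (fun x => data.R x n p) (D.cell K) :=
  ((data.r_integrable n hn p hp).mono_set (D.cell_subset K)).mul_const _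

/-- Recombination dissipates the entropy. -/
theorem PhysicalData.integral_R_mul_nonneg {n p : ℝ} (hn : n ∈ data.stat.I)
    (hp : p ∈ data.stat.I) (K : 𝓜) :
    0 ≤ (∫ x in D.cell K, data.R x n p) *
      (data.stat.h n + data.stat.h p - (data.αN + data.αP)) := by
  simp only [PhysicalData.R, integral_mul_const]
  -- Either r vanishes almost everywhere and so does the integral, or α_N + α_P = 0 and the sign is
  -- that of (exp(s) − 1)s.
  by_cases hr : ∀ n ∈ data.stat.I, ∀ p ∈ data.stat.I, ∀ᵐ x ∂volume.restrict dom.Ω, data.r x n p = 0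
  · rw [integral_eq_zero_of_ae (ae_mono (restrict_cell_le D K) (hr n hn p hp))]
    simp
  · rw [data.compat_r hr, sub_zero, mul_assoc]
    refine mul_nonneg (setIntegral_nonneg (D.cell_isOpen K).measurableSet fun x hx =>
      data.r_nonneg x (D.cell_subset K hx) n hn p hp) ?_
    set s := data.stat.h n + data.stat.h p
    rcases le_total 0 s with hs | hs
    · exact mul_nonneg (by linarith [Real.add_one_le_exp s]) hs
    · exact mul_nonneg_of_nonpos_of_nonpos (by linarith [Real.exp_le_one_iff.2 hs]) hs

variable {N P φ : ℕ → Vec 𝓜 𝓔}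

namespace IsSolution

theorem isPoisson (h : IsSolution data D η m Δt N P φ) (n : ℕ) :
    IsPoisson data D η (N n) (P n) (φ n) := by
  refine isPoisson_iff.2 fun v hv => ?_
  rw [← D.setIntegral_const_cells (F := fun x => (D.recon (P n) x - D.recon (N n) x) * D.recon v x)
    fun K x hx => by rw [D.recon_apply _ hx, D.recon_apply _ hx, D.recon_apply _ hx]]
  linarith [h.poisson n v hv]

theorem average_mem_Icc {lo hi : ℝ} {f : Pt d → ℝ} (hf : MemLp f ⊤ (volume.restrict dom.Ω))
    (h : ∀ᵐ x ∂volume.restrict dom.Ω, f x ∈ Icc lo hi) (K : 𝓜) :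
    ⨍ x in D.cell K, f x ∈ Icc lo hi := by
  have : IsFiniteMeasure ((volume : Measure (Pt d)).restrict (D.cell K)) :=
    ⟨by simpa using D.volume_cell_lt_top K⟩
  exact (convex_Icc lo hi).set_average_mem isClosed_Icc (D.volume_cell_pos K).ne'
    (D.volume_cell_lt_top K).ne (ae_mono (restrict_cell_le D K) h)
    ((hf.mono_measure (restrict_cell_le D K)).integrable le_top)

theorem _root_.HFV.PhysicalData.exists_initial_bound (data : PhysicalData dom)
    (D : Discretisation dom 𝓜 𝓔) :
    ∃ B, ∀ K, (⨍ x in D.cell K, data.Nin x) ∈ data.stat.I ∧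
      (⨍ x in D.cell K, data.Pin x) ∈ data.stat.I ∧
      |data.stat.h (⨍ x in D.cell K, data.Nin x)| ≤ B ∧
      |data.stat.h (⨍ x in D.cell K, data.Pin x)| ≤ B := by
  obtain ⟨lo, hi, hlo, hlohi, hhi, hb⟩ := data.bounds
  have hloI : lo ∈ data.stat.I := ⟨hlo, (EReal.coe_lt_coe_iff.2 hlohi).trans hhi⟩
  have hhiI : hi ∈ data.stat.I := ⟨hlo.trans hlohi, hhi⟩
  have hsub : Icc lo hi ⊆ data.stat.I := data.stat.ordConnected_I.out hloI hhiI
  have hbd : ∀ x ∈ Icc lo hi, |data.stat.h x| ≤ max |data.stat.h lo| |data.stat.h hi| := by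
    intro x hx
    have hmono := data.stat.strictMonoOn_h.monotoneOn
    exact abs_le_max_abs_abs (hmono hloI (hsub hx) hx.1) (hmono (hsub hx) hhiI hx.2)
  refine ⟨max |data.stat.h lo| |data.stat.h hi|, fun K => ?_⟩
  have h1 := average_mem_Icc (D := D) data.Nin_memLp (hb.mono fun x hx => hx.1) K
  have h2 := average_mem_Icc (D := D) data.Pin_memLp (hb.mono fun x hx => hx.2.1) K
  exact ⟨hsub h1, hsub h2, hbd _ h1, hbd _ h2⟩

theorem cell_mem (h : IsSolution data D η m Δt N P φ) (n : ℕ) (K : 𝓜) :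
    N n (Sum.inl K) ∈ data.stat.I ∧ P n (Sum.inl K) ∈ data.stat.I := by
  rcases n with _ | n
  · obtain ⟨B, hB⟩ := data.exists_initial_bound D
    rw [h.init_N, h.init_P]
    exact ⟨(hB K).1, (hB K).2.1⟩
  · exact ⟨h.mem_N n _, h.mem_P n _⟩

theorem balance_N (h : IsSolution data D η m Δt N P φ) (n : ℕ) {v : Vec 𝓜 𝓔} (hv : v ∈ D.V0) :
    ∑ K, D.cellMeas K * ((N (n + 1) (Sum.inl K) - N n (Sum.inl K)) / Δt * v (Sum.inl K))
      + D.T η m data.ΛN (N (n + 1)) (wN data (N (n + 1)) (φ (n + 1))) v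
      = - ∑ K, (∫ x in D.cell K, data.R x (N (n + 1) (Sum.inl K)) (P (n + 1) (Sum.inl K)))
          * v (Sum.inl K) := by
  have h1 := h.eq_N n v hv
  rw [D.setIntegral_const_cells fun K x hx => by
      rw [D.recon_apply _ hx, D.recon_apply _ hx, D.recon_apply _ hx],
    D.setIntegral_eq_sum (f := fun K x =>
      data.R x (N (n + 1) (Sum.inl K)) (P (n + 1) (Sum.inl K)) * v (Sum.inl K))
      (fun K x hx => by rw [D.recon_apply _ hx, D.recon_apply _ hx, D.recon_apply _ hx])
      fun K => (data.integrableOn_R (h.mem_N n _) (h.mem_P n _) K).mul_const _] at h1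
  simpa only [integral_mul_const] using h1

theorem balance_P (h : IsSolution data D η m Δt N P φ) (n : ℕ) {v : Vec 𝓜 𝓔} (hv : v ∈ D.V0) :
    ∑ K, D.cellMeas K * ((P (n + 1) (Sum.inl K) - P n (Sum.inl K)) / Δt * v (Sum.inl K))
      + D.T η m data.ΛP (P (n + 1)) (wP data (P (n + 1)) (φ (n + 1))) v
      = - ∑ K, (∫ x in D.cell K, data.R x (N (n + 1) (Sum.inl K)) (P (n + 1) (Sum.inl K)))
          * v (Sum.inl K) := by
  have h1 := h.eq_P n v hv
  rw [D.setIntegral_const_cells fun K x hx => by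
      rw [D.recon_apply _ hx, D.recon_apply _ hx, D.recon_apply _ hx],
    D.setIntegral_eq_sum (f := fun K x =>
      data.R x (N (n + 1) (Sum.inl K)) (P (n + 1) (Sum.inl K)) * v (Sum.inl K))
      (fun K x hx => by rw [D.recon_apply _ hx, D.recon_apply _ hx, D.recon_apply _ hx])
      fun K => (data.integrableOn_R (h.mem_N n _) (h.mem_P n _) K).mul_const _] at h1
  simpa only [integral_mul_const] using h1

end IsSolution

theorem IsThermalEquilibrium.sub_mem_V0 {Ne Pe φe : Vec 𝓜 𝓔}
    (he : IsThermalEquilibrium data D η Ne Pe φe) (h : IsSolution data D η m Δt N P φ) (n : ℕ) :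
    φ n - φe ∈ D.V0 := by
  have := Discretisation.sub_mem_V0 (h.psi_mem n) he.psi_mem
  rwa [sub_sub_sub_cancel_right] at this

/-- All solutions have the same initial entropy. -/
theorem IsSolution.entropy_zero_eq (hd : 1 ≤ d) (hη : 0 < η) {N' P' φ' : ℕ → Vec 𝓜 𝓔}
    (h : IsSolution data D η m Δt N P φ) (h' : IsSolution data D η m Δt N' P' φ')
    (Ne Pe φe : Vec 𝓜 𝓔) : entropy data D η Ne Pe φe (N 0) (P 0) (φ 0)
      = entropy data D η Ne Pe φe (N' 0) (P' 0) (φ' 0) := by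
  have hv : φ 0 - φ' 0 ∈ D.V0 := by
    have := Discretisation.sub_mem_V0 (h.psi_mem 0) (h'.psi_mem 0)
    rwa [sub_sub_sub_cancel_right] at this
  -- The initial cell densities are prescribed averages, so both Poisson equations have the same
  -- charge and determine the same φ^0.
  have hφ : φ 0 - φ' 0 = 0 := by
    refine eq_zero_of_aForm_self_nonpos (data := data) hd hη hv ?_
    rw [(h.isPoisson 0).sub (h'.isPoisson 0) hv]
    refine (Finset.sum_eq_zero fun K _ => ?_).le
    rw [h.init_N, h'.init_N, h.init_P, h'.init_P]
    ring
  simp only [entropy_eq, h.init_N, h'.init_N, h.init_P, h'.init_P, sub_eq_zero.1 hφ]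

section Dissipation

variable {Ne Pe φe : Vec 𝓜 𝓔}

/-- Entropy dissipation. -/
theorem IsSolution.entropy_add_le (hΔt : 0 < Δt) (h : IsSolution data D η m Δt N P φ)
    (he : IsThermalEquilibrium data D η Ne Pe φe) (n : ℕ) :
    entropy data D η Ne Pe φe (N (n + 1)) (P (n + 1)) (φ (n + 1))
      + Δt * (D.T η m data.ΛN (N (n + 1)) (wN data (N (n + 1)) (φ (n + 1)))
            (wN data (N (n + 1)) (φ (n + 1)))
          + D.T η m data.ΛP (P (n + 1)) (wP data (P (n + 1)) (φ (n + 1)))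
            (wP data (P (n + 1)) (φ (n + 1))))
      ≤ entropy data D η Ne Pe φe (N n) (P n) (φ n) := by
  obtain ⟨-, heN, heP, -⟩ := isThermalEquilibrium_iff.1 he
  set w := wN data (N (n + 1)) (φ (n + 1)) with hw
  set z := wP data (P (n + 1)) (φ (n + 1)) with hz
  have hψ : φ (n + 1) - φe ∈ D.V0 := he.sub_mem_V0 h (n + 1)
  -- With x = φ^{n+1} − φ^e and y = φ^{n+1} − φ^n, ½a(x, x) − ½a(x − y, x − y) = a(y, x) − ½a(y, y).
  -- The Poisson equation then expresses a(y, x) through density increments.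
  have ea : 1 / 2 * D.aForm η data.Λφ (φ (n + 1) - φe) (φ (n + 1) - φe)
      - 1 / 2 * D.aForm η data.Λφ (φ n - φe) (φ n - φe)
      ≤ D.aForm η data.Λφ (φ (n + 1) - φ n) (φ (n + 1) - φe) := by
    have h0 := (data.isElliptic_Λφ D).aForm_self_nonneg η (φ (n + 1) - φ n)
    have hs := data.aForm_Λφ_comm D η (φ (n + 1) - φe) (φ (n + 1) - φ n)
    have hφ : φ n - φe = (φ (n + 1) - φe) - (φ (n + 1) - φ n) := by abel
    rw [hφ]
    simp only [← (data.isElliptic_Λφ D).bilin_apply] at h0 hs ⊢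
    rw [map_sub (((data.isElliptic_Λφ D).bilin η)) (φ (n + 1) - φe) (φ (n + 1) - φ n),
      LinearMap.sub_apply,
      map_sub _ (φ (n + 1) - φe) (φ (n + 1) - φ n),
      map_sub _ (φ (n + 1) - φe) (φ (n + 1) - φ n), hs]
    linarith
  rw [(h.isPoisson (n + 1)).sub (h.isPoisson n) hψ] at ea
  -- Since h(N^e) = α_N + φ^e, the factor h(N^{n+1}) − h(N^e) is w + (φ^{n+1} − φ^e). Its φ part,
  -- together with that of P, cancels the increments coming from `ea`.
  have eN : ∀ K, data.stat.relH (N (n + 1) (Sum.inl K)) (Ne (Sum.inl K))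
      - data.stat.relH (N n (Sum.inl K)) (Ne (Sum.inl K))
      ≤ (w (Sum.inl K) + (φ (n + 1) - φe) (Sum.inl K))
        * (N (n + 1) (Sum.inl K) - N n (Sum.inl K)) := by
    intro K
    refine (data.stat.relH_sub_relH_le (h.cell_mem n K).1 (h.mem_N n _)).trans_eq ?_
    rw [heN, data.stat.h_g, hw, wN, Pi.sub_apply]
    ring
  have eP : ∀ K, data.stat.relH (P (n + 1) (Sum.inl K)) (Pe (Sum.inl K))
      - data.stat.relH (P n (Sum.inl K)) (Pe (Sum.inl K))
      ≤ (z (Sum.inl K) - (φ (n + 1) - φe) (Sum.inl K))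
        * (P (n + 1) (Sum.inl K) - P n (Sum.inl K)) := by
    intro K
    refine (data.stat.relH_sub_relH_le (h.cell_mem n K).2 (h.mem_P n _)).trans_eq ?_
    rw [heP, data.stat.h_g, hz, wP, Pi.sub_apply]
    ring
  have bN := h.balance_N n (h.wN_mem n)
  have bP := h.balance_P n (h.wP_mem n)
  rw [← hw] at bN
  rw [← hz] at bP
  -- The sum w^N + w^P equals h(N) + h(P) − (α_N + α_P), the factor whose product with the
  -- recombination integral is nonnegative.
  have hR : 0 ≤ ∑ K, ((∫ x in D.cell K, data.R x (N (n + 1) (Sum.inl K)) (P (n + 1) (Sum.inl K)))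
        * w (Sum.inl K)
      + (∫ x in D.cell K, data.R x (N (n + 1) (Sum.inl K)) (P (n + 1) (Sum.inl K)))
        * z (Sum.inl K)) := by
    refine Finset.sum_nonneg fun K _ => ?_
    have := data.integral_R_mul_nonneg (D := D) (h.mem_N n (Sum.inl K)) (h.mem_P n (Sum.inl K)) K
    refine this.trans_eq ?_
    simp only [hw, hz, wN, wP]
    ring
  rw [Finset.sum_add_distrib] at hR
  have tN : ∑ K, D.cellMeas K * ((N (n + 1) (Sum.inl K) - N n (Sum.inl K)) / Δt * w (Sum.inl K))
      = (∑ K, D.cellMeas K * (w (Sum.inl K) * (N (n + 1) (Sum.inl K) - N n (Sum.inl K)))) / Δt := by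
    rw [Finset.sum_div]
    exact Finset.sum_congr rfl fun K _ => by ring
  have tP : ∑ K, D.cellMeas K * ((P (n + 1) (Sum.inl K) - P n (Sum.inl K)) / Δt * z (Sum.inl K))
      = (∑ K, D.cellMeas K * (z (Sum.inl K) * (P (n + 1) (Sum.inl K) - P n (Sum.inl K)))) / Δt := by
    rw [Finset.sum_div]
    exact Finset.sum_congr rfl fun K _ => by ring
  rw [tN] at bN
  rw [tP] at bP
  have hsum : (∑ K, D.cellMeas K * (w (Sum.inl K) * (N (n + 1) (Sum.inl K) - N n (Sum.inl K))))
      + (∑ K, D.cellMeas K * (z (Sum.inl K) * (P (n + 1) (Sum.inl K) - P n (Sum.inl K))))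
      + Δt * (D.T η m data.ΛN (N (n + 1)) w w + D.T η m data.ΛP (P (n + 1)) z z) ≤ 0 := by
    set X := ∑ K, D.cellMeas K * (w (Sum.inl K) * (N (n + 1) (Sum.inl K) - N n (Sum.inl K)))
    set Y := ∑ K, D.cellMeas K * (z (Sum.inl K) * (P (n + 1) (Sum.inl K) - P n (Sum.inl K)))
    have h1 : X / Δt + Y / Δt
        + (D.T η m data.ΛN (N (n + 1)) w w + D.T η m data.ΛP (P (n + 1)) z z) ≤ 0 := by
      linarith
    have h2 := mul_nonpos_of_nonneg_of_nonpos hΔt.le h1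
    have h3 : Δt * (X / Δt + Y / Δt
        + (D.T η m data.ΛN (N (n + 1)) w w + D.T η m data.ΛP (P (n + 1)) z z))
      = X + Y + Δt * (D.T η m data.ΛN (N (n + 1)) w w + D.T η m data.ΛP (P (n + 1)) z z) := by
      field_simp
    linarith
  have hrel : ∑ K, D.cellMeas K * data.stat.relH (N (n + 1) (Sum.inl K)) (Ne (Sum.inl K))
      + ∑ K, D.cellMeas K * data.stat.relH (P (n + 1) (Sum.inl K)) (Pe (Sum.inl K))
      + ∑ K, D.cellMeas K * (((P (n + 1) (Sum.inl K) - P n (Sum.inl K))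
          - (N (n + 1) (Sum.inl K) - N n (Sum.inl K))) * (φ (n + 1) - φe) (Sum.inl K))
      ≤ ∑ K, D.cellMeas K * data.stat.relH (N n (Sum.inl K)) (Ne (Sum.inl K))
      + ∑ K, D.cellMeas K * data.stat.relH (P n (Sum.inl K)) (Pe (Sum.inl K))
      + (∑ K, D.cellMeas K * (w (Sum.inl K) * (N (n + 1) (Sum.inl K) - N n (Sum.inl K))))
      + (∑ K, D.cellMeas K * (z (Sum.inl K) * (P (n + 1) (Sum.inl K) - P n (Sum.inl K)))) := by
    simp only [← Finset.sum_add_distrib, ← mul_add]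
    refine Finset.sum_le_sum fun K _ => mul_le_mul_of_nonneg_left ?_ (D.cellMeas_pos K).le
    linarith [eN K, eP K]
  rw [entropy_eq, entropy_eq]
  linarith

end Dissipation

end Entropy

open Discretisation

theorem Statistics.mem_Icc_g (S : Statistics) {x B : ℝ} (hx : x ∈ S.I) (h : |S.h x| ≤ B) :
    x ∈ Icc (S.g (-B)) (S.g B) :=
  ⟨(S.le_h_iff hx).1 (abs_le.1 h).1, (S.h_le_iff hx).1 (abs_le.1 h).2⟩

/-! ### Uniform bounds, entropy–dissipation inequality and control of the L² distance -/

section LongTime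

variable {d : ℕ} {dom : Domain d} {𝓜 𝓔 : Type*} [Fintype 𝓜] [Fintype 𝓔]
  {data : PhysicalData dom} {D : Discretisation dom 𝓜 𝓔} {η Δt : ℝ} {m : ℝ → ℝ → ℝ}
  {Ne Pe φe : Vec 𝓜 𝓔} {N P φ : ℕ → Vec 𝓜 𝓔}

theorem sum_cellMeas_mul_le {f : 𝓜 → ℝ} {C : ℝ} (h : ∀ K, f K ≤ C) :
    ∑ K, D.cellMeas K * f K ≤ (∑ K, D.cellMeas K) * C := by
  rw [Finset.sum_mul]
  exact Finset.sum_le_sum fun K _ => mul_le_mul_of_nonneg_left (h K) (D.cellMeas_pos K).le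

theorem IsThermalEquilibrium.mem (he : IsThermalEquilibrium data D η Ne Pe φe) (i : 𝓜 ⊕ 𝓔) :
    Ne i ∈ data.stat.I ∧ Pe i ∈ data.stat.I := by
  rw [he.eq_N, he.eq_P]
  exact ⟨data.stat.g_mem _, data.stat.g_mem _⟩

theorem IsSolution.relH_nonneg (h : IsSolution data D η m Δt N P φ)
    (he : IsThermalEquilibrium data D η Ne Pe φe) (n : ℕ) :
    0 ≤ ∑ K, D.cellMeas K * data.stat.relH (N n (Sum.inl K)) (Ne (Sum.inl K)) ∧
      0 ≤ ∑ K, D.cellMeas K * data.stat.relH (P n (Sum.inl K)) (Pe (Sum.inl K)) :=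
  ⟨Finset.sum_nonneg fun K _ => mul_nonneg (D.cellMeas_pos K).le
      (data.stat.relH_nonneg (h.cell_mem n K).1 (he.mem _).1),
    Finset.sum_nonneg fun K _ => mul_nonneg (D.cellMeas_pos K).le
      (data.stat.relH_nonneg (h.cell_mem n K).2 (he.mem _).2)⟩

theorem IsSolution.aForm_le_entropy (h : IsSolution data D η m Δt N P φ)
    (he : IsThermalEquilibrium data D η Ne Pe φe) (n : ℕ) :
    D.aForm η data.Λφ (φ n - φe) (φ n - φe) ≤ 2 * entropy data D η Ne Pe φe (N n) (P n) (φ n) := by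
  rw [entropy_eq]
  linarith [h.relH_nonneg he n]

theorem IsSolution.entropy_nonneg (h : IsSolution data D η m Δt N P φ)
    (he : IsThermalEquilibrium data D η Ne Pe φe) (n : ℕ) :
    0 ≤ entropy data D η Ne Pe φe (N n) (P n) (φ n) := by
  linarith [h.aForm_le_entropy he n,
    (data.isElliptic_Λφ D).aForm_self_nonneg η (φ n - φe)]

theorem IsSolution.dissipation_nonneg (hm : data.stat.IsMean m)
    (h : IsSolution data D η m Δt N P φ) (n : ℕ) :
    0 ≤ D.T η m data.ΛN (N (n + 1)) (wN data (N (n + 1)) (φ (n + 1)))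
        (wN data (N (n + 1)) (φ (n + 1))) ∧
      0 ≤ D.T η m data.ΛP (P (n + 1)) (wP data (P (n + 1)) (φ (n + 1)))
        (wP data (P (n + 1)) (φ (n + 1))) :=
  ⟨T_self_nonneg hm (h.mem_N n) (data.isElliptic_ΛN D) η _,
    T_self_nonneg hm (h.mem_P n) (data.isElliptic_ΛP D) η _⟩

theorem IsSolution.entropy_le_zero (hm : data.stat.IsMean m) (hΔt : 0 < Δt)
    (h : IsSolution data D η m Δt N P φ) (he : IsThermalEquilibrium data D η Ne Pe φe) (n : ℕ) :
    entropy data D η Ne Pe φe (N n) (P n) (φ n)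
      ≤ entropy data D η Ne Pe φe (N 0) (P 0) (φ 0) := by
  induction n with
  | zero => exact le_rfl
  | succ n ih =>
    have h1 := h.entropy_add_le hΔt he n
    have h2 := h.dissipation_nonneg hm n
    nlinarith [mul_nonneg hΔt.le (add_nonneg h2.1 h2.2)]

/-- Uniform bounds on the densities of the solutions of the scheme: they stay away from `0` and
`a`. -/
theorem exists_uniform_bound (hd : 1 ≤ d) (hη : 0 < η) (hm : data.stat.IsMean m) (hΔt : 0 < Δt)
    (he : IsThermalEquilibrium data D η Ne Pe φe) :
    ∃ B, ∀ N P φ : ℕ → Vec 𝓜 𝓔, IsSolution data D η m Δt N P φ → ∀ n i,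
      |data.stat.h (N (n + 1) i)| ≤ B ∧ |data.stat.h (P (n + 1) i)| ≤ B := by
  -- The bound must be chosen before the solution. The initial entropy E of any one solution serves
  -- for all of them; without solutions nothing is to be proved.
  by_cases hex : ∃ N P φ : ℕ → Vec 𝓜 𝓔, IsSolution data D η m Δt N P φ
  swap
  · exact ⟨0, fun N P φ h => absurd ⟨N, P, φ, h⟩ hex⟩
  obtain ⟨N₀, P₀, φ₀, h₀⟩ := hex
  set E := entropy data D η Ne Pe φe (N₀ 0) (P₀ 0) (φ₀ 0)
  obtain ⟨c, hc, hcoer⟩ := (data.isElliptic_Λφ D).exists_coercive hd hη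
  obtain ⟨CN, hCN, hN⟩ := exists_mh_mul_sq_le_T hm hd hη (data.isElliptic_ΛN D)
  obtain ⟨CP, hCP, hP⟩ := exists_mh_mul_sq_le_T hm hd hη (data.isElliptic_ΛP D)
  obtain ⟨β, -, hβ⟩ := exists_le_of_finite fun i => |φe i|
  set b := β + (1 + 2 * E / c) + |data.αN| + |data.αP|
  obtain ⟨BN, hBN⟩ := exists_abs_h_le data.stat hd D b (CN * (E / Δt))
  obtain ⟨BP, hBP⟩ := exists_abs_h_le data.stat hd D b (CP * (E / Δt))
  refine ⟨max BN BP, fun N P φ h n => ?_⟩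
  have hE : entropy data D η Ne Pe φe (N 0) (P 0) (φ 0) = E :=
    h.entropy_zero_eq hd hη h₀ Ne Pe φe
  have hφ : ∀ i, |φ (n + 1) i| ≤ β + (1 + 2 * E / c) := by
    intro i
    have h1 := hcoer _ (he.sub_mem_V0 h (n + 1)) i
    have h2 := h.aForm_le_entropy he (n + 1)
    have h3 := h.entropy_le_zero hm hΔt he (n + 1)
    rw [hE] at h3
    rw [Pi.sub_apply] at h1
    have h4 : (φ (n + 1) i - φe i) ^ 2 ≤ 2 * E / c := by
      rw [le_div_iff₀ hc]; linarith
    -- From t ≤ 1 + t².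
    have h5 : |φ (n + 1) i - φe i| ≤ 1 + 2 * E / c := by
      rw [← sq_abs] at h4
      nlinarith [sq_nonneg (|φ (n + 1) i - φe i| - 1), abs_nonneg (φ (n + 1) i - φe i)]
    have h6 := abs_add_le (φe i) (φ (n + 1) i - φe i)
    rw [add_sub_cancel] at h6
    linarith [hβ i]
  -- One step dissipates at most the entropy available, which is nonnegative and never exceeds E.
  have hdiss : D.T η m data.ΛN (N (n + 1)) (wN data (N (n + 1)) (φ (n + 1)))
        (wN data (N (n + 1)) (φ (n + 1))) + D.T η m data.ΛP (P (n + 1))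
          (wP data (P (n + 1)) (φ (n + 1))) (wP data (P (n + 1)) (φ (n + 1))) ≤ E / Δt := by
    rw [le_div_iff₀' hΔt]
    linarith [h.entropy_add_le hΔt he n, h.entropy_nonneg he (n + 1), h.entropy_le_zero hm hΔt he n]
  obtain ⟨hTN, hTP⟩ := h.dissipation_nonneg hm n
  refine fun i => ⟨(hBN _ _ (h.mem_N n) (h.wN_mem n) (fun i => ?_) (fun K σ hσ => ?_) i).trans
    (le_max_left _ _), (hBP _ _ (h.mem_P n) (h.wP_mem n) (fun i => ?_) (fun K σ hσ => ?_) i).trans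
    (le_max_right _ _)⟩
  · rw [wN, show ∀ x : ℝ, x - (x - φ (n + 1) i - data.αN) = φ (n + 1) i + data.αN from
      fun x => by ring]
    linarith [abs_add_le (φ (n + 1) i) data.αN, hφ i, abs_nonneg data.αP]
  · exact (hN _ (h.mem_N n) _ K σ hσ).trans (mul_le_mul_of_nonneg_left (by linarith) hCN.le)
  · rw [wP, show ∀ x : ℝ, x - (x + φ (n + 1) i - data.αP) = data.αP - φ (n + 1) i from
      fun x => by ring]
    linarith [abs_sub data.αP (φ (n + 1) i), hφ i, abs_nonneg data.αN]
  · exact (hP _ (h.mem_P n) _ K σ hσ).trans (mul_le_mul_of_nonneg_left (by linarith) hCP.le)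

/-- All densities, including the initial and the equilibrium ones, lie in a fixed compact
subinterval of `I_h`. -/
theorem exists_uniform_Icc (hd : 1 ≤ d) (hη : 0 < η) (hm : data.stat.IsMean m) (hΔt : 0 < Δt)
    (he : IsThermalEquilibrium data D η Ne Pe φe) :
    ∃ l ∈ data.stat.I, ∃ u ∈ data.stat.I,
      (∀ i, Ne i ∈ Icc l u ∧ Pe i ∈ Icc l u) ∧
      ∀ N P φ : ℕ → Vec 𝓜 𝓔, IsSolution data D η m Δt N P φ → ∀ n K,
        N n (Sum.inl K) ∈ Icc l u ∧ P n (Sum.inl K) ∈ Icc l u := by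
  obtain ⟨B₁, hB₁⟩ := exists_uniform_bound hd hη hm hΔt he
  obtain ⟨B₂, hB₂⟩ := data.exists_initial_bound D
  obtain ⟨B₃, -, hB₃⟩ := exists_le_of_finite fun i => |data.stat.h (Ne i)|
  obtain ⟨B₄, -, hB₄⟩ := exists_le_of_finite fun i => |data.stat.h (Pe i)|
  set B := max (max B₁ B₂) (max B₃ B₄)
  have h1 : B₁ ≤ B := (le_max_left _ _).trans (le_max_left _ _)
  have h2 : B₂ ≤ B := (le_max_right _ _).trans (le_max_left _ _)
  have h3 : B₃ ≤ B := (le_max_left _ _).trans (le_max_right _ _)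
  have h4 : B₄ ≤ B := (le_max_right _ _).trans (le_max_right _ _)
  refine ⟨_, data.stat.g_mem (-B), _, data.stat.g_mem B, fun i =>
    ⟨data.stat.mem_Icc_g (he.mem i).1 ((hB₃ i).trans h3),
      data.stat.mem_Icc_g (he.mem i).2 ((hB₄ i).trans h4)⟩, fun N P φ h n K => ?_⟩
  obtain ⟨hN, hP⟩ := h.cell_mem n K
  rcases n with _ | n
  · rw [h.init_N] at hN ⊢
    rw [h.init_P] at hP ⊢
    exact ⟨data.stat.mem_Icc_g hN ((hB₂ K).2.2.1.trans h2),
      data.stat.mem_Icc_g hP ((hB₂ K).2.2.2.trans h2)⟩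
  · have := hB₁ N P φ h n (Sum.inl K)
    exact ⟨data.stat.mem_Icc_g hN (this.1.trans h1), data.stat.mem_Icc_g hP (this.2.trans h1)⟩

/-- Young's inequality with weight κ; the hypothesis turns κx²/2 into half of the monotone product
yx. -/
theorem young_of_mul_sq_le {κ w x y : ℝ} (hκ : 0 < κ) (h : κ * x ^ 2 ≤ y * x) :
    w * x ≤ w ^ 2 / (2 * κ) + y * x / 2 := by
  have h1 : w * x = w ^ 2 / (2 * κ) + κ * x ^ 2 / 2 - (w - κ * x) ^ 2 / (2 * κ) := by
    field_simp; ring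
  have h2 : 0 ≤ (w - κ * x) ^ 2 / (2 * κ) := by positivity
  linarith

/-- The relative entropy is controlled by the quasi-Fermi potentials. -/
theorem IsSolution.entropy_le_quasiFermi (h : IsSolution data D η m Δt N P φ)
    (he : IsThermalEquilibrium data D η Ne Pe φe) {κ : ℝ} (hκ : 0 < κ) (n : ℕ)
    (hN : ∀ K, κ * (N (n + 1) (Sum.inl K) - Ne (Sum.inl K)) ^ 2 ≤
      (data.stat.h (N (n + 1) (Sum.inl K)) - data.stat.h (Ne (Sum.inl K))) *
        (N (n + 1) (Sum.inl K) - Ne (Sum.inl K)))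
    (hP : ∀ K, κ * (P (n + 1) (Sum.inl K) - Pe (Sum.inl K)) ^ 2 ≤
      (data.stat.h (P (n + 1) (Sum.inl K)) - data.stat.h (Pe (Sum.inl K))) *
        (P (n + 1) (Sum.inl K) - Pe (Sum.inl K))) :
    entropy data D η Ne Pe φe (N (n + 1)) (P (n + 1)) (φ (n + 1)) ≤
      ∑ K, D.cellMeas K * ((wN data (N (n + 1)) (φ (n + 1)) (Sum.inl K) ^ 2
        + wP data (P (n + 1)) (φ (n + 1)) (Sum.inl K) ^ 2) / κ) := by
  obtain ⟨-, -, -, hpe⟩ := isThermalEquilibrium_iff.1 he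
  have hA := (h.isPoisson (n + 1)).sub hpe (he.sub_mem_V0 h (n + 1))
  have hA0 := (data.isElliptic_Λφ D).aForm_self_nonneg η (φ (n + 1) - φe)
  -- Put x = N − N^e, y = h(N) − h(N^e) = w + ψ, ψ = φ − φ^e. Absorbing yx/2 leaves yx ≤ w²/κ + 2ψx,
  -- and likewise for P with −ψ. The ψ terms sum to −2a(ψ, ψ) by the Poisson equation, so this sum
  -- appears twice on the left.
  have key : ∑ K, D.cellMeas K * data.stat.relH (N (n + 1) (Sum.inl K)) (Ne (Sum.inl K))
      + ∑ K, D.cellMeas K * data.stat.relH (P (n + 1) (Sum.inl K)) (Pe (Sum.inl K))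
      + (∑ K, D.cellMeas K *
        (((P (n + 1) (Sum.inl K) - Pe (Sum.inl K)) - (N (n + 1) (Sum.inl K) - Ne (Sum.inl K)))
          * (φ (n + 1) - φe) (Sum.inl K))
        + ∑ K, D.cellMeas K *
        (((P (n + 1) (Sum.inl K) - Pe (Sum.inl K)) - (N (n + 1) (Sum.inl K) - Ne (Sum.inl K)))
          * (φ (n + 1) - φe) (Sum.inl K)))
      ≤ ∑ K, D.cellMeas K * ((wN data (N (n + 1)) (φ (n + 1)) (Sum.inl K) ^ 2
        + wP data (P (n + 1)) (φ (n + 1)) (Sum.inl K) ^ 2) / κ) := by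
    simp only [← Finset.sum_add_distrib, ← mul_add]
    refine Finset.sum_le_sum fun K _ => mul_le_mul_of_nonneg_left ?_ (D.cellMeas_pos K).le
    have r1 := data.stat.relH_le (h.mem_N n (Sum.inl K)) (he.mem (Sum.inl K)).1
    have r2 := data.stat.relH_le (h.mem_P n (Sum.inl K)) (he.mem (Sum.inl K)).2
    have y1 := young_of_mul_sq_le (w := wN data (N (n + 1)) (φ (n + 1)) (Sum.inl K)) hκ (hN K)
    have y2 := young_of_mul_sq_le (w := wP data (P (n + 1)) (φ (n + 1)) (Sum.inl K)) hκ (hP K)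
    have wn : data.stat.h (N (n + 1) (Sum.inl K)) - data.stat.h (Ne (Sum.inl K))
        = wN data (N (n + 1)) (φ (n + 1)) (Sum.inl K) + (φ (n + 1) - φe) (Sum.inl K) := by
      rw [he.eq_N, data.stat.h_g, wN, Pi.sub_apply]; ring
    have wp : data.stat.h (P (n + 1) (Sum.inl K)) - data.stat.h (Pe (Sum.inl K))
        = wP data (P (n + 1)) (φ (n + 1)) (Sum.inl K) - (φ (n + 1) - φe) (Sum.inl K) := by
      rw [he.eq_P, data.stat.h_g, wP, Pi.sub_apply]; ring
    rw [wn] at r1 y1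
    rw [wp] at r2 y2
    generalize wN data (N (n + 1)) (φ (n + 1)) (Sum.inl K) = w at *
    generalize wP data (P (n + 1)) (φ (n + 1)) (Sum.inl K) = z at *
    have hw : w ^ 2 / (2 * κ) * 2 = w ^ 2 / κ := by field_simp
    have hz : z ^ 2 / (2 * κ) * 2 = z ^ 2 / κ := by field_simp
    rw [add_div]
    linarith
  rw [entropy_eq]
  linarith

/-- Entropy-entropy dissipation inequality. -/
theorem exists_entropy_le_dissipation (hd : 1 ≤ d) (hη : 0 < η) (hm : data.stat.IsMean m)
    (hΔt : 0 < Δt) (he : IsThermalEquilibrium data D η Ne Pe φe) :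
    ∃ ν > 0, ∀ N P φ : ℕ → Vec 𝓜 𝓔, IsSolution data D η m Δt N P φ → ∀ n,
      ν * entropy data D η Ne Pe φe (N (n + 1)) (P (n + 1)) (φ (n + 1)) ≤
        D.T η m data.ΛN (N (n + 1)) (wN data (N (n + 1)) (φ (n + 1)))
            (wN data (N (n + 1)) (φ (n + 1)))
          + D.T η m data.ΛP (P (n + 1)) (wP data (P (n + 1)) (φ (n + 1)))
            (wP data (P (n + 1)) (φ (n + 1))) := by
  obtain ⟨B, hB⟩ := exists_uniform_bound hd hη hm hΔt he
  obtain ⟨l, hl, u, hu, heq, hsol⟩ := exists_uniform_Icc hd hη hm hΔt he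
  obtain ⟨κ, hκ, hκh⟩ := data.stat.exists_mul_sq_le l u hl hu
  obtain ⟨CN, hCN, hTN⟩ := exists_sq_le_T hm hd hη (data.isElliptic_ΛN D) B
  obtain ⟨CP, hCP, hTP⟩ := exists_sq_le_T hm hd hη (data.isElliptic_ΛP D) B
  have hM : 0 ≤ ∑ K, D.cellMeas K := Finset.sum_nonneg fun K _ => (D.cellMeas_pos K).le
  -- E is at most |Ω|(C_N + C_P)D/κ; the added 1 only makes the denominator visibly positive.
  refine ⟨κ / ((∑ K, D.cellMeas K + 1) * (CN + CP)), by positivity, fun N P φ h n => ?_⟩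
  rw [div_mul_eq_mul_div, div_le_iff₀ (by positivity)]
  have h1 := h.entropy_le_quasiFermi he hκ n
    (fun K => hκh _ (hsol N P φ h (n + 1) K).1 _ (heq _).1)
    (fun K => hκh _ (hsol N P φ h (n + 1) K).2 _ (heq _).2)
  obtain ⟨h2, h3⟩ := h.dissipation_nonneg hm n
  have hwN := hTN _ _ (h.mem_N n) (fun i => (hB N P φ h n i).1) (h.wN_mem n)
  have hwP := hTP _ _ (h.mem_P n) (fun i => (hB N P φ h n i).2) (h.wP_mem n)
  set τN := D.T η m data.ΛN (N (n + 1)) (wN data (N (n + 1)) (φ (n + 1)))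
    (wN data (N (n + 1)) (φ (n + 1)))
  set τP := D.T η m data.ΛP (P (n + 1)) (wP data (P (n + 1)) (φ (n + 1)))
    (wP data (P (n + 1)) (φ (n + 1)))
  have h4 := h1.trans (sum_cellMeas_mul_le (D := D) (C := (CN + CP) * (τN + τP) / κ) fun K => by
    refine div_le_div_of_nonneg_right ?_ hκ.le
    nlinarith [hwN (Sum.inl K), hwP (Sum.inl K), mul_nonneg hCN.le h3, mul_nonneg hCP.le h2])
  have h5 : 0 ≤ (CN + CP) * (τN + τP) := by positivity
  calc κ * entropy data D η Ne Pe φe (N (n + 1)) (P (n + 1)) (φ (n + 1))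
      ≤ κ * ((∑ K, D.cellMeas K) * ((CN + CP) * (τN + τP) / κ)) := by gcongr
    _ = (∑ K, D.cellMeas K) * ((CN + CP) * (τN + τP)) := by field_simp
    _ ≤ (∑ K, D.cellMeas K + 1) * ((CN + CP) * (τN + τP)) := by gcongr; linarith
    _ = _ := by ring

/-- The relative entropy controls the `L²` distance to the equilibrium. -/
theorem exists_l2NormSq_le_entropy (hd : 1 ≤ d) (hη : 0 < η) (hm : data.stat.IsMean m)
    (hΔt : 0 < Δt) (he : IsThermalEquilibrium data D η Ne Pe φe) :
    ∃ c > 0, ∀ N P φ : ℕ → Vec 𝓜 𝓔, IsSolution data D η m Δt N P φ → ∀ n,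
      l2NormSq dom.Ω (fun x => D.recon (N n) x - D.recon Ne x)
        + l2NormSq dom.Ω (fun x => D.recon (P n) x - D.recon Pe x)
        + l2NormSq dom.Ω (fun x => D.recon (φ n) x - D.recon φe x)
        ≤ c * entropy data D η Ne Pe φe (N n) (P n) (φ n) := by
  obtain ⟨l, hl, u, hu, heq, hsol⟩ := exists_uniform_Icc hd hη hm hΔt he
  obtain ⟨κ, hκ, hκh⟩ := data.stat.exists_mul_sq_le_relH l u hl hu
  obtain ⟨c, hc, hcoer⟩ := (data.isElliptic_Λφ D).exists_coercive hd hη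
  have hM : 0 ≤ ∑ K, D.cellMeas K := Finset.sum_nonneg fun K _ => (D.cellMeas_pos K).le
  -- Strong convexity of H gives κ⁻¹ for the two densities; coercivity and a(φ − φ^e, φ − φ^e) ≤ 2E
  -- give |Ω|·2/c for the potential.
  refine ⟨κ⁻¹ + (∑ K, D.cellMeas K) * (2 / c), by positivity, fun N P φ h n => ?_⟩
  obtain ⟨r1, r2⟩ := h.relH_nonneg he n
  have hA := h.aForm_le_entropy he n
  have hA0 := (data.isElliptic_Λφ D).aForm_self_nonneg η (φ n - φe)
  set E := entropy data D η Ne Pe φe (N n) (P n) (φ n) with hE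
  rw [entropy_eq] at hE
  simp only [l2NormSq_recon_sub]
  have hφ : ∑ K, D.cellMeas K * (φ n (Sum.inl K) - φe (Sum.inl K)) ^ 2
      ≤ (∑ K, D.cellMeas K) * (2 / c * E) := by
    refine sum_cellMeas_mul_le fun K => ?_
    rw [div_mul_eq_mul_div, le_div_iff₀' hc]
    exact (hcoer _ (he.sub_mem_V0 h n) (Sum.inl K)).trans hA
  have hdens : ∀ {x y : 𝓜 → ℝ}, (∀ K, x K ∈ Icc l u) → (∀ K, y K ∈ Icc l u) →
      ∑ K, D.cellMeas K * (x K - y K) ^ 2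
        ≤ κ⁻¹ * ∑ K, D.cellMeas K * data.stat.relH (x K) (y K) := by
    intro x y hx hy
    rw [Finset.mul_sum]
    refine Finset.sum_le_sum fun K _ => ?_
    rw [mul_left_comm]
    refine mul_le_mul_of_nonneg_left ?_ (D.cellMeas_pos K).le
    rw [inv_mul_eq_div, le_div_iff₀' hκ]
    exact hκh _ (hx K) _ (hy K)
  have hN := hdens (fun K => (hsol N P φ h n K).1) fun K => (heq (Sum.inl K)).1
  have hP := hdens (fun K => (hsol N P φ h n K).2) fun K => (heq (Sum.inl K)).2
  have hNP : κ⁻¹ * ∑ K, D.cellMeas K * data.stat.relH (N n (Sum.inl K)) (Ne (Sum.inl K))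
      + κ⁻¹ * ∑ K, D.cellMeas K * data.stat.relH (P n (Sum.inl K)) (Pe (Sum.inl K))
      ≤ κ⁻¹ * E := by
    rw [← mul_add]
    exact mul_le_mul_of_nonneg_left (by linarith) (by positivity)
  linarith

end LongTime

end HFV

/-! ### Exponential decay to the discrete equilibrium -/

theorem theorem4p5 {d : ℕ} (hd : 1 ≤ d ∧ d ≤ 3) (dom : HFV.Domain d)
    (data : HFV.PhysicalData dom) {𝓜 𝓔 : Type*} [Fintype 𝓜] [Fintype 𝓔]
    (D : HFV.Discretisation dom 𝓜 𝓔) (η : ℝ) (hη : 0 < η)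
    (m : ℝ → ℝ → ℝ) (hm : data.stat.IsMean m) (Δt : ℝ) (hΔt : 0 < Δt) :
    (∃! e : HFV.Vec 𝓜 𝓔 × HFV.Vec 𝓜 𝓔 × HFV.Vec 𝓜 𝓔,
      HFV.IsThermalEquilibrium data D η e.1 e.2.1 e.2.2) ∧
    ∃ ν > (0 : ℝ), ∃ c > (0 : ℝ),
      ∀ Ne Pe φe : HFV.Vec 𝓜 𝓔, HFV.IsThermalEquilibrium data D η Ne Pe φe →
      ∀ N P φ : ℕ → HFV.Vec 𝓜 𝓔, HFV.IsSolution data D η m Δt N P φ →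
        (∀ n : ℕ,
          HFV.entropy data D η Ne Pe φe (N (n + 1)) (P (n + 1)) (φ (n + 1)) ≤
            (1 + ν * Δt)⁻¹ * HFV.entropy data D η Ne Pe φe (N n) (P n) (φ n)) ∧
        (∀ n : ℕ,
          HFV.l2NormSq dom.Ω (fun x => D.recon (N n) x - D.recon Ne x)
            + HFV.l2NormSq dom.Ω (fun x => D.recon (P n) x - D.recon Pe x)
            + HFV.l2NormSq dom.Ω (fun x => D.recon (φ n) x - D.recon φe x) ≤
          c * HFV.entropy data D η Ne Pe φe (N 0) (P 0) (φ 0) * ((1 + ν * Δt) ^ n)⁻¹) := by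
  obtain ⟨Ne₀, Pe₀, φe₀, he₀⟩ := HFV.exists_isThermalEquilibrium data D hd.1 hη
  refine ⟨⟨(Ne₀, Pe₀, φe₀), he₀, ?_⟩, ?_⟩
  · rintro ⟨Ne, Pe, φe⟩ he
    obtain ⟨rfl, rfl, rfl⟩ := HFV.IsThermalEquilibrium.unique hd.1 hη he he₀
    rfl
  obtain ⟨ν, hν, hdiss⟩ := HFV.exists_entropy_le_dissipation hd.1 hη hm hΔt he₀
  obtain ⟨c, hc, hl2⟩ := HFV.exists_l2NormSq_le_entropy hd.1 hη hm hΔt he₀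
  refine ⟨ν, hν, c, hc, fun Ne Pe φe he N P φ h => ?_⟩
  -- The constants were built from one equilibrium; by uniqueness it is the given one.
  obtain ⟨rfl, rfl, rfl⟩ := HFV.IsThermalEquilibrium.unique hd.1 hη he he₀
  have hpos : 0 < 1 + ν * Δt := by positivity
  have hdecay : ∀ n : ℕ,
      HFV.entropy data D η Ne Pe φe (N (n + 1)) (P (n + 1)) (φ (n + 1)) ≤
        (1 + ν * Δt)⁻¹ * HFV.entropy data D η Ne Pe φe (N n) (P n) (φ n) := by
    intro n
    rw [inv_mul_eq_div, le_div_iff₀ hpos]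
    -- Δt·ν·E^{n+1} ≤ Δt·D^{n+1} ≤ E^n − E^{n+1}.
    have h1 := h.entropy_add_le hΔt he n
    have h2 := mul_le_mul_of_nonneg_left (hdiss N P φ h n) hΔt.le
    linarith
  refine ⟨hdecay, fun n => (hl2 N P φ h n).trans ?_⟩
  rw [mul_assoc]
  refine mul_le_mul_of_nonneg_left ?_ hc.le
  induction n with
  | zero => simp
  | succ n ih =>
    refine (hdecay n).trans ((mul_le_mul_of_nonneg_left ih (inv_nonneg.2 hpos.le)).trans_eq ?_)
    rw [pow_succ, mul_inv]
    ring
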